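/- Let $\varphi:\mathbb{R}^2\to S^2\cong SU_2/T$ be a harmonic map, where $\mathbb R^2=\mathbb C$ has coordinate $z$ and $T$ is the group of diagonal matrices, and let $F:\mathbb{R}^2\to SU_2$ be a smooth framing with $F(0)=I$, $\varphi=F\cdot T$. Write $\alpha=F^{-1}dF=\alpha_{\mathfrak t}+\alpha_{\mathfrak m}$ (diagonal and off-diagonal parts), $\tau=\mathrm{diag}(1,-1)$, and for $\zeta\in\mathbb{C}^*$ $$\alpha_\zeta=\zeta^{-1}\alpha_{\mathfrak m}^{(1,0)}+\alpha_{\mathfrak t}+\zeta\,\alpha_{\mathfrak m}^{(0,1)} .$$ Suppose that $\varphi$ is of semisimple finite type, that is: (a) there is a smooth $a:\mathbb{R}^2\to\mathbb{C}^*$ with $\alpha_{\mathfrak m}(\partial/\partial z)=\mathrm{Ad}\,\mathrm{diag}(a,a^{-1})\cdot\begin{pmatrix}0&1\\1&0\end{pmatrix}$; (b) there is a smooth map $\xi_\zeta(z)$ from $\mathbb{R}^2$ into the analytic maps $\mathbb{C}^*\to\mathfrak{gl}_2(\mathbb{C})$ with $d\xi_\zeta+[\alpha_\zeta,\xi_\zeta]=0$,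 $\xi_{\bar\zeta^{-1}}=-\xi_\zeta^\dagger$, $\xi_{-\zeta}=\mathrm{Ad}\tau\cdot\xi_\zeta$, and such that for every $z$ there is an integer $p\ge1$ for which $\xi_\zeta(z)$ is a Laurent polynomial in $\zeta$ of order $2p+1$ (with terms from $\zeta^{-2p-1}$ to $\zeta^{2p+1}$, both extreme coefficients being non-zero). For $\eta_\zeta$ with $\eta_{-\zeta}=\mathrm{Ad}\tau\cdot\eta_\zeta$ let $\eta_\lambda=\mathrm{Ad}\,\mathrm{diag}(1,\zeta)\cdot\eta_\zeta$, $\lambda=\zeta^2$; this gives $\xi_\lambda(z)$ and $\alpha_\lambda$. Let $$X_A(z)=\{(\lambda,[w])\in\mathbb{C}^*\times\mathbb{P}^1:\ \xi_\lambda(z)w=\mu w\ \text{for some}\ \mu\in\mathbb C\},$$ where at a zero $\lambda_0$ of $\xi_\lambda(z)$ one uses instead the value at $\lambda_0$ of $(\lambda-\lambda_0)^m\xi_\lambda(z)$, with $m$ chosen so that this is regular and non-zero there. Let $X(z)=X_A(z)\cup\{P_0,P_\infty\}\subset\mathbb{P}^1\times\mathbb{P}^1$ with $P_0=(0,[1,0])$,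 $P_\infty=(\infty,[0,1])$. Then there is a family $F_\lambda:\mathbb{R}^2\to GL_2(\mathbb{C})$, $\lambda\in\mathbb{C}^*$ (the extended frame), with $F_\lambda^{-1}dF_\lambda=\alpha_\lambda$ and $F_\lambda(0)=I$. Moreover $p$ can be taken independent of $z$, and there is a constant $c\in\mathbb{C}^*$ such that for all $z$ $$\xi_\zeta=c\,\zeta^{-2p-1}\alpha_{\mathfrak m}(\partial/\partial z)+\dots+\bar c\,\zeta^{2p+1}\alpha_{\mathfrak m}(\partial/\partial\bar z).$$ For every $z\in\mathbb{R}^2$ the complex curves $X(0)$ and $X(z)$ are isomorphic. More precisely there is a bijection $\Phi:X(0)\to X(z)$ such that $\Phi$ and $\Phi^{-1}$ are locally restrictions of holomorphic maps of $\mathbb{P}^1\times\mathbb{P}^1$, with $$\Phi(\lambda,[v])=(\lambda,[F_\lambda(z)^{-1}v])\qquad(\lambda\in\mathbb{C}^*).$$ Furthermore $$H_+=\exp(-c^{-1}z\lambda^p\xi_\lambda(0))F_\lambda(z)\quad\text{and}\quad H_-=\exp(-\bar c^{-1}\bar z\lambda^{-p}\xi_\lambda(0))F_\lambda(z)$$ extend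 to holomorphic $GL_2(\mathbb{C})$-valued maps on $\mathbb{P}^1\setminus\{\infty\}$ and on $\mathbb{P}^1\setminus\{0\}$ respectively, and $\Phi(\lambda,[v])=(\lambda,[H_\pm^{-1}v])$ at every point of $X(0)$ with $\lambda\ne\infty$, respectively $\lambda\neq0$; in particular these formulas give $\Phi$ at and near $P_0$ and $P_\infty$. -/

import Mathlib

open scoped Matrix ContDiff Topology ComplexConjugate Matrix.Norms.Operator Laplacian
open Filter

namespace SpectralCurve

noncomputable section

/-- `ℂ²`. -/
abbrev Vec : Type := Fin 2 → ℂ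

/-- `𝔤𝔩₂(ℂ)`. -/
abbrev Mat : Type := Matrix (Fin 2) (Fin 2) ℂ

/-- The complex projective line. -/
abbrev P1 : Type := Projectivization ℂ Vec

/-! ### Harmonic maps of the plane into the 2-sphere and their framings

The plane `ℝ²` is `ℂ`, with complex coordinate `z`. -/

/-- The matrix `τ = diag(1,-1)`. -/
def tau : Mat := !![1, 0; 0, -1]

/-- `φ : ℝ² → S²` is a (smooth) harmonic map into the unit sphere of `ℝ³`: its tension field, which
is the component of `Δ φ` tangent to the sphere, vanishes. -/
structure IsHarmonicMap (φ : ℂ → EuclideanSpace ℝ (Fin 3)) : Prop where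
  smooth : ContDiff ℝ ∞ φ
  norm_eq_one : ∀ z, ‖φ z‖ = 1
  tension : ∀ z, ∃ c : ℝ, Laplacian.laplacian φ z = c • φ z

/-- The projection `SU₂ → SU₂/T ≃ S²`. The coset `g T` corresponds to the traceless Hermitian
involution `g τ g†`, written here as the vector `x` of the unit sphere of `ℝ³` for which
`g τ g† = !![x₃, x₁ - i x₂; x₁ + i x₂, -x₃]`. -/
def toSphere (g : Mat) : EuclideanSpace ℝ (Fin 3) :=
  !₂[((g * tau * gᴴ) 1 0).re, ((g * tau * gᴴ) 1 0).im, ((g * tau * gᴴ) 0 0).re]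

/-- `F : ℝ² → SU₂` is a smooth framing of `φ` with `F(0) = I`, i.e. `φ = F · T`. -/
structure IsFraming (φ : ℂ → EuclideanSpace ℝ (Fin 3)) (F : ℂ → Mat) : Prop where
  smooth : ContDiff ℝ ∞ F
  mem : ∀ z, F z ∈ Matrix.specialUnitaryGroup (Fin 2) ℂ
  zero : F 0 = 1
  frames : ∀ z, φ z = toSphere (F z)

/-! ### The Maurer-Cartan form and its loop -/

/-- The diagonal part of a matrix. -/
def tPart (M : Mat) : Mat := Matrix.diagonal M.diag

/-- The off-diagonal part of a matrix. -/
def mPart (M : Mat) : Mat := M - tPart M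

/-- `α = F⁻¹ dF` at the point `z`, evaluated on the real tangent vector `X`. -/
def mcForm (F : ℂ → Mat) (z X : ℂ) : Mat := (F z)⁻¹ * fderiv ℝ F z X

/-- `α_𝔪(∂/∂z)`, where `∂/∂z = (∂/∂x - i ∂/∂y)/2`. -/
def alphaMdz (F : ℂ → Mat) (z : ℂ) : Mat :=
  (1 / 2 : ℂ) • (mPart (mcForm F z 1) - Complex.I • mPart (mcForm F z Complex.I))

/-- `α_𝔪(∂/∂z̄)`, where `∂/∂z̄ = (∂/∂x + i ∂/∂y)/2`. -/
def alphaMdzbar (F : ℂ → Mat) (z : ℂ) : Mat :=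
  (1 / 2 : ℂ) • (mPart (mcForm F z 1) + Complex.I • mPart (mcForm F z Complex.I))

/-- The loop of 1-forms `α_ζ = ζ⁻¹ α_𝔪^{(1,0)} + α_𝔱 + ζ α_𝔪^{(0,1)}` at the point `z`, evaluated on
the real tangent vector `X` (so that `dz` and `dz̄` take the values `X` and `conj X`). -/
def loopForm (F : ℂ → Mat) (z X ζ : ℂ) : Mat :=
  (ζ⁻¹ * X) • alphaMdz F z + tPart (mcForm F z X) + (ζ * conj X) • alphaMdzbar F z

/-! ### Semisimple finite type -/

/-- There is a smooth `a : ℝ² → ℂ^*` with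
`α_𝔪(∂/∂z) = Ad diag(a, a⁻¹) · !![0, 1; 1, 0]`. -/
def IsSemisimpleFrame (F : ℂ → Mat) : Prop :=
  ∃ a : ℂ → ℂ, ContDiff ℝ ∞ a ∧ (∀ z, a z ≠ 0) ∧
    ∀ z, alphaMdz F z =
      !![a z, 0; 0, (a z)⁻¹] * !![0, 1; 1, 0] * (!![a z, 0; 0, (a z)⁻¹] : Mat)⁻¹

/-- On `ℂ^*`, `η` is the Laurent polynomial `∑_{|j| ≤ d} ζ^j C_j`. -/
def HasLaurentExpansion (η : ℂ → Mat) (d : ℕ) (C : ℤ → Mat) : Prop :=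
  ∀ ζ : ℂ, ζ ≠ 0 → η ζ = ∑ j ∈ Finset.Icc (-(d : ℤ)) (d : ℤ), ζ ^ j • C j

/-- `η` is a Laurent polynomial of order exactly `d`, with terms from `ζ^{-d}` up to `ζ^d`. -/
def IsLaurentOfOrder (η : ℂ → Mat) (d : ℕ) : Prop :=
  ∃ C : ℤ → Mat, HasLaurentExpansion η d C ∧ C (-(d : ℤ)) ≠ 0 ∧ C (d : ℤ) ≠ 0

/-- `ξ z ζ` (for `ζ ≠ 0`) is a polynomial Killing field for the loop of forms `α_ζ` of `F`.
A smooth map from `ℝ²` to the Fréchet space of holomorphic maps on `ℂ^*` is a map which is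
holomorphic in `ζ` (automatic here) and jointly smooth in `(z, ζ)`. -/
structure IsPolynomialKillingField (F : ℂ → Mat) (ξ : ℂ → ℂ → Mat) : Prop where
  smooth : ContDiffOn ℝ ∞ (fun q : ℂ × ℂ => ξ q.1 q.2) {q | q.2 ≠ 0}
  /-- `dξ_ζ + [α_ζ, ξ_ζ] = 0` -/
  lax : ∀ ζ : ℂ, ζ ≠ 0 → ∀ z X : ℂ,
    fderiv ℝ (fun w => ξ w ζ) z X + (loopForm F z X ζ * ξ z ζ - ξ z ζ * loopForm F z X ζ) = 0
  /-- `ξ_{1/ζ̄} = -ξ_ζ†` -/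
  real : ∀ z ζ : ℂ, ζ ≠ 0 → ξ z (conj ζ)⁻¹ = -(ξ z ζ)ᴴ
  /-- `ξ_{-ζ} = Ad τ · ξ_ζ` -/
  twisted : ∀ z ζ : ℂ, ζ ≠ 0 → ξ z (-ζ) = tau * ξ z ζ * tau⁻¹
  laurent : ∀ z : ℂ, ∃ p : ℕ, 0 < p ∧ IsLaurentOfOrder (ξ z) (2 * p + 1)

/-! ### From `ζ` to `λ = ζ²` -/

/-- The matrix `κ = diag(1, ζ)`. -/
def kappa (ζ : ℂ) : Mat := !![1, 0; 0, ζ]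

/-- `η_λ = Ad κ · η_ζ` with `λ = ζ²`. A square root of `λ` is chosen; for `η` with
`η_{-ζ} = Ad τ · η_ζ` the result does not depend on the choice, see `untwist_sq`. -/
def untwist (η : ℂ → Mat) (l : ℂ) : Mat :=
  kappa (l ^ (1 / 2 : ℂ)) * η (l ^ (1 / 2 : ℂ)) * (kappa (l ^ (1 / 2 : ℂ)))⁻¹

theorem kappa_neg (ζ : ℂ) : kappa (-ζ) = kappa ζ * tau := by
  simp [kappa, tau]

theorem tau_mul_tau : tau * tau = 1 := by
  ext i j
  fin_cases i <;> fin_cases j <;> simp [tau]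

theorem untwist_sq (η : ℂ → Mat) (hη : ∀ ζ, ζ ≠ 0 → η (-ζ) = tau * η ζ * tau⁻¹)
    (ζ : ℂ) (hζ : ζ ≠ 0) : untwist η (ζ ^ 2) = kappa ζ * η ζ * (kappa ζ)⁻¹ := by
  have hinv : tau⁻¹ = tau := Matrix.inv_eq_right_inv tau_mul_tau
  have h : ((ζ ^ 2) ^ (1 / 2 : ℂ)) ^ 2 = ζ ^ 2 := by simp
  rcases sq_eq_sq_iff_eq_or_eq_neg.mp h with h | h
  · simp only [untwist, h]
  · simp only [untwist, h, kappa_neg, hη ζ hζ, Matrix.mul_inv_rev, hinv]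
    calc kappa ζ * tau * (tau * η ζ * tau) * (tau * (kappa ζ)⁻¹)
        = kappa ζ * (tau * tau) * η ζ * (tau * tau) * (kappa ζ)⁻¹ := by
          simp only [Matrix.mul_assoc]
      _ = _ := by simp [tau_mul_tau]

/-- `E z λ` is the extended frame `F_λ(z)`: for each `λ ∈ ℂ^*` it solves
`dF_λ = F_λ α_λ` (i.e. `F_λ⁻¹ dF_λ = α_λ`), `F_λ(0) = I`. -/
structure IsExtendedFrame (F : ℂ → Mat) (E : ℂ → ℂ → Mat) : Prop where
  zero : ∀ l : ℂ, l ≠ 0 → E 0 l = 1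
  differentiable : ∀ l : ℂ, l ≠ 0 → Differentiable ℝ (fun z => E z l)
  isUnit : ∀ l : ℂ, l ≠ 0 → ∀ z : ℂ, IsUnit (E z l)
  deriv : ∀ l : ℂ, l ≠ 0 → ∀ z X : ℂ,
    (E z l)⁻¹ * fderiv ℝ (fun w => E w l) z X = untwist (loopForm F z X) l

/-! ### The quotient spectral curve in `ℙ¹ × ℙ¹` -/

/-- The pair of vectors `y` is a pair of homogeneous coordinates for the point `x ∈ ℙ¹ × ℙ¹`. In the
first factor `λ ∈ ℂ` has homogeneous coordinates `![λ, 1]` and `∞` has `![1, 0]`. -/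
def Represents (y : Vec × Vec) (x : P1 × P1) : Prop :=
  (∃ h : y.1 ≠ 0, x.1 = Projectivization.mk ℂ y.1 h) ∧
    ∃ h : y.2 ≠ 0, x.2 = Projectivization.mk ℂ y.2 h

/-- `N` is the value at `l₀` of the renormalisation `(λ - l₀)^m η_λ` of `η` at `l₀`, with `m` chosen
so that this is regular and non-zero at `l₀`. -/
def IsRenormalizedValue (η : ℂ → Mat) (l₀ : ℂ) (N : Mat) : Prop :=
  N ≠ 0 ∧ ∃ m : ℤ, Tendsto (fun l : ℂ => (l - l₀) ^ m • η l) (𝓝[≠] l₀) (𝓝 N)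

/-- The affine curve `{(λ, [w]) ∈ ℂ^* × ℙ¹ : η_λ w = μ w for some μ}`, where `η` is replaced by its
renormalisation. -/
def affineCurve (η : ℂ → Mat) : Set (P1 × P1) :=
  {x | ∃ l : ℂ, l ≠ 0 ∧ ∃ w : Vec, Represents (![l, 1], w) x ∧
    ∃ N : Mat, IsRenormalizedValue η l N ∧ ∃ μ : ℂ, N *ᵥ w = μ • w}

/-- The completed quotient spectral curve `X(z)`: the affine curve of `ξ_λ(z)` together with the
points `P₀ = (0, [1,0])` and `P_∞ = (∞, [0,1])`. -/
def curve (ξ : ℂ → ℂ → Mat) (z : ℂ) : Set (P1 × P1) :=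
  affineCurve (untwist (ξ z)) ∪
    {x | Represents (![0, 1], ![1, 0]) x} ∪ {x | Represents (![1, 0], ![0, 1]) x}

/-- A map between subsets of `ℙ¹ × ℙ¹` is holomorphic if near each point it is the restriction of a
holomorphic map of the ambient space, written here in homogeneous coordinates. -/
def IsHolomorphicMap {S T : Set (P1 × P1)} (f : S → T) : Prop :=
  ∀ (x : S) (y : Vec × Vec), Represents y x →
    ∃ G : Vec × Vec → Vec × Vec, AnalyticAt ℂ G y ∧
      ∀ᶠ y' in 𝓝 y, ∀ x' : S, Represents y' x' → Represents (G y') (f x')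

/-- An isomorphism of (possibly singular) complex curves in `ℙ¹ × ℙ¹`: a bijection which is
holomorphic in both directions. -/
def IsCurveIso {S T : Set (P1 × P1)} (f : S ≃ T) : Prop :=
  IsHolomorphicMap f ∧ IsHolomorphicMap f.symm

end

end SpectralCurve

/-! The mechanism is a gauge transformation that removes the poles of `α_λ`. If `ξ_ζ = c ζ^{-2p-1}
α_𝔪(∂/∂z) + …` with `c` constant, then in `α_ζ - c⁻¹ ζ^{2p} ξ_ζ dz` the term `ζ⁻¹ α_𝔪^{(1,0)}`
cancels and a polynomial in `ζ` remains. After conjugation by `κ` it is polynomial in `λ` and upper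
triangular at `λ = 0`. The Lax equation makes the new connection flat, so it has a frame `H` that is
entire in `λ`, invertible, and upper triangular at `λ = 0`. The Lax equation also gives `ξ_λ(0) H =
H ξ_λ(z)`, whence `exp(c⁻¹ z λ^p ξ_λ(0)) H` is a frame of `α_λ`: this is the extended frame. The top
coefficient gives in the same way a frame `K`, entire in `s = λ⁻¹` and lower triangular at `s = 0`.

Conjugation by `H` carries the eigenlines of `ξ_λ(0)` to those of `ξ_λ(z)`, also after
renormalisation at zeros, and triangularity fixes `P₀` and `P_∞`. On an eigenvector of `ξ_λ(0)` the
exponential factor is a scalar, so `F_λ⁻¹`, `H⁻¹` and `K⁻¹` induce the same projective map on the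
curve. It is therefore holomorphic near both added points.

Two inputs remain. The degree and `c` must not depend on `z` (`exists_uniform_degree`,
`exists_leading_coeff`). By Baire, the degree is locally constant on a dense open set; there the
leading coefficient commutes with `α_𝔪(∂/∂z)` and is off-diagonal, hence is a multiple of it with
nonzero square. Since `tr ξ²` is independent of `z`, the order of its pole at `ζ = 0` fixes the
degree, and its leading coefficient fixes `c²`; connectedness fixes `c`. Next, `α_ζ` must be flat
for all `ζ`: the extreme coefficients of the Lax equation supply the missing parallelism of
`α_𝔪^{(1,0)}` and `α_𝔪^{(0,1)}` (`isFlat_loop`). Frames holomorphic in a parameter come from radial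
linear ODEs (`exists_flat_frame`, `exists_frame_family`), and the geometric conclusion is
`exists_curve_iso`. -/

namespace SpectralCurve

/-! ### Linear ordinary differential equations -/

section LinearODE

open Set

variable {V : Type*} [NormedAddCommGroup V] [NormedSpace ℝ V]

/-- A continuous inhomogeneous linear differential equation has a solution on `[0,1]`. -/
theorem exists_linear_ode_solution [CompleteSpace V] (L : ℝ → V →L[ℝ] V) (g : ℝ → V)
    (hL : Continuous L) (hg : Continuous g) (y₀ : V) :
    ∃ Y : ℝ → V, Y 0 = y₀ ∧ ∀ t ∈ Icc (0 : ℝ) 1, HasDerivAt Y (L t (Y t) + g t) t := by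
  obtain ⟨K, hKpos, hK⟩ : ∃ K : ℝ, 0 < K ∧ ∀ t ∈ Icc (0 : ℝ) 1, ‖L t‖ ≤ K := by
    obtain ⟨C, hC⟩ := isCompact_Icc.exists_bound_of_continuousOn
      (f := L) (s := Icc (0 : ℝ) 1) hL.continuousOn
    exact ⟨max C 1, by positivity, fun t ht => (hC t ht).trans (le_max_left _ _)⟩
  -- The unknown `U` stands for `e^{-2Kt} Y(t)`. With this weight the Picard operator has Lipschitz
  -- constant `(1 - e^{-2Kt})/2 ≤ 1/2` on the whole interval. Extending `U` by constants outside
  -- `[0,1]` makes the solution two-sidedly differentiable at the endpoints.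
  let ext : C(Icc (0 : ℝ) 1, V) → ℝ → V := fun U => IccExtend zero_le_one U
  have hext : ∀ U, Continuous (ext U) := fun U => U.continuous.Icc_extend'
  let r : C(Icc (0 : ℝ) 1, V) → ℝ → V := fun U s => L s (Real.exp (2 * K * s) • ext U s) + g s
  have hr : ∀ U, Continuous (r U) := fun U => by
    have := hext U
    exact (hL.clm_apply (by fun_prop)).add hg
  let S : C(Icc (0 : ℝ) 1, V) → C(Icc (0 : ℝ) 1, V) := fun U =>
    ⟨fun t => Real.exp (-(2 * K * t)) • (y₀ + ∫ s in (0 : ℝ)..t, r U s), by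
      have h1 : Continuous fun t : ℝ => ∫ s in (0 : ℝ)..t, r U s :=
        intervalIntegral.continuous_primitive (fun a b => (hr U).intervalIntegrable a b) 0
      have h2 := h1.comp (continuous_subtype_val (p := fun t => t ∈ Icc (0 : ℝ) 1))
      simp only [Function.comp_def] at h2
      fun_prop⟩
  have hS : ContractingWith (1 / 2) S := by
    refine ⟨by norm_num [← NNReal.coe_lt_coe], LipschitzWith.of_dist_le_mul fun U W => ?_⟩
    have hd : 0 ≤ dist U W := dist_nonneg
    rw [ContinuousMap.dist_le (by positivity)]
    rintro ⟨t, ht0, ht1⟩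
    have key : ‖∫ s in (0 : ℝ)..t, (r U s - r W s)‖ ≤
        ∫ s in (0 : ℝ)..t, K * Real.exp (2 * K * s) * dist U W := by
      refine intervalIntegral.norm_integral_le_of_norm_le ht0 ?_ ?_
      · refine MeasureTheory.ae_of_all _ fun s hs => ?_
        have hs' : s ∈ Icc (0 : ℝ) 1 := ⟨hs.1.le, hs.2.trans ht1⟩
        have h1 : r U s - r W s = L s (Real.exp (2 * K * s) • (ext U s - ext W s)) := by
          simp only [r, smul_sub, map_sub]; abel
        have h2 : ‖ext U s - ext W s‖ ≤ dist U W := by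
          rw [← dist_eq_norm]
          simp only [ext, IccExtend_of_mem _ _ hs']
          exact ContinuousMap.dist_apply_le_dist _
        rw [h1]
        calc _ ≤ ‖L s‖ * ‖Real.exp (2 * K * s) • (ext U s - ext W s)‖ := (L s).le_opNorm _
          _ ≤ K * (Real.exp (2 * K * s) * dist U W) := by
            rw [norm_smul, Real.norm_eq_abs, abs_of_pos (Real.exp_pos _)]
            gcongr
            exact hK s hs'
          _ = _ := by ring
      · exact Continuous.intervalIntegrable (by fun_prop) _ _
    have hint : ∫ s in (0 : ℝ)..t, K * Real.exp (2 * K * s) * dist U W =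
        (Real.exp (2 * K * t) - 1) / 2 * dist U W := by
      have := intervalIntegral.integral_eq_sub_of_hasDerivAt (a := (0 : ℝ)) (b := t)
        (f := fun s => Real.exp (2 * K * s) / 2 * dist U W)
        (f' := fun s => K * Real.exp (2 * K * s) * dist U W) (fun s _ => by
          have h : HasDerivAt (fun s : ℝ => 2 * K * s) (2 * K) s := by
            simpa using (hasDerivAt_id s).const_mul (2 * K)
          convert! (h.exp.div_const 2).mul_const (dist U W) using 1
          ring) (Continuous.intervalIntegrable (by fun_prop) _ _)
      rw [this]
      simp
      ring
    have hsub : S U ⟨t, ht0, ht1⟩ - S W ⟨t, ht0, ht1⟩ =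
        Real.exp (-(2 * K * t)) • ∫ s in (0 : ℝ)..t, (r U s - r W s) := by
      simp only [S, ContinuousMap.coe_mk]
      rw [intervalIntegral.integral_sub ((hr U).intervalIntegrable _ _)
        ((hr W).intervalIntegrable _ _), ← smul_sub]
      congr 1
      abel
    rw [dist_eq_norm, hsub, norm_smul, Real.norm_eq_abs, abs_of_pos (Real.exp_pos _)]
    calc _ ≤ Real.exp (-(2 * K * t)) * ((Real.exp (2 * K * t) - 1) / 2 * dist U W) := by
          rw [← hint]; gcongr
      _ = (1 - Real.exp (-(2 * K * t))) / 2 * dist U W := by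
          have : Real.exp (-(2 * K * t)) * Real.exp (2 * K * t) = 1 := by
            rw [← Real.exp_add]; simp
          linear_combination (dist U W / 2) * this
      _ ≤ _ := by
          have := Real.exp_pos (-(2 * K * t))
          push_cast
          gcongr
          linarith
  obtain ⟨U, hU, -⟩ := hS.exists_fixedPoint (0 : C(Icc (0 : ℝ) 1, V)) (edist_ne_top _ _)
  refine ⟨fun t => y₀ + ∫ s in (0 : ℝ)..t, r U s, by simp, fun t ht => ?_⟩
  have h1 : HasDerivAt (fun t => y₀ + ∫ s in (0 : ℝ)..t, r U s) (r U t) t :=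
    ((hr U).integral_hasStrictDerivAt 0 t).hasDerivAt.const_add y₀
  have h2 : ext U t = Real.exp (-(2 * K * t)) • (y₀ + ∫ s in (0 : ℝ)..t, r U s) := by
    have := congrArg (fun W : C(Icc (0 : ℝ) 1, V) => W ⟨t, ht⟩) hU.symm
    simpa [ext, IccExtend_of_mem _ _ ht, S] using this
  convert! h1 using 1
  simp only [r, h2, smul_smul, ← Real.exp_add, add_neg_cancel, Real.exp_zero, one_smul]

/-- A perturbation of a homogeneous linear equation with zero initial value. -/
theorem norm_le_of_linear_ode {D D' : ℝ → V} {K ε : ℝ} (hK : 0 < K)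
    (hD : ∀ t ∈ Icc (0 : ℝ) 1, HasDerivAt D (D' t) t) (h0 : D 0 = 0)
    (hb : ∀ t ∈ Icc (0 : ℝ) 1, ‖D' t‖ ≤ K * ‖D t‖ + ε) :
    ‖D 1‖ ≤ ε * ((Real.exp K - 1) / K) := by
  have := norm_le_gronwallBound_of_norm_deriv_right_le (f := D) (f' := D') (δ := 0) (K := K)
    (ε := ε) (a := 0) (b := 1) (fun t ht => (hD t ht).continuousAt.continuousWithinAt)
    (fun t ht => (hD t (Ico_subset_Icc_self ht)).hasDerivWithinAt) (by simp [h0])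
    (fun t ht => hb t (Ico_subset_Icc_self ht)) 1 (by simp)
  rw [gronwallBound_of_K_ne_0 hK.ne'] at this
  simp only [sub_zero, mul_one, zero_mul, zero_add] at this
  calc _ ≤ _ := this
    _ = _ := by ring

/-- Two solutions of a homogeneous linear equation with the same initial value agree. -/
theorem linear_ode_unique {Y Z : ℝ → V} {L : ℝ → V →L[ℝ] V} (hL : Continuous L)
    (hY : ∀ t ∈ Icc (0 : ℝ) 1, HasDerivAt Y (L t (Y t)) t)
    (hZ : ∀ t ∈ Icc (0 : ℝ) 1, HasDerivAt Z (L t (Z t)) t) (h0 : Y 0 = Z 0) : Y 1 = Z 1 := by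
  obtain ⟨C, hC⟩ := isCompact_Icc.exists_bound_of_continuousOn
    (f := L) (s := Icc (0 : ℝ) 1) hL.continuousOn
  have := norm_le_of_linear_ode (D := fun t => Y t - Z t) (K := max C 1) (ε := 0) (by positivity)
    (fun t ht => (hY t ht).sub (hZ t ht)) (by simp [h0]) (fun t ht => by
      rw [← map_sub, add_zero]
      exact ((L t).le_opNorm _).trans
        (mul_le_mul_of_nonneg_right ((hC t ht).trans (le_max_left _ _)) (norm_nonneg _)))
  rw [zero_mul] at this
  exact sub_eq_zero.mp (norm_le_zero_iff.mp this)

end LinearODE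

/-! ### Differentiability of solutions in parameters -/

section Parameters

open Set

variable {𝕜 : Type*} [RCLike 𝕜] {X G : Type*} [NormedAddCommGroup X] [NormedSpace 𝕜 X]
  [NormedAddCommGroup G] [NormedSpace 𝕜 G]

/-- A first order Taylor expansion which is uniform in a compact parameter. -/
theorem eventually_norm_taylor_le (b : X → ℝ → G) (b' : X → ℝ → X →L[𝕜] G)
    (hb : ∀ x t, HasFDerivAt (b · t) (b' x t) x)
    (hb' : Continuous fun q : X × ℝ => b' q.1 q.2) (x₀ : X) {ε : ℝ} (hε : 0 < ε) :
    ∀ᶠ x in 𝓝 x₀, ∀ t ∈ Icc (0 : ℝ) 1,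
      ‖b x t - b x₀ t - b' x₀ t (x - x₀)‖ ≤ ε * ‖x - x₀‖ := by
  let : NormedSpace ℝ X := NormedSpace.restrictScalars ℝ 𝕜 X
  have h1 : ∀ᶠ x in 𝓝 x₀, ∀ t ∈ Icc (0 : ℝ) 1, ‖b' x t - b' x₀ t‖ < ε := by
    refine isCompact_Icc.eventually_forall_of_forall_eventually fun t _ => ?_
    have hc : Continuous fun q : X × ℝ => ‖b' q.1 q.2 - b' x₀ q.2‖ :=
      (hb'.sub (hb'.comp (f := fun q : X × ℝ => (x₀, q.2)) (by fun_prop))).norm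
    exact hc.continuousAt.eventually_lt continuousAt_const (by simpa using hε)
  obtain ⟨δ, hδ, hball⟩ := Metric.eventually_nhds_iff_ball.mp h1
  filter_upwards [Metric.ball_mem_nhds x₀ hδ] with x hx t ht
  have := (convex_ball x₀ δ).norm_image_sub_le_of_norm_hasFDerivWithin_le (𝕜 := 𝕜)
    (f := fun y => b y t - b' x₀ t (y - x₀)) (f' := fun y => b' y t - b' x₀ t) (C := ε)
    (fun y _ => ((hb y t).sub
      (((b' x₀ t).hasFDerivAt).comp y ((hasFDerivAt_id y).sub_const x₀))).hasFDerivWithinAt)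
    (fun y hy => (hball y hy t ht).le) (Metric.mem_ball_self hδ) hx
  simp only [sub_self, map_zero, sub_zero] at this
  rwa [sub_right_comm] at this

end Parameters

section Variation

open Set

variable {𝕜 : Type*} [RCLike 𝕜] {X A : Type*} [NormedAddCommGroup X] [NormedSpace 𝕜 X]
  [NormedRing A] [NormedSpace 𝕜 A] [NormedSpace ℝ A]

/-- The value at time `1` of the solution of `Y' = Y b` is differentiable with respect to
parameters, and its derivative solves the variational equation. -/
theorem hasFDerivAt_of_variation (b : X → ℝ → A) (b' : X → ℝ → X →L[𝕜] A)
    (hb : ∀ x t, HasFDerivAt (b · t) (b' x t) x)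
    (hbc : Continuous fun q : X × ℝ => b q.1 q.2)
    (hb' : Continuous fun q : X × ℝ => b' q.1 q.2)
    (Y : X → ℝ → A) (hY0 : ∀ x, Y x 0 = 1)
    (hY : ∀ x, ∀ t ∈ Icc (0 : ℝ) 1, HasDerivAt (Y x) (Y x t * b x t) t)
    (x₀ : X) (Z : ℝ → X →L[𝕜] A) (hZc : ContinuousOn Z (Icc 0 1)) (hZ0 : Z 0 = 0)
    (hZ : ∀ v, ∀ t ∈ Icc (0 : ℝ) 1,
      HasDerivAt (fun t => Z t v) (Z t v * b x₀ t + Y x₀ t * b' x₀ t v) t) :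
    HasFDerivAt (fun x => Y x 1) (Z 1) x₀ := by
  obtain ⟨MY, hMY⟩ := isCompact_Icc.exists_bound_of_continuousOn
    (f := Y x₀) (s := Icc (0 : ℝ) 1) fun t ht => (hY x₀ t ht).continuousAt.continuousWithinAt
  obtain ⟨MZ, hMZ⟩ := isCompact_Icc.exists_bound_of_continuousOn hZc
  have hbc0 : Continuous (b x₀) := hbc.comp (f := fun t : ℝ => (x₀, t)) (by fun_prop)
  obtain ⟨K, hK⟩ := isCompact_Icc.exists_bound_of_continuousOn
    (f := b x₀) (s := Icc (0 : ℝ) 1) hbc0.continuousOn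
  have h0 : (0 : ℝ) ∈ Icc (0 : ℝ) 1 := by simp
  have hMY0 : 0 ≤ MY := (norm_nonneg _).trans (hMY 0 h0)
  have hMZ0 : 0 ≤ MZ := (norm_nonneg _).trans (hMZ 0 h0)
  have hK0 : 0 ≤ K := (norm_nonneg _).trans (hK 0 h0)
  set C := (Real.exp (K + 1) - 1) / (K + 1) with hCdef
  have hC : 0 ≤ C := by
    have : 1 ≤ Real.exp (K + 1) := Real.one_le_exp (by positivity)
    exact div_nonneg (by linarith) (by positivity)
  have hnear : ∀ ε : ℝ, 0 < ε → ∀ᶠ x in 𝓝 x₀, ∀ t ∈ Icc (0 : ℝ) 1, ‖b x t - b x₀ t‖ < ε := by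
    refine fun ε hε => isCompact_Icc.eventually_forall_of_forall_eventually fun t _ => ?_
    have hc : Continuous fun q : X × ℝ => ‖b q.1 q.2 - b x₀ q.2‖ :=
      (hbc.sub (hbc0.comp continuous_snd)).norm
    exact hc.continuousAt.eventually_lt continuousAt_const (by simpa using hε)
  rw [hasFDerivAt_iff_isLittleO, Asymptotics.isLittleO_iff]
  intro c hc
  -- `MY` and `MZ` bound `Y` and `Z` at `x₀`, and `C` is the Gronwall factor for the rate `K + 1`,
  -- which bounds `b x` for `x` near `x₀`. The added ones keep the denominator positive.
  set ε := c / ((MY + MZ + 1) * (C + 1)) with hε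
  have hεpos : 0 < ε := by positivity
  filter_upwards [hnear 1 one_pos, hnear ε hεpos, eventually_norm_taylor_le b b' hb hb' x₀ hεpos]
    with x h1 h2 h3
  -- The remainder `D = Y_x - Y_{x₀} - Z(x - x₀)` starts at `0` and solves `D' = D b_x + R`, where
  -- `R` has size at most `(MY + MZ) ε ‖x - x₀‖`; Gronwall then makes `D(1)` small of first order.
  have key := norm_le_of_linear_ode (V := A)
    (D := fun t => Y x t - Y x₀ t - Z t (x - x₀))
    (D' := fun t => Y x t * b x t - Y x₀ t * b x₀ t -
      (Z t (x - x₀) * b x₀ t + Y x₀ t * b' x₀ t (x - x₀)))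
    (K := K + 1) (ε := (MY + MZ) * ε * ‖x - x₀‖) (by positivity)
    (fun t ht => ((hY x t ht).sub (hY x₀ t ht)).sub (hZ _ t ht)) (by simp [hY0, hZ0])
    (fun t ht => by
      have e : Y x t * b x t - Y x₀ t * b x₀ t -
          (Z t (x - x₀) * b x₀ t + Y x₀ t * b' x₀ t (x - x₀)) =
          (Y x t - Y x₀ t - Z t (x - x₀)) * b x t +
          (Y x₀ t * (b x t - b x₀ t - b' x₀ t (x - x₀)) +
            Z t (x - x₀) * (b x t - b x₀ t)) := by noncomm_ring
      have hbx : ‖b x t‖ ≤ K + 1 := by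
        calc ‖b x t‖ = ‖b x₀ t + (b x t - b x₀ t)‖ := by congr 1; abel
          _ ≤ _ := (norm_add_le _ _).trans (add_le_add (hK t ht) (h1 t ht).le)
      rw [e]
      refine (norm_add_le _ _).trans (add_le_add ?_ ((norm_add_le _ _).trans ?_))
      · refine (norm_mul_le _ _).trans ?_
        rw [mul_comm]
        gcongr
      · calc _ ≤ MY * (ε * ‖x - x₀‖) + MZ * ‖x - x₀‖ * ε := by
              refine add_le_add ((norm_mul_le _ _).trans ?_) ((norm_mul_le _ _).trans ?_)
              · gcongr
                exacts [hMY t ht, h3 t ht]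
              · gcongr
                exacts [((Z t).le_opNorm _).trans (by gcongr; exact hMZ t ht), (h2 t ht).le]
          _ = _ := by ring)
  refine key.trans ?_
  have e1 : (MY + MZ) * C ≤ (MY + MZ + 1) * (C + 1) := by nlinarith
  calc (MY + MZ) * ε * ‖x - x₀‖ * C = ((MY + MZ) * C) * ε * ‖x - x₀‖ := by ring
    _ ≤ ((MY + MZ + 1) * (C + 1)) * ε * ‖x - x₀‖ := by gcongr
    _ = c * ‖x - x₀‖ := by
      rw [hε]
      field_simp

end Variation

/-! ### Flat connections and holomorphic dependence on a parameter -/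

section Frobenius

open Set

/-- A function with vanishing derivative along `[0,1]`. -/
theorem eq_of_hasDerivAt_zero {V : Type*} [NormedAddCommGroup V] [NormedSpace ℝ V] {Y : ℝ → V}
    (hY : ∀ t ∈ Icc (0 : ℝ) 1, HasDerivAt Y 0 t) : Y 1 = Y 0 :=
  linear_ode_unique (L := fun _ => 0) (Z := fun _ => Y 0) continuous_const
    (by simpa using hY) (fun t _ => by simpa using hasDerivAt_const t (Y 0)) rfl

variable {A : Type*} [NormedRing A] [CompleteSpace A]

/-- The Frobenius theorem for flat connections with values in a Banach algebra. -/
theorem exists_flat_frame [NormedAlgebra ℝ A] {V : Type*} [NormedAddCommGroup V] [NormedSpace ℝ V]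
    (β : V → V →L[ℝ] A) (hβ : ContDiff ℝ 1 β)
    (hflat : ∀ z u v, fderiv ℝ β z u v - fderiv ℝ β z v u +
      (β z u * β z v - β z v * β z u) = 0) :
    ∃ H : V → A, H 0 = 1 ∧
      ∀ z, HasFDerivAt H ((ContinuousLinearMap.mul ℝ A (H z)).comp (β z)) z := by
  have hβc : Continuous β := hβ.continuous
  have hβ' : Continuous (fderiv ℝ β) := hβ.continuous_fderiv one_ne_zero
  have hβd : ∀ z, HasFDerivAt β (fderiv ℝ β z) z :=
    fun z => (hβ.differentiable one_ne_zero z).hasFDerivAt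
  have hL : ∀ z : V, Continuous fun t : ℝ => (ContinuousLinearMap.mul ℝ A).flip (β (t • z) z) :=
    fun z => by fun_prop
  -- The frame at `z` is the parallel transport along the ray `t ↦ t z`, evaluated at `t = 1`.
  choose Y hY0 hY using fun z : V => exists_linear_ode_solution
    (fun t : ℝ => (ContinuousLinearMap.mul ℝ A).flip (β (t • z) z)) (fun _ => 0) (hL z)
    continuous_const (1 : A)
  simp only [ContinuousLinearMap.flip_apply, ContinuousLinearMap.mul_apply', add_zero] at hY
  refine ⟨fun z => Y z 1, ?_, fun z => ?_⟩
  · have := eq_of_hasDerivAt_zero (Y := Y 0) (fun t ht => by simpa using hY 0 t ht)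
    exact this.trans (hY0 0)
  have hYc : ContinuousOn (Y z) (Icc 0 1) :=
    fun t ht => (hY z t ht).continuousAt.continuousWithinAt
  -- The expected derivative of the radial transport in the direction `v` is `t Y β(tz) v`. Flatness
  -- exchanges the two directions in `dβ`, which turns its derivative into the variational equation;
  -- at `t = 1` this reads `dH = H β`.
  have hZ : ∀ v, ∀ t ∈ Icc (0 : ℝ) 1, HasDerivAt (fun t : ℝ => t • (Y z t * β (t • z) v))
      (t • (Y z t * β (t • z) v) * β (t • z) z +
        Y z t * (β (t • z) v + t • fderiv ℝ β (t • z) v z)) t := by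
    intro v t ht
    have h1 : HasDerivAt (fun t : ℝ => t • z) z t := by
      simpa using (hasDerivAt_id t).smul_const z
    have h2 : HasDerivAt (fun t : ℝ => β (t • z) v) (fderiv ℝ β (t • z) z v) t := by
      have h := (hβd (t • z)).comp_hasDerivAt t h1
      exact ((ContinuousLinearMap.apply ℝ A v).hasFDerivAt (x := β (t • z))).comp_hasDerivAt t h
    have h3 := (hasDerivAt_id t).smul ((hY z t ht).mul h2)
    refine h3.congr_deriv ?_
    rw [Pi.mul_apply]
    have hf : fderiv ℝ β (t • z) v z = fderiv ℝ β (t • z) z v +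
        (β (t • z) z * β (t • z) v - β (t • z) v * β (t • z) z) := by
      have := hflat (t • z) z v
      rw [← sub_eq_zero]
      rw [← neg_eq_zero, ← this]
      abel
    rw [hf]
    generalize fderiv ℝ β (t • z) z v = P
    generalize β (t • z) z = Q
    generalize β (t • z) v = R
    generalize Y z t = S
    have e : S * Q * R + S * P = S * R * Q + S * (P + (Q * R - R * Q)) := by noncomm_ring
    simp only [id, one_smul]
    rw [e, smul_add, mul_add S R, mul_smul_comm, smul_mul_assoc]
    abel
  have := hasFDerivAt_of_variation (𝕜 := ℝ) (fun z t => β (t • z) z)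
    (fun z t => β (t • z) + t • (fderiv ℝ β (t • z)).flip z) (fun x t => by
      have h1 : HasFDerivAt (fun z : V => t • z) (t • ContinuousLinearMap.id ℝ V) x :=
        (hasFDerivAt_id x).const_smul t
      have h2 := ((hβd (t • x)).comp x h1).clm_apply (hasFDerivAt_id x)
      convert! h2 using 1
      ext h
      simp)
    (by fun_prop)
    (by
      have : Continuous fun q : V × ℝ => (fderiv ℝ β (q.2 • q.1)).flip q.1 := by
        have h1 : Continuous fun q : V × ℝ => fderiv ℝ β (q.2 • q.1) := by fun_prop
        exact ((ContinuousLinearMap.flipₗᵢ ℝ V V A).continuous.comp h1).clm_apply continuous_fst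
      fun_prop)
    Y hY0 hY z
    (fun t => t • (ContinuousLinearMap.mul ℝ A (Y z t)).comp (β (t • z)))
    (by
      have h1 : ContinuousOn (fun t => ContinuousLinearMap.mul ℝ A (Y z t)) (Icc 0 1) :=
        (ContinuousLinearMap.mul ℝ A).continuous.comp_continuousOn hYc
      have h2 : ContinuousOn (fun t : ℝ => β (t • z)) (Icc 0 1) := by fun_prop
      exact continuousOn_id.smul (h1.clm_comp h2)) (by simp)
    (fun v t ht => hZ v t ht)
  simpa using this

/-- Solutions of `Y' = Y b` are invertible from the right. -/
theorem exists_mul_eq_one_of_linear_ode [NormedAlgebra ℝ A] {b Y : ℝ → A} (hb : Continuous b)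
    (hY0 : Y 0 = 1) (hY : ∀ t ∈ Icc (0 : ℝ) 1, HasDerivAt Y (Y t * b t) t) :
    ∃ W, Y 1 * W = 1 := by
  -- The inverse solves the adjoint equation `W' = -b W`, so that `(Y W)' = 0`.
  obtain ⟨W, hW0, hW⟩ := exists_linear_ode_solution
    (fun t : ℝ => -ContinuousLinearMap.mul ℝ A (b t)) (fun _ => 0)
    (by fun_prop) continuous_const (1 : A)
  refine ⟨W 1, ?_⟩
  have := eq_of_hasDerivAt_zero (Y := fun t => Y t * W t) (fun t ht => by
    convert! (hY t ht).mul (hW t ht) using 1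
    simp [mul_assoc])
  simpa [hY0, hW0] using this

attribute [local instance] NormedAlgebra.toNormedSpace in
/-- The solution of `Y' = Y b` is holomorphic in a parameter in which `b` is holomorphic. -/
theorem differentiable_of_linear_ode [NormedAlgebra ℝ A] [NormedAlgebra ℂ A] (b b' : ℂ → ℝ → A)
    (hb : ∀ l t, HasDerivAt (b · t) (b' l t) l)
    (hbc : Continuous fun q : ℂ × ℝ => b q.1 q.2)
    (hb' : Continuous fun q : ℂ × ℝ => b' q.1 q.2)
    (Y : ℂ → ℝ → A) (hY0 : ∀ l, Y l 0 = 1)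
    (hY : ∀ l t, HasDerivAt (Y l) (Y l t * b l t) t) :
    Differentiable ℂ fun l => Y l 1 := by
  intro l
  have hY' : Continuous (Y l) :=
    continuous_iff_continuousAt.mpr fun t => (hY l t).continuousAt
  have hbl : Continuous (b l) := hbc.comp (f := fun t : ℝ => (l, t)) (by fun_prop)
  have hbl' : Continuous (b' l) := hb'.comp (f := fun t : ℝ => (l, t)) (by fun_prop)
  obtain ⟨W, hW0, hW⟩ := exists_linear_ode_solution
    (fun t : ℝ => (ContinuousLinearMap.mul ℝ A).flip (b l t)) (fun t => Y l t * b' l t)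
    (by fun_prop) (by fun_prop) (0 : A)
  refine (hasFDerivAt_of_variation (𝕜 := ℂ) b
    (fun l t => ContinuousLinearMap.toSpanSingleton ℂ (b' l t))
    (fun l t => (hb l t).hasFDerivAt) hbc
    ((ContinuousLinearMap.toSpanSingletonCLE (𝕜 := ℂ) (E := A)).continuous.comp hb') Y hY0
    (fun l t _ => hY l t) l
    (fun t => ContinuousLinearMap.toSpanSingleton ℂ (W t))
    ((ContinuousLinearMap.toSpanSingletonCLE (𝕜 := ℂ) (E := A)).continuous.comp_continuousOn
      fun t ht => (hW t ht).continuousAt.continuousWithinAt)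
    (by ext; simp [hW0]) (fun v t ht => ?_)).differentiableAt
  have := (hW t ht).const_smul v
  convert! this using 1
  simp

end Frobenius

/-! ### Laurent coefficients -/

/-- A primitive `N`-th root of unity. -/
noncomputable def rootOfUnity (N : ℕ) : ℂ := Complex.exp (2 * Real.pi * Complex.I / N)

theorem rootOfUnity_ne_zero (N : ℕ) : rootOfUnity N ≠ 0 := Complex.exp_ne_zero _

/-- The `j`-th coefficient of a Laurent polynomial with few terms, computed by a discrete Fourier
transform over the `N`-th roots of unity. -/
noncomputable def laurentCoeff (N : ℕ) (f : ℂ → Mat) (j : ℤ) : Mat :=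
  (N : ℂ)⁻¹ • ∑ k ∈ Finset.range N, (rootOfUnity N ^ (k : ℤ)) ^ (-j) • f (rootOfUnity N ^ (k : ℤ))

theorem laurentCoeff_congr {f g : ℂ → Mat} (h : ∀ ζ, ζ ≠ 0 → f ζ = g ζ) (N : ℕ) (j : ℤ) :
    laurentCoeff N f j = laurentCoeff N g j := by
  simp only [laurentCoeff]
  congr 1
  exact Finset.sum_congr rfl fun k _ => by rw [h _ (zpow_ne_zero _ (rootOfUnity_ne_zero N))]

theorem laurentCoeff_add (f g : ℂ → Mat) (N : ℕ) (j : ℤ) :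
    laurentCoeff N (fun ζ => f ζ + g ζ) j = laurentCoeff N f j + laurentCoeff N g j := by
  simp only [laurentCoeff, smul_add, Finset.sum_add_distrib]

theorem laurentCoeff_sum {ι : Type*} (s : Finset ι) (f : ι → ℂ → Mat) (N : ℕ) (j : ℤ) :
    laurentCoeff N (fun ζ => ∑ i ∈ s, f i ζ) j = ∑ i ∈ s, laurentCoeff N (f i) j := by
  simp only [laurentCoeff, Finset.smul_sum]
  rw [Finset.sum_comm]

theorem map_laurentCoeff (T : Mat →ₗ[ℂ] Mat) (f : ℂ → Mat) (N : ℕ) (j : ℤ) :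
    laurentCoeff N (fun ζ => T (f ζ)) j = T (laurentCoeff N f j) := by
  simp only [laurentCoeff, map_smul, map_sum]

theorem laurentCoeff_zero (N : ℕ) (j : ℤ) : laurentCoeff N (fun _ => 0) j = 0 := by
  simp [laurentCoeff]

/-- Exact for every `f` and `N`: an identity in `ζ` can be compared coefficientwise before any
expansion is known. -/
theorem laurentCoeff_shift (f : ℂ → Mat) (N : ℕ) (i j : ℤ) :
    laurentCoeff N (fun ζ => ζ ^ i • f ζ) j = laurentCoeff N f (j - i) := by
  simp only [laurentCoeff, smul_smul]
  congr 1
  refine Finset.sum_congr rfl fun k _ => ?_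
  rw [← zpow_add₀ (zpow_ne_zero _ (rootOfUnity_ne_zero N))]
  congr 2
  ring

/-- Orthogonality of characters. Exponents are seen only modulo `N`, so every later use must exclude
aliasing. -/
theorem laurentCoeff_const (M : Mat) {N : ℕ} (hN : N ≠ 0) (j : ℤ) :
    laurentCoeff N (fun _ => M) j = if (N : ℤ) ∣ j then M else 0 := by
  have hprim : IsPrimitiveRoot (rootOfUnity N) N := Complex.isPrimitiveRoot_exp N hN
  simp only [laurentCoeff, ← Finset.sum_smul, smul_smul]
  have hpow : ∀ k : ℕ, (rootOfUnity N ^ (k : ℤ)) ^ (-j) = (rootOfUnity N ^ (-j)) ^ k := fun k => by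
    rw [← zpow_mul, ← zpow_natCast, ← zpow_mul, mul_comm]
  simp only [hpow]
  split_ifs with h
  · have : rootOfUnity N ^ (-j) = 1 := (hprim.zpow_eq_one_iff_dvd _).mpr (by simpa using h)
    simp [this, hN]
  · have h1 : rootOfUnity N ^ (-j) ≠ 1 := fun h' =>
      h (by simpa using (hprim.zpow_eq_one_iff_dvd _).mp h')
    have h2 : (rootOfUnity N ^ (-j)) ^ N = 1 := by
      rw [← hpow, zpow_natCast, hprim.pow_eq_one, one_zpow]
    rw [geom_sum_eq h1, h2]
    simp

theorem HasLaurentExpansion.laurentCoeff_eq {f : ℂ → Mat} {n : ℕ} {C : ℤ → Mat}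
    (hf : HasLaurentExpansion f n C) {N : ℕ} (hN : 2 * n < N) {j : ℤ}
    (hj : j ∈ Finset.Icc (-(n : ℤ)) n) : laurentCoeff N f j = C j := by
  rw [laurentCoeff_congr hf, laurentCoeff_sum, Finset.sum_eq_single j]
  · rw [laurentCoeff_shift, sub_self, laurentCoeff_const _ (by omega)]
    simp
  · intro i hi hij
    rw [laurentCoeff_shift, laurentCoeff_const _ (by omega), if_neg]
    rw [Finset.mem_Icc] at hi hj
    intro h
    exact hij (sub_eq_zero.mp (Int.eq_zero_of_abs_lt_dvd h (by rw [abs_lt]; omega))).symm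
  · exact fun h => absurd hj h

/-- The two ranges are the gaps between `[-n, n]` and its translates by `N` and `-N`, where no
exponent aliases to `j`. -/
theorem HasLaurentExpansion.laurentCoeff_eq_zero {f : ℂ → Mat} {n : ℕ} {C : ℤ → Mat}
    (hf : HasLaurentExpansion f n C) {N : ℕ} {j : ℤ}
    (hj : (n : ℤ) < j ∧ j < N - n ∨ j < -n ∧ n - N < j) : laurentCoeff N f j = 0 := by
  rw [laurentCoeff_congr hf, laurentCoeff_sum]
  refine Finset.sum_eq_zero fun i hi => ?_
  rw [Finset.mem_Icc] at hi
  rw [laurentCoeff_shift, laurentCoeff_const _ (by omega), if_neg]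
  intro h
  have := Int.eq_zero_of_abs_lt_dvd h (by rw [abs_lt]; omega)
  omega

theorem HasLaurentExpansion.unique {f : ℂ → Mat} {n : ℕ} {C D : ℤ → Mat}
    (hC : HasLaurentExpansion f n C) (hD : HasLaurentExpansion f n D) {j : ℤ}
    (hj : j ∈ Finset.Icc (-(n : ℤ)) n) : C j = D j := by
  rw [← hC.laurentCoeff_eq (N := 2 * n + 1) (by omega) hj,
    ← hD.laurentCoeff_eq (N := 2 * n + 1) (by omega) hj]

/-- The lowest coefficient as a limit. -/
theorem HasLaurentExpansion.tendsto {f : ℂ → Mat} {n : ℕ} {C : ℤ → Mat}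
    (hf : HasLaurentExpansion f n C) :
    Tendsto (fun ζ : ℂ => ζ ^ n • f ζ) (𝓝[≠] 0) (𝓝 (C (-(n : ℤ)))) := by
  have h1 : Continuous fun ζ : ℂ =>
      ∑ j ∈ Finset.Icc (-(n : ℤ)) (n : ℤ), ζ ^ (j + n).toNat • C j := by fun_prop
  have h2 : ∑ j ∈ Finset.Icc (-(n : ℤ)) (n : ℤ), (0 : ℂ) ^ (j + n).toNat • C j = C (-(n : ℤ)) := by
    rw [Finset.sum_eq_single (-(n : ℤ))]
    · simp
    · intro i hi hin
      rw [Finset.mem_Icc] at hi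
      rw [zero_pow (by omega), zero_smul]
    · intro h
      exact absurd (Finset.mem_Icc.mpr (by omega)) h
  have h3 := (h1.tendsto 0).mono_left (nhdsWithin_le_nhds (s := {0}ᶜ))
  rw [h2] at h3
  refine h3.congr' ?_
  filter_upwards [self_mem_nhdsWithin] with ζ hζ
  rw [hf ζ hζ, Finset.smul_sum]
  refine Finset.sum_congr rfl fun j hj => ?_
  rw [Finset.mem_Icc] at hj
  rw [smul_smul, ← zpow_natCast, ← zpow_natCast, ← zpow_add₀ hζ, Int.toNat_of_nonneg (by omega),
    add_comm]

/-- If there is an expansion of order `n` then the coefficients can be taken to be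
`laurentCoeff N f`. -/
theorem HasLaurentExpansion.canonical {f : ℂ → Mat} {n : ℕ} {C : ℤ → Mat}
    (hf : HasLaurentExpansion f n C) {N : ℕ} (hN : 2 * n < N) :
    HasLaurentExpansion f n (laurentCoeff N f) := by
  intro ζ hζ
  rw [hf ζ hζ]
  exact Finset.sum_congr rfl fun j hj => by rw [hf.laurentCoeff_eq hN hj]

theorem tau_inv : tau⁻¹ = tau := Matrix.inv_eq_right_inv tau_mul_tau

/-- The coefficients of a twisted loop are alternately diagonal and off-diagonal. -/
theorem HasLaurentExpansion.twisted {f : ℂ → Mat} {n : ℕ} {C : ℤ → Mat}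
    (hf : HasLaurentExpansion f n C) (htw : ∀ ζ, ζ ≠ 0 → f (-ζ) = tau * f ζ * tau⁻¹) {j : ℤ}
    (hj : j ∈ Finset.Icc (-(n : ℤ)) n) : tau * C j * tau = (-1 : ℂ) ^ j • C j := by
  have h1 : HasLaurentExpansion (fun ζ => tau * f ζ * tau) n fun j => tau * C j * tau := by
    intro ζ hζ
    simp only [hf ζ hζ, Finset.mul_sum, Finset.sum_mul, mul_smul_comm, smul_mul_assoc]
  have h2 : HasLaurentExpansion (fun ζ => tau * f ζ * tau) n fun j => (-1 : ℂ) ^ j • C j := by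
    intro ζ hζ
    have := htw ζ hζ
    rw [tau_inv] at this
    simp only [← this, hf (-ζ) (neg_ne_zero.mpr hζ), smul_smul]
    refine Finset.sum_congr rfl fun i _ => ?_
    rw [← mul_zpow]
    congr 2
    ring
  exact h1.unique h2 hj

/-- The coefficients of a loop satisfying the reality condition. -/
theorem HasLaurentExpansion.real {f : ℂ → Mat} {n : ℕ} {C : ℤ → Mat}
    (hf : HasLaurentExpansion f n C) (hre : ∀ ζ : ℂ, ζ ≠ 0 → f (conj ζ)⁻¹ = -(f ζ)ᴴ) {j : ℤ}
    (hj : j ∈ Finset.Icc (-(n : ℤ)) n) : C j = -(C (-j))ᴴ := by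
  refine hf.unique (D := fun j => -(C (-j))ᴴ) (fun ζ hζ => ?_) hj
  have h0 : (conj ζ)⁻¹ ≠ 0 := inv_ne_zero (by simpa using hζ)
  have h1 := hre _ h0
  simp only [map_inv₀, Complex.conj_conj, inv_inv] at h1
  rw [h1, hf _ h0, Matrix.conjTranspose_sum, ← Finset.sum_neg_distrib]
  refine Finset.sum_bij' (fun i _ => -i) (fun i _ => -i) ?_ ?_ ?_ ?_ ?_
  · intro i hi; rw [Finset.mem_Icc] at hi ⊢; omega
  · intro i hi; rw [Finset.mem_Icc] at hi ⊢; omega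
  · simp
  · simp
  · intro i _
    simp only [Matrix.conjTranspose_smul, neg_neg, smul_neg]
    congr 2
    simp [← starRingEnd_apply]

/-! ### The leading coefficient of a polynomial Killing field -/

theorem contDiff_eval {ξ : ℂ → ℂ → Mat}
    (h : ContDiffOn ℝ ∞ (fun q : ℂ × ℂ => ξ q.1 q.2) {q | q.2 ≠ 0}) {ζ : ℂ} (hζ : ζ ≠ 0) :
    ContDiff ℝ ∞ fun w => ξ w ζ := by
  have h1 : ContDiff ℝ ∞ fun w : ℂ => (w, ζ) := by fun_prop
  exact contDiffOn_univ.mp (h.comp h1.contDiffOn fun _ _ => hζ)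

theorem contDiff_sum_smul {V : Type*} [NormedAddCommGroup V] [NormedSpace ℝ V] [NormedSpace ℂ V]
    [SMulCommClass ℝ ℂ V] {ι : Type*} (s : Finset ι) (a : ℂ) (c : ι → ℂ) (f : ι → ℂ → V)
    (hf : ∀ i, ContDiff ℝ ∞ (f i)) : ContDiff ℝ ∞ fun w => a • ∑ i ∈ s, c i • f i w :=
  (ContDiff.sum fun i _ => (hf i).const_smul (c i)).const_smul a

theorem fderiv_sum_smul {V : Type*} [NormedAddCommGroup V] [NormedSpace ℝ V] [NormedSpace ℂ V]
    [SMulCommClass ℝ ℂ V] {ι : Type*} (s : Finset ι) (a : ℂ) (c : ι → ℂ) (f : ι → ℂ → V) (z X : ℂ)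
    (hf : ∀ i, DifferentiableAt ℝ (f i) z) :
    fderiv ℝ (fun w => a • ∑ i ∈ s, c i • f i w) z X =
      a • ∑ i ∈ s, c i • fderiv ℝ (f i) z X := by
  have := (HasFDerivAt.fun_sum (u := s) fun i _ =>
    ((hf i).hasFDerivAt.fun_const_smul (c i))).fun_const_smul a
  rw [this.fderiv]
  simp

/-- The discrete transform is a finite combination of evaluations at fixed nonzero `ζ`, so
smoothness in `z` passes to coefficients with no integral to differentiate. -/
theorem contDiff_laurentCoeff {ξ : ℂ → ℂ → Mat}
    (h : ContDiffOn ℝ ∞ (fun q : ℂ × ℂ => ξ q.1 q.2) {q | q.2 ≠ 0}) (N : ℕ) (j : ℤ) :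
    ContDiff ℝ ∞ fun w => laurentCoeff N (ξ w) j :=
  contDiff_sum_smul _ _ _ (fun (k : ℕ) w => ξ w (rootOfUnity N ^ (k : ℤ)))
    fun k => contDiff_eval h (zpow_ne_zero k (rootOfUnity_ne_zero N))

theorem fderiv_laurentCoeff {ξ : ℂ → ℂ → Mat}
    (h : ContDiffOn ℝ ∞ (fun q : ℂ × ℂ => ξ q.1 q.2) {q | q.2 ≠ 0}) (N : ℕ) (j : ℤ) (z X : ℂ) :
    fderiv ℝ (fun w => laurentCoeff N (ξ w) j) z X =
      laurentCoeff N (fun ζ => fderiv ℝ (fun w => ξ w ζ) z X) j :=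
  fderiv_sum_smul _ _ _ (fun (k : ℕ) w => ξ w (rootOfUnity N ^ (k : ℤ))) z X fun k =>
    (contDiff_eval h (zpow_ne_zero k (rootOfUnity_ne_zero N))).differentiable (by simp) z

/-- The square of a solution of a Lax equation has constant trace. -/
theorem trace_sq_const_of_lax {A : Type*} [NormedRing A] [NormedAlgebra ℝ A] (tr : A →ₗ[ℝ] ℂ)
    (htr : Continuous tr) (hc : ∀ P Q, tr (P * Q) = tr (Q * P)) (f : ℂ → A) (α : ℂ → ℂ → A)
    (hf : Differentiable ℝ f)
    (hl : ∀ z X, fderiv ℝ f z X + (α z X * f z - f z * α z X) = 0) (z w : ℂ) :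
    tr (f z * f z) = tr (f w * f w) := by
  let tr' : A →L[ℝ] ℂ := ⟨tr, htr⟩
  have hd2 := fun w => tr'.hasFDerivAt.comp w ((hf w).hasFDerivAt.mul' (hf w).hasFDerivAt)
  refine is_const_of_fderiv_eq_zero (𝕜 := ℝ) (fun w => (hd2 w).differentiableAt) (fun w => ?_) z w
  rw [(hd2 w).fderiv]
  ext1 X
  have hl' := eq_neg_of_add_eq_zero_left (hl w X)
  change tr (f w * fderiv ℝ f w X + fderiv ℝ f w X * f w) = 0
  rw [hl', map_add, hc _ (f w), mul_neg, mul_sub, map_neg, map_sub, hc (f w) (α w X * f w),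
    mul_assoc, hc (α w X), mul_assoc, sub_self, neg_zero, add_zero]

section Killing

variable {F : ℂ → Mat} {ξ : ℂ → ℂ → Mat}

/-- The Lax equation in terms of Laurent coefficients. -/
theorem IsPolynomialKillingField.lax_coeff (hξ : IsPolynomialKillingField F ξ) (N : ℕ) (j : ℤ)
    (z X : ℂ) :
    fderiv ℝ (fun w => laurentCoeff N (ξ w) j) z X +
      X • (alphaMdz F z * laurentCoeff N (ξ z) (j + 1) -
        laurentCoeff N (ξ z) (j + 1) * alphaMdz F z) +
      (tPart (mcForm F z X) * laurentCoeff N (ξ z) j -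
        laurentCoeff N (ξ z) j * tPart (mcForm F z X)) +
      conj X • (alphaMdzbar F z * laurentCoeff N (ξ z) (j - 1) -
        laurentCoeff N (ξ z) (j - 1) * alphaMdzbar F z) = 0 := by
  have key := laurentCoeff_congr (f := fun _ => 0) (fun ζ hζ => (hξ.lax ζ hζ z X).symm) N j
  rw [laurentCoeff_zero] at key
  let ad (M : Mat) : Mat →ₗ[ℂ] Mat := LinearMap.mulLeft ℂ M - LinearMap.mulRight ℂ M
  have e : (fun ζ => fderiv ℝ (fun w => ξ w ζ) z X +
      (loopForm F z X ζ * ξ z ζ - ξ z ζ * loopForm F z X ζ)) = fun ζ =>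
      ((fderiv ℝ (fun w => ξ w ζ) z X + (X • ad (alphaMdz F z)) (ζ ^ (-1 : ℤ) • ξ z ζ)) +
        ad (tPart (mcForm F z X)) (ξ z ζ)) +
        (conj X • ad (alphaMdzbar F z)) (ζ ^ (1 : ℤ) • ξ z ζ) := by
    funext ζ
    simp only [loopForm, ad, LinearMap.smul_apply, LinearMap.sub_apply, LinearMap.mulLeft_apply,
      LinearMap.mulRight_apply, add_mul, mul_add, smul_mul_assoc, mul_smul_comm, zpow_neg_one,
      zpow_one, smul_sub, smul_smul, mul_comm X, mul_comm (conj X)]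
    abel
  rw [e, laurentCoeff_add, laurentCoeff_add, laurentCoeff_add, map_laurentCoeff, map_laurentCoeff,
    map_laurentCoeff, laurentCoeff_shift, laurentCoeff_shift, ← fderiv_laurentCoeff hξ.smooth] at key
  simpa [ad] using key.symm

/-- The points at which the degree of the Killing field is at most `n`. -/
def degreeLE (ξ : ℂ → ℂ → Mat) (n : ℕ) : Set ℂ := {z | ∃ C, HasLaurentExpansion (ξ z) n C}

theorem mem_degreeLE_iff {z : ℂ} {n : ℕ} :
    z ∈ degreeLE ξ n ↔ HasLaurentExpansion (ξ z) n (laurentCoeff (2 * n + 3) (ξ z)) :=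
  ⟨fun ⟨_, hC⟩ => hC.canonical (by omega), fun h => ⟨_, h⟩⟩

/-- With the coefficients given by `laurentCoeff`, membership is an equality, for each `ζ`, between
two continuous functions of `z`. Closedness is what Baire's theorem needs. -/
theorem isClosed_degreeLE (h : ContDiffOn ℝ ∞ (fun q : ℂ × ℂ => ξ q.1 q.2) {q | q.2 ≠ 0})
    (n : ℕ) : IsClosed (degreeLE ξ n) := by
  have : degreeLE ξ n = ⋂ ζ : ℂ, ⋂ _ : ζ ≠ 0, {z | ξ z ζ =
      ∑ j ∈ Finset.Icc (-(n : ℤ)) (n : ℤ), ζ ^ j • laurentCoeff (2 * n + 3) (ξ z) j} := by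
    ext z
    simp only [mem_degreeLE_iff, HasLaurentExpansion, Set.mem_iInter, Set.mem_ofPred_eq]
  rw [this]
  refine isClosed_iInter fun ζ => isClosed_iInter fun hζ => isClosed_eq
    (contDiff_eval h hζ).continuous ?_
  have := fun j => (contDiff_laurentCoeff h (2 * n + 3) j).continuous
  fun_prop

theorem trace_sq_eq (hξ : IsPolynomialKillingField F ξ) {ζ : ℂ} (hζ : ζ ≠ 0) (z : ℂ) :
    (ξ z ζ * ξ z ζ).trace = (ξ 0 ζ * ξ 0 ζ).trace := by
  refine trace_sq_const_of_lax (Matrix.traceLinearMap (Fin 2) ℝ ℂ) ?_ Matrix.trace_mul_comm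
    (fun w => ξ w ζ) (fun w X => loopForm F w X ζ)
    ((contDiff_eval hξ.smooth hζ).differentiable (by simp)) (hξ.lax ζ hζ) z 0
  exact continuous_id.matrix_trace

/-- Compares the bottom coefficient at an arbitrary `z` with one function of `ζ` that does not
depend on `z`. When the limit is nonzero, it determines `n`. -/
theorem tendsto_trace_sq (hξ : IsPolynomialKillingField F ξ) {z : ℂ} {n : ℕ} {C : ℤ → Mat}
    (hC : HasLaurentExpansion (ξ z) n C) :
    Tendsto (fun ζ : ℂ => ζ ^ (2 * n) * (ξ 0 ζ * ξ 0 ζ).trace) (𝓝[≠] 0)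
      (𝓝 (C (-(n : ℤ)) * C (-(n : ℤ))).trace) := by
  have h1 := hC.tendsto.mul hC.tendsto
  have hc : Continuous fun M : Mat => M.trace := continuous_id.matrix_trace
  refine ((hc.tendsto _).comp h1).congr' ?_
  filter_upwards [self_mem_nhdsWithin] with ζ hζ
  simp only [Function.comp, smul_mul_assoc, mul_smul_comm, smul_smul, Matrix.trace_smul,
    trace_sq_eq hξ hζ z, smul_eq_mul]
  ring

/-- A semisimple frame in terms of the squares of the function `a`. -/
theorem IsSemisimpleFrame.exists_eq (hss : IsSemisimpleFrame F) :
    ∃ b : ℂ → ℂ, ContDiff ℝ ∞ b ∧ (∀ z, b z ≠ 0) ∧ ∀ z, alphaMdz F z = !![0, b z; (b z)⁻¹, 0] := by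
  obtain ⟨a, ha, ha0, h⟩ := hss
  refine ⟨fun z => a z ^ 2, ha.pow 2, fun z => pow_ne_zero 2 (ha0 z), fun z => ?_⟩
  have hinv : (!![a z, 0; 0, (a z)⁻¹] : Mat)⁻¹ = !![(a z)⁻¹, 0; 0, a z] := by
    refine Matrix.inv_eq_right_inv ?_
    ext i j
    fin_cases i <;> fin_cases j <;> simp [ha0 z]
  rw [h z, hinv]
  ext i j
  fin_cases i <;> fin_cases j <;> simp [sq]

/-- The matrix `!![0, b; b⁻¹, 0]` has the distinct eigenvalues `±1`, so its centraliser is spanned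
by `1` and itself; being off-diagonal excludes the identity component. -/
theorem eq_smul_of_commute {b : ℂ} (hb : b ≠ 0) {M : Mat} (hM : tau * M * tau = -M)
    (hc : !![0, b; b⁻¹, 0] * M = M * !![0, b; b⁻¹, 0]) :
    M = (M 0 1 / b) • (!![0, b; b⁻¹, 0] : Mat) := by
  have h00 := congrFun (congrFun hM 0) 0
  have h11 := congrFun (congrFun hM 1) 1
  have h1 := congrFun (congrFun hc 0) 0
  simp [tau, Matrix.mul_apply, Matrix.vecMul, dotProduct, Fin.sum_univ_two] at h00 h11 h1
  have e0 : M 0 0 = 0 := by linear_combination (1 / 2) * h00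
  have e1 : M 1 1 = 0 := by linear_combination (1 / 2) * h11
  ext i j
  fin_cases i <;> fin_cases j <;> simp [e0, e1, hb]
  field_simp at h1 ⊢
  linear_combination h1

/-- On an open set where the degree is at most `n`, the coefficient of `ζ^{-n-1}` vanishes
identically, hence so does its derivative, and the Lax equation in that degree reduces to one
commutator. -/
theorem commute_leading_coeff (hξ : IsPolynomialKillingField F ξ) {n : ℕ} {z : ℂ}
    (hz : z ∈ interior (degreeLE ξ n)) :
    alphaMdz F z * laurentCoeff (2 * n + 3) (ξ z) (-(n : ℤ)) =
      laurentCoeff (2 * n + 3) (ξ z) (-(n : ℤ)) * alphaMdz F z := by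
  -- The indices `-n-1` and `-n-2` occur below; modulo `2n + 3` they become `n+2` and `n+1`, still
  -- outside `[-n, n]`. No smaller modulus would do.
  have h0 : ∀ w ∈ degreeLE ξ n, ∀ j : ℤ, (j < -n ∧ n - ((2 * n + 3 : ℕ) : ℤ) < j) →
      laurentCoeff (2 * n + 3) (ξ w) j = 0 :=
    fun w ⟨_, hC⟩ j hj => hC.laurentCoeff_eq_zero (Or.inr hj)
  have h1 := hξ.lax_coeff (2 * n + 3) (-n - 1) z 1
  have h2 : (fun w => laurentCoeff (2 * n + 3) (ξ w) (-n - 1)) =ᶠ[𝓝 z] fun _ => 0 := by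
    filter_upwards [isOpen_interior.mem_nhds hz] with w hw
    exact h0 w (interior_subset hw) _ (by push_cast; omega)
  rw [h2.fderiv_eq, h0 z (interior_subset hz) (-n - 1) (by push_cast; omega),
    h0 z (interior_subset hz) (-n - 1 - 1) (by push_cast; omega)] at h1
  simpa [sub_eq_zero] using h1

/-- The order is odd, so twisting makes the bottom coefficient off-diagonal, and it commutes with
`α_𝔪(∂/∂z)`. At this stage the factor may depend on `z` and may vanish. -/
theorem trace_leading_coeff (hss : IsSemisimpleFrame F) (hξ : IsPolynomialKillingField F ξ)
    {p : ℕ} {z : ℂ} (hz : z ∈ interior (degreeLE ξ (2 * p + 1))) :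
    ∃ c : ℂ, laurentCoeff (2 * (2 * p + 1) + 3) (ξ z) (-((2 * p + 1 : ℕ) : ℤ)) =
      c • alphaMdz F z := by
  obtain ⟨b, -, hb0, hA⟩ := hss.exists_eq
  have hc := commute_leading_coeff hξ hz
  rw [hA z] at hc ⊢
  have hL := mem_degreeLE_iff.mp (interior_subset hz)
  have htw := hL.twisted (hξ.twisted z) (j := -((2 * p + 1 : ℕ) : ℤ))
    (Finset.mem_Icc.mpr (by omega))
  refine ⟨_, eq_smul_of_commute (hb0 z) ?_ hc⟩
  rw [htw, zpow_neg, zpow_natCast, Odd.neg_one_pow ⟨p, rfl⟩]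
  simp

/-- The degree of a polynomial Killing field does not depend on the point. -/
theorem exists_uniform_degree (hss : IsSemisimpleFrame F) (hξ : IsPolynomialKillingField F ξ) :
    ∃ p : ℕ, 0 < p ∧ (∀ z, z ∈ degreeLE ξ (2 * p + 1)) ∧
      ∀ z, ∀ C, HasLaurentExpansion (ξ z) (2 * p + 1) C →
        (C (-((2 * p + 1 : ℕ) : ℤ)) * C (-((2 * p + 1 : ℕ) : ℤ))).trace ≠ 0 := by
  obtain ⟨b, -, hb0, hA⟩ := hss.exists_eq
  have hcl := isClosed_degreeLE hξ.smooth
  choose p hp0 C hC hC1 hC2 using hξ.laurent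
  let q : ℂ → ℂ := fun ζ => (ξ 0 ζ * ξ 0 ζ).trace
  -- The bottom coefficient of the given expansion is nonzero, so no expansion of smaller order
  -- exists.
  have hlt : ∀ z n, z ∈ degreeLE ξ n → 2 * p z + 1 ≤ n := by
    rintro z n ⟨D, hD⟩
    by_contra! hn
    have h1 := (hC z).tendsto
    have h2 : Tendsto (fun ζ : ℂ => ζ ^ (2 * p z + 1 - n) • (ζ ^ n • ξ z ζ)) (𝓝[≠] 0)
        (𝓝 ((0 : ℂ) ^ (2 * p z + 1 - n) • D (-(n : ℤ)))) :=
      (((continuous_pow _).tendsto 0).mono_left nhdsWithin_le_nhds).smul hD.tendsto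
    rw [zero_pow (by omega), zero_smul] at h2
    refine hC1 z (tendsto_nhds_unique h1 (h2.congr fun ζ => ?_))
    rw [smul_smul, ← pow_add]
    congr 2
    omega
  -- Every open set contains a point whose degree is attained as a bound on a neighbourhood. There
  -- the bottom coefficient is a nonzero multiple of `α_𝔪(∂/∂z)`, whose square has trace `2`, so `tr
  -- ξ²` has a pole of order exactly twice the degree.
  have hlocal : ∀ W : Set ℂ, IsOpen W → W.Nonempty → ∃ z ∈ W, ∃ c : ℂ, c ≠ 0 ∧
      Tendsto (fun ζ : ℂ => ζ ^ (2 * (2 * p z + 1)) * q ζ) (𝓝[≠] 0) (𝓝 c) := by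
    intro W hW hWne
    have hdense := dense_iUnion_interior_of_closed hcl
      (Set.eq_univ_of_forall fun z => Set.mem_iUnion.mpr ⟨_, C z, hC z⟩)
    have hex : ∃ n, (W ∩ interior (degreeLE ξ n)).Nonempty := by
      obtain ⟨z, hzW, hz⟩ := hdense.inter_open_nonempty W hW hWne
      obtain ⟨n, hn⟩ := Set.mem_iUnion.mp hz
      exact ⟨n, z, hzW, hn⟩
    classical
    -- Take the least `n` for which `degreeLE ξ n` has interior meeting `W`. If no point there had
    -- degree exactly `n`, the same open set would lie in `degreeLE ξ (n - 1)`.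
    obtain ⟨z, hzW, hz, hzn⟩ : ∃ z ∈ W, z ∈ interior (degreeLE ξ (Nat.find hex)) ∧
        2 * p z + 1 = Nat.find hex := by
      by_contra! hne
      obtain ⟨z, hzW, hz⟩ := Nat.find_spec hex
      have hpos : 0 < Nat.find hex := by
        have := hlt z _ (interior_subset hz)
        omega
      refine Nat.find_min hex (m := Nat.find hex - 1) (by omega) ⟨z, hzW, ?_⟩
      refine interior_maximal (t := W ∩ interior (degreeLE ξ (Nat.find hex))) ?_
        (hW.inter isOpen_interior) ⟨hzW, hz⟩
      rintro w ⟨hwW, hw⟩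
      have h1 := hlt w _ (interior_subset hw)
      have h2 := hne w hwW hw
      refine ⟨fun j => if j ∈ Finset.Icc (-((2 * p w + 1 : ℕ) : ℤ)) ((2 * p w + 1 : ℕ) : ℤ)
        then C w j else 0, fun ζ hζ => ?_⟩
      rw [hC w ζ hζ]
      refine Finset.sum_subset_zero_on_sdiff (fun j hj => ?_) (fun j hj => ?_) (fun j hj => ?_)
      · rw [Finset.mem_Icc] at hj ⊢; omega
      · simp only [if_neg (Finset.mem_sdiff.mp hj).2, smul_zero]
      · simp only [if_pos hj]
    refine ⟨z, hzW, _, ?_, tendsto_trace_sq hξ (mem_degreeLE_iff.mp ⟨C z, hC z⟩)⟩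
    rw [← hzn] at hz
    obtain ⟨c, hc⟩ := trace_leading_coeff hss hξ hz
    have hc0 : c ≠ 0 := by
      rintro rfl
      rw [zero_smul, (hC z).laurentCoeff_eq (by omega) (Finset.mem_Icc.mpr (by omega))] at hc
      exact hC1 z hc
    rw [hc, hA z]
    simp [Matrix.trace_fin_two]
    field_simp [hb0 z]
    ring_nf
    simp [hc0]
  obtain ⟨z₀, -, c₀, hc₀, hlim₀⟩ := hlocal Set.univ isOpen_univ ⟨0, trivial⟩
  have huniq : ∀ (m n : ℕ) (c d : ℂ), d ≠ 0 →
      Tendsto (fun ζ : ℂ => ζ ^ m * q ζ) (𝓝[≠] 0) (𝓝 c) →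
      Tendsto (fun ζ : ℂ => ζ ^ n * q ζ) (𝓝[≠] 0) (𝓝 d) → n ≤ m := by
    intro m n c d hd hc hd'
    by_contra! hmn
    have h2 : Tendsto (fun ζ : ℂ => ζ ^ (n - m) * (ζ ^ m * q ζ)) (𝓝[≠] 0)
        (𝓝 ((0 : ℂ) ^ (n - m) * c)) :=
      (((continuous_pow _).tendsto 0).mono_left nhdsWithin_le_nhds).mul hc
    rw [zero_pow (by omega), zero_mul] at h2
    refine hd (tendsto_nhds_unique hd' (h2.congr fun ζ => ?_))
    rw [← mul_assoc, ← pow_add]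
    congr 2
    omega
  -- The pole order of `tr ξ²` is the same for all `z`, so the points found by `hlocal` all have the
  -- degree of `z₀`; they are dense, and the degree bound is a closed condition.
  have hall : ∀ z, z ∈ degreeLE ξ (2 * p z₀ + 1) := by
    have hd : Dense (degreeLE ξ (2 * p z₀ + 1)) := by
      rw [dense_iff_inter_open]
      intro W hW hWne
      obtain ⟨z, hzW, c, hc, hlim⟩ := hlocal W hW hWne
      have h1 := huniq _ _ _ _ hc hlim₀ hlim
      have h2 := huniq _ _ _ _ hc₀ hlim hlim₀
      have h3 : p z = p z₀ := by omega
      exact ⟨z, hzW, h3 ▸ ⟨C z, hC z⟩⟩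
    intro z
    rw [← (hcl (2 * p z₀ + 1)).closure_eq]
    exact hd z
  refine ⟨p z₀, hp0 z₀, hall, fun z D hD => ?_⟩
  rw [tendsto_nhds_unique (tendsto_trace_sq hξ hD) hlim₀]
  exact hc₀

/-- The leading coefficient of a polynomial Killing field is a constant multiple of
`α_𝔪(∂/∂z)`. -/
theorem exists_leading_coeff (hss : IsSemisimpleFrame F) (hξ : IsPolynomialKillingField F ξ) :
    ∃ (p : ℕ) (c : ℂ) (C : ℂ → ℤ → Mat), 0 < p ∧ c ≠ 0 ∧
      (∀ z, HasLaurentExpansion (ξ z) (2 * p + 1) (C z)) ∧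
      (∀ j, ContDiff ℝ ∞ fun z => C z j) ∧
      (∀ z, C z (-(2 * (p : ℤ) + 1)) = c • alphaMdz F z) ∧
      (∀ z X, fderiv ℝ (fun w => C w (-(2 * (p : ℤ) + 1))) z X +
        X • (alphaMdz F z * C z (-(2 * (p : ℤ))) - C z (-(2 * (p : ℤ))) * alphaMdz F z) +
        (tPart (mcForm F z X) * C z (-(2 * (p : ℤ) + 1)) -
          C z (-(2 * (p : ℤ) + 1)) * tPart (mcForm F z X)) = 0) ∧
      ∀ z X, fderiv ℝ (fun w => C w (2 * (p : ℤ) + 1)) z X +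
        conj X • (alphaMdzbar F z * C z (2 * (p : ℤ)) - C z (2 * (p : ℤ)) * alphaMdzbar F z) +
        (tPart (mcForm F z X) * C z (2 * (p : ℤ) + 1) -
          C z (2 * (p : ℤ) + 1) * tPart (mcForm F z X)) = 0 := by
  obtain ⟨b, hbs, hb0, hA⟩ := hss.exists_eq
  obtain ⟨p, hp, hdeg, htr⟩ := exists_uniform_degree hss hξ
  have hint : interior (degreeLE ξ (2 * p + 1)) = Set.univ := by
    rw [Set.eq_univ_of_forall hdeg, interior_univ]
  choose k hk using fun z => trace_leading_coeff hss hξ (p := p) (z := z) (hint ▸ Set.mem_univ z)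
  have hcan := fun z => mem_degreeLE_iff.mp (hdeg z)
  set N := 2 * (2 * p + 1) + 3 with hN
  have hidx : -((2 * p + 1 : ℕ) : ℤ) = -(2 * (p : ℤ) + 1) := by push_cast; rfl
  rw [hidx] at hk
  have hkc : Continuous k := by
    have h1 : k = fun z => laurentCoeff N (ξ z) (-(2 * (p : ℤ) + 1)) 0 1 / b z := by
      funext z
      rw [hk z, hA z]
      simp [hb0 z]
    rw [h1]
    have h2 := (contDiff_laurentCoeff hξ.smooth N (-(2 * (p : ℤ) + 1))).continuous
    exact (h2.matrix_elem 0 1).div hbs.continuous hb0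
  have hksq : ∀ z, 2 * k z ^ 2 = (laurentCoeff N (ξ z) (-(2 * (p : ℤ) + 1)) *
      laurentCoeff N (ξ z) (-(2 * (p : ℤ) + 1))).trace := by
    intro z
    rw [hk z, hA z]
    simp [Matrix.trace_fin_two]
    field_simp [hb0 z]
    ring
  have hk0 : ∀ z, k z ≠ 0 := by
    intro z h0
    have := htr z _ (hcan z)
    rw [hidx, ← hksq z, h0] at this
    simp at this
  -- The limit of `ζ^{4p+2} tr ξ²` is `2 k²` and does not depend on `z`; a continuous nonvanishing
  -- function with constant square on a connected set is constant.
  have hkconst : ∀ z, k z = k 0 := by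
    have hsq : ∀ z, k z ^ 2 = k 0 ^ 2 := by
      intro z
      have h1 := tendsto_nhds_unique (tendsto_trace_sq hξ (hcan z)) (tendsto_trace_sq hξ (hcan 0))
      rw [hidx, ← hksq z, ← hksq 0] at h1
      exact mul_left_cancel₀ two_ne_zero h1
    intro z
    exact isPreconnected_univ.eq_of_sq_eq (f := k) (g := fun _ => k 0) hkc.continuousOn
      continuousOn_const (fun w _ => hsq w) (fun _ => hk0 0) (Set.mem_univ 0) rfl (Set.mem_univ z)
  refine ⟨p, k 0, fun z => laurentCoeff N (ξ z), hp, hk0 0, hcan,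
    contDiff_laurentCoeff hξ.smooth N, fun z => (hk z).trans (by rw [hkconst z]),
    fun z X => ?_, fun z X => ?_⟩
  · have h1 := hξ.lax_coeff N (-(2 * (p : ℤ) + 1)) z X
    have h0 : laurentCoeff N (ξ z) (-(2 * (p : ℤ) + 1) - 1) = 0 :=
      (hcan z).laurentCoeff_eq_zero (Or.inr (by push_cast [hN]; omega))
    rw [h0, mul_zero, zero_mul, sub_zero, smul_zero, add_zero,
      show -(2 * (p : ℤ) + 1) + 1 = -(2 * (p : ℤ)) by ring] at h1
    exact h1
  · have h1 := hξ.lax_coeff N (2 * (p : ℤ) + 1) z X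
    have h0 : laurentCoeff N (ξ z) (2 * (p : ℤ) + 1 + 1) = 0 :=
      (hcan z).laurentCoeff_eq_zero (Or.inl (by push_cast [hN]; omega))
    rw [h0, mul_zero, zero_mul, sub_zero, smul_zero, add_zero, add_sub_cancel_right,
      add_right_comm] at h1
    exact h1

end Killing

/-! ### Connections on the plane -/

section Connections

attribute [local instance] NormedAlgebra.toNormedSpace

variable {A : Type*} [NormedRing A] [NormedAlgebra ℝ A]

/-- A smooth 1-form on the plane with values in `A`. -/
structure IsSmoothForm (β : ℂ → ℂ → A) : Prop where
  smooth : ∀ X, ContDiff ℝ ∞ fun z => β z X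
  map_add : ∀ z X Y, β z (X + Y) = β z X + β z Y
  map_smul : ∀ z (r : ℝ) X, β z (r • X) = r • β z X

/-- The connection `d + β` is flat. -/
def IsFlat (β : ℂ → ℂ → A) : Prop :=
  ∀ z u v, fderiv ℝ (fun w => β w v) z u - fderiv ℝ (fun w => β w u) z v +
    (β z u * β z v - β z v * β z u) = 0

/-- `H` solves `dH = H β` with `H(0) = 1`. -/
structure IsFrameOf (β : ℂ → ℂ → A) (H : ℂ → A) : Prop where
  zero : H 0 = 1
  differentiable : Differentiable ℝ H
  deriv : ∀ z X, fderiv ℝ H z X = H z * β z X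

theorem IsSmoothForm.exists_clm {β : ℂ → ℂ → A} (h : IsSmoothForm β) :
    ∃ B : ℂ → ℂ →L[ℝ] A, ContDiff ℝ ∞ B ∧ ∀ z X, B z X = β z X := by
  refine ⟨fun z => LinearMap.toContinuousLinearMap
    { toFun := β z, map_add' := h.map_add z, map_smul' := h.map_smul z }, ?_, fun z X => rfl⟩
  exact contDiff_clm_apply_iff.mpr h.smooth

theorem IsSmoothForm.continuous_ray {β : ℂ → ℂ → A} (h : IsSmoothForm β) (z X : ℂ) :
    Continuous fun t : ℝ => β (t • z) X :=
  (h.smooth X).continuous.comp (by fun_prop)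

theorem IsSmoothForm.add {β γ : ℂ → ℂ → A} (hβ : IsSmoothForm β) (hγ : IsSmoothForm γ) :
    IsSmoothForm fun z X => β z X + γ z X where
  smooth X := (hβ.smooth X).add (hγ.smooth X)
  map_add z X Y := by simp only [hβ.map_add, hγ.map_add]; abel
  map_smul z r X := by simp only [hβ.map_smul, hγ.map_smul, smul_add]

theorem IsSmoothForm.sum {ι : Type*} (s : Finset ι) {β : ι → ℂ → ℂ → A}
    (hβ : ∀ i, IsSmoothForm (β i)) : IsSmoothForm fun z X => ∑ i ∈ s, β i z X where
  smooth X := ContDiff.sum fun i _ => (hβ i).smooth X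
  map_add z X Y := by simp only [(hβ _).map_add, Finset.sum_add_distrib]
  map_smul z r X := by simp only [(hβ _).map_smul, Finset.smul_sum]

theorem IsSmoothForm.zero : IsSmoothForm fun _ _ : ℂ => (0 : A) where
  smooth _ := contDiff_const
  map_add := by simp
  map_smul := by simp

theorem exists_frame [CompleteSpace A] {β : ℂ → ℂ → A} (hβ : IsSmoothForm β) (hf : IsFlat β) :
    ∃ H, IsFrameOf β H := by
  obtain ⟨B, hB, hBβ⟩ := hβ.exists_clm
  have hB' : ∀ z X, HasFDerivAt (fun w => β w X) ((fderiv ℝ B z).flip X) z := by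
    intro z X
    have := ((hB.differentiable (by simp) z).hasFDerivAt).clm_apply (hasFDerivAt_const X z)
    simpa [hBβ] using this
  obtain ⟨H, hH0, hH⟩ := exists_flat_frame B (hB.of_le (by norm_cast)) (fun z u v => by
    have := hf z u v
    rw [(hB' z v).fderiv, (hB' z u).fderiv] at this
    simpa [hBβ] using this)
  refine ⟨H, hH0, fun z => (hH z).differentiableAt, fun z X => ?_⟩
  rw [(hH z).fderiv]
  simp [hBβ]

theorem IsFrameOf.hasDerivAt_ray {β : ℂ → ℂ → A} {H : ℂ → A} (h : IsFrameOf β H) (z : ℂ) (t : ℝ) :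
    HasDerivAt (fun t : ℝ => H (t • z)) (H (t • z) * β (t • z) z) t := by
  rw [← h.deriv]
  have h1 : HasDerivAt (fun t : ℝ => t • z) z t := by
    simpa using (hasDerivAt_id t).smul_const z
  exact (h.differentiable (t • z)).hasFDerivAt.comp_hasDerivAt t h1

/-- Only the equation in the radial direction is needed to identify two maps, which keeps
verifications of equality one-dimensional. -/
theorem eq_of_ray_ode {β : ℂ → ℂ → A} (hβ : IsSmoothForm β) {M₁ M₂ : ℂ → A} (z : ℂ)
    (h₁ : ∀ t : ℝ, HasDerivAt (fun t : ℝ => M₁ (t • z)) (M₁ (t • z) * β (t • z) z) t)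
    (h₂ : ∀ t : ℝ, HasDerivAt (fun t : ℝ => M₂ (t • z)) (M₂ (t • z) * β (t • z) z) t)
    (h0 : M₁ 0 = M₂ 0) : M₁ z = M₂ z := by
  have hc := hβ.continuous_ray z z
  have := linear_ode_unique (Y := fun t : ℝ => M₁ (t • z)) (Z := fun t : ℝ => M₂ (t • z))
    (L := fun t : ℝ => (ContinuousLinearMap.mul ℝ A).flip (β (t • z) z))
    ((ContinuousLinearMap.mul ℝ A).flip.continuous.comp hc) (fun t _ => h₁ t) (fun t _ => h₂ t) (by simpa using h0)
  simpa using this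

theorem IsFrameOf.unique {β : ℂ → ℂ → A} (hβ : IsSmoothForm β) {H₁ H₂ : ℂ → A}
    (h₁ : IsFrameOf β H₁) (h₂ : IsFrameOf β H₂) (z : ℂ) : H₁ z = H₂ z :=
  eq_of_ray_ode hβ z (h₁.hasDerivAt_ray z) (h₂.hasDerivAt_ray z) (h₁.zero.trans h₂.zero.symm)

theorem IsFrameOf.exists_mul_eq_one [CompleteSpace A] {β : ℂ → ℂ → A} (hβ : IsSmoothForm β)
    {H : ℂ → A} (h : IsFrameOf β H) (z : ℂ) : ∃ W, H z * W = 1 := by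
  have := exists_mul_eq_one_of_linear_ode (Y := fun t : ℝ => H (t • z)) (hβ.continuous_ray z z)
    (by simpa using h.zero) (fun t _ => h.hasDerivAt_ray z t)
  simpa using this

/-- The Maurer-Cartan equation. -/
theorem isFlat_mul_fderiv {F G : ℂ → A} (hF : ContDiff ℝ ∞ F) (hG : ContDiff ℝ ∞ G)
    (hGF : ∀ z, G z * F z = 1) (hFG : ∀ z, F z * G z = 1) :
    IsFlat fun z X => G z * fderiv ℝ F z X := by
  intro z u v
  have hF' : ContDiff ℝ ∞ (fderiv ℝ F) := hF.fderiv_right (by simp)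
  have hd : ∀ X, HasFDerivAt (fun w => fderiv ℝ F w X) ((fderiv ℝ (fderiv ℝ F) z).flip X) z := by
    intro X
    simpa using ((hF'.differentiable (by simp) z).hasFDerivAt).clm_apply (hasFDerivAt_const X z)
  have hGd := (hG.differentiable (by simp) z).hasFDerivAt
  have hFd := (hF.differentiable (by simp) z).hasFDerivAt
  have hsymm : fderiv ℝ (fderiv ℝ F) z u v = fderiv ℝ (fderiv ℝ F) z v u :=
    (hF.contDiffAt.isSymmSndFDerivAt (by rw [minSmoothness_of_isRCLikeNormedField]; exact WithTop.coe_le_coe.mpr le_top)) u v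
  have hG' : ∀ X, fderiv ℝ G z X = -(G z * fderiv ℝ F z X * G z) := by
    intro X
    have h1 : HasFDerivAt (fun w => G w * F w) (0 : ℂ →L[ℝ] A) z := by
      simp only [hGF]
      exact hasFDerivAt_const _ _
    have h2 := DFunLike.congr_fun ((hGd.mul' hFd).unique h1) X
    have h3 : G z * fderiv ℝ F z X + fderiv ℝ G z X * F z = 0 := h2
    calc fderiv ℝ G z X = (G z * fderiv ℝ F z X + fderiv ℝ G z X * F z) * G z -
          G z * fderiv ℝ F z X * G z := by
          rw [add_mul, mul_assoc (fderiv ℝ G z X), hFG]; noncomm_ring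
      _ = _ := by rw [h3]; simp
  change fderiv ℝ (G * fun w => fderiv ℝ F w v) z u - fderiv ℝ (G * fun w => fderiv ℝ F w u) z v +
    (G z * fderiv ℝ F z u * (G z * fderiv ℝ F z v) - G z * fderiv ℝ F z v * (G z * fderiv ℝ F z u)) = 0
  rw [(hGd.mul' (hd v)).fderiv, (hGd.mul' (hd u)).fderiv]
  change (G z * fderiv ℝ (fderiv ℝ F) z u v + fderiv ℝ G z u * fderiv ℝ F z v) -
    (G z * fderiv ℝ (fderiv ℝ F) z v u + fderiv ℝ G z v * fderiv ℝ F z u) +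
    (G z * fderiv ℝ F z u * (G z * fderiv ℝ F z v) - G z * fderiv ℝ F z v * (G z * fderiv ℝ F z u)) = 0
  rw [hsymm, hG', hG']
  noncomm_ring

variable [NormedAlgebra ℂ A]

theorem IsSmoothForm.const_smul [SMulCommClass ℝ ℂ A] {β : ℂ → ℂ → A} (hβ : IsSmoothForm β) (c : ℂ) :
    IsSmoothForm fun z X => c • β z X where
  smooth X := (hβ.smooth X).const_smul c
  map_add z X Y := by simp only [hβ.map_add, smul_add]
  map_smul z r X := by simp only [hβ.map_smul, smul_comm c r]

theorem IsSmoothForm.dz [SMulCommClass ℝ ℂ A] [IsScalarTower ℝ ℂ A] {M : ℂ → A} (hM : ContDiff ℝ ∞ M) :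
    IsSmoothForm fun z X => X • M z where
  smooth X := hM.const_smul X
  map_add _ _ _ := add_smul _ _ _
  map_smul _ _ _ := smul_assoc _ _ _

theorem IsSmoothForm.dzbar [SMulCommClass ℝ ℂ A] [IsScalarTower ℝ ℂ A] {M : ℂ → A} (hM : ContDiff ℝ ∞ M) :
    IsSmoothForm fun z X => conj X • M z where
  smooth X := hM.const_smul (conj X)
  map_add z X Y := by rw [RingHom.map_add, add_smul]
  map_smul z r X := by
    rw [Complex.real_smul, RingHom.map_mul, Complex.conj_ofReal, ← Complex.real_smul, smul_assoc]

/-- Twisting a flat connection by a solution of its Lax equation. -/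
theorem IsFlat.sub_smul [SMulCommClass ℝ ℂ A] {α : ℂ → ℂ → A} (hα : IsFlat α) (hαd : ∀ X, Differentiable ℝ fun z => α z X)
    {ξ : ℂ → A} (hξd : Differentiable ℝ ξ)
    (hl : ∀ z X, fderiv ℝ ξ z X + (α z X * ξ z - ξ z * α z X) = 0) (θ : ℂ → ℂ) :
    IsFlat fun z X => α z X - θ X • ξ z := by
  intro z u v
  have hd : ∀ X, HasFDerivAt (fun w => α w X - θ X • ξ w)
      (fderiv ℝ (fun w => α w X) z - θ X • fderiv ℝ ξ z) z := fun X =>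
    (hαd X z).hasFDerivAt.sub ((hξd z).hasFDerivAt.const_smul (θ X))
  beta_reduce
  rw [(hd v).fderiv, (hd u).fderiv]
  -- Since `θ` has constant coefficients, only `ξ` is differentiated. The Lax equation cancels the
  -- mixed commutators, and the quadratic term is a multiple of `[ξ, ξ] = 0`.
  have h1 := hα z u v
  have h2 := eq_neg_of_add_eq_zero_left (hl z u)
  have h3 := eq_neg_of_add_eq_zero_left (hl z v)
  change (fderiv ℝ (fun w => α w v) z u - θ v • fderiv ℝ ξ z u) -
    (fderiv ℝ (fun w => α w u) z v - θ u • fderiv ℝ ξ z v) + _ = 0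
  rw [h2, h3, ← h1]
  simp only [mul_sub, sub_mul, smul_sub, smul_mul_assoc, mul_smul_comm, neg_sub]
  rw [smul_comm (θ u) (θ v)]
  abel

/-- If `H` is a frame for `α - θ ξ`, where `ξ` solves the Lax equation of `α`, then `H` conjugates
`ξ(z)` into `ξ(0)`. -/
theorem IsFrameOf.lax_conj {α : ℂ → ℂ → A} {ξ : ℂ → A} (hξd : Differentiable ℝ ξ)
    (hl : ∀ z X, fderiv ℝ ξ z X + (α z X * ξ z - ξ z * α z X) = 0) {θ : ℂ → ℂ}
    (hβ : IsSmoothForm fun z X => α z X - θ X • ξ z) {H : ℂ → A}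
    (hH : IsFrameOf (fun z X => α z X - θ X • ξ z) H) (z : ℂ) : ξ 0 * H z = H z * ξ z := by
  -- Both products solve the same right-multiplication equation: differentiating `H ξ` gives `H (α -
  -- θξ) ξ + H [ξ, α] = H ξ (α - θξ)`.
  refine eq_of_ray_ode hβ (M₁ := fun z => ξ 0 * H z) (M₂ := fun z => H z * ξ z) z
    (fun t => ?_) (fun t => ?_) ?_
  · rw [mul_assoc]
    exact (hH.hasDerivAt_ray z t).const_mul (ξ 0)
  · have h1 : HasDerivAt (fun t : ℝ => t • z) z t := by
      simpa using (hasDerivAt_id t).smul_const z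
    have h2 := (hH.hasDerivAt_ray z t).mul ((hξd (t • z)).hasFDerivAt.comp_hasDerivAt t h1)
    refine h2.congr_deriv ?_
    rw [eq_neg_of_add_eq_zero_left (hl (t • z) z)]
    simp only [Function.comp, mul_sub, sub_mul, mul_smul_comm, smul_mul_assoc, mul_assoc, neg_sub]
    abel
  · simp [hH.zero]

/-- If `H` is a frame for `α - θ ξ`, where `ξ` solves the Lax equation of `α`, then
`exp(θ(z) ξ(0)) H` is a frame for `α`. -/
theorem IsFrameOf.exp_mul [SMulCommClass ℝ ℂ A] [CompleteSpace A] [IsScalarTower ℝ ℂ A] {α : ℂ → ℂ → A} {ξ : ℂ → A}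
    (hξd : Differentiable ℝ ξ)
    (hl : ∀ z X, fderiv ℝ ξ z X + (α z X * ξ z - ξ z * α z X) = 0) (θ : ℂ →L[ℝ] ℂ)
    (hβ : IsSmoothForm fun z X => α z X - θ X • ξ z) {H : ℂ → A}
    (hH : IsFrameOf (fun z X => α z X - θ X • ξ z) H) :
    IsFrameOf α fun z => NormedSpace.exp (θ z • ξ 0) * H z := by
  have hexp : ∀ z, HasFDerivAt (fun z => NormedSpace.exp (θ z • ξ 0))
      ((NormedSpace.exp (θ z • ξ 0)) • θ.smulRight (ξ 0)) z := by
    intro z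
    have h1 := ((hasFDerivAt_exp_smul_const (𝕂 := ℂ) (ξ 0) (θ z)).restrictScalars ℝ).comp z
      θ.hasFDerivAt
    refine h1.congr_fderiv ?_
    ext X
    rfl
  have hd := fun z => (hexp z).mul' (hH.differentiable z).hasFDerivAt
  refine ⟨by simp [hH.zero], fun z => (hd z).differentiableAt, fun z X => ?_⟩
  change fderiv ℝ ((fun z => NormedSpace.exp (θ z • ξ 0)) * H) z X = _
  rw [(hd z).fderiv]
  change NormedSpace.exp (θ z • ξ 0) * fderiv ℝ H z X +
    NormedSpace.exp (θ z • ξ 0) * (θ X • ξ 0) * H z = _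
  -- Moving `ξ 0` across `H` turns the term coming from the exponential into `θ H ξ(z)`, which
  -- cancels the gauge term.
  rw [hH.deriv, mul_assoc _ (θ X • ξ 0), smul_mul_assoc, hH.lax_conj hξd hl hβ]
  simp only [mul_sub, mul_smul_comm, mul_assoc]
  abel

/-- Holomorphic dependence of the frame on the parameter of a polynomial family of connections. -/
theorem exists_frame_family [SMulCommClass ℝ ℂ A] [CompleteSpace A] {ι : Type*} [Fintype ι] (e : ι → ℕ)
    (Γ : ι → ℂ → ℂ → A) (hΓ : ∀ i, IsSmoothForm (Γ i))
    (hf : ∀ l : ℂ, l ≠ 0 → IsFlat fun z X => ∑ i, l ^ e i • Γ i z X) :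
    ∃ H : ℂ → ℂ → A, (∀ l, IsFrameOf (fun z X => ∑ i, l ^ e i • Γ i z X) (H l)) ∧
      ∀ z, Differentiable ℂ fun l => H l z := by
  have hd : ∀ l z X : ℂ, HasFDerivAt (𝕜 := ℝ) (fun w : ℂ => ∑ i, l ^ e i • Γ i w X)
      (∑ i, l ^ e i • fderiv ℝ (fun w => Γ i w X) z) z := by
    intro l z X
    exact HasFDerivAt.fun_sum fun i _ =>
      (((hΓ i).smooth X).differentiable (by simp) z).hasFDerivAt.fun_const_smul (l ^ e i)
  -- Curvature is continuous in `l`, so flatness extends from `l ≠ 0` to `l = 0`, the point where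
  -- the gauge transformation is used.
  have hflat : ∀ l : ℂ, IsFlat fun z X => ∑ i, l ^ e i • Γ i z X := by
    intro l z u v
    have hc : Continuous fun l : ℂ => fderiv ℝ (fun w => ∑ i, l ^ e i • Γ i w v) z u -
        fderiv ℝ (fun w => ∑ i, l ^ e i • Γ i w u) z v +
        ((∑ i, l ^ e i • Γ i z u) * (∑ i, l ^ e i • Γ i z v) -
          (∑ i, l ^ e i • Γ i z v) * (∑ i, l ^ e i • Γ i z u)) := by
      simp only [(hd _ z _).fderiv, sum_apply, smul_apply]
      fun_prop
    refine congrFun (hc.ext_on (dense_compl_singleton (0 : ℂ)) continuous_const ?_) l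
    intro l hl
    exact hf l hl z u v
  have hsm : ∀ l : ℂ, IsSmoothForm fun z X => ∑ i, l ^ e i • Γ i z X := fun l =>
    IsSmoothForm.sum _ fun i => (hΓ i).const_smul _
  choose H hH using fun l => exists_frame (hsm l) (hflat l)
  refine ⟨H, hH, fun z => ?_⟩
  have hcont : ∀ i, Continuous fun q : ℂ × ℝ => Γ i (q.2 • z) z := fun i =>
    ((hΓ i).continuous_ray z z).comp continuous_snd
  have := differentiable_of_linear_ode (fun l t => ∑ i, l ^ e i • Γ i (t • z) z)
    (fun l t => ∑ i, ((e i : ℂ) * l ^ (e i - 1)) • Γ i (t • z) z)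
    (fun l t => HasDerivAt.fun_sum fun i _ => (hasDerivAt_pow (e i) l).smul_const _)
    (continuous_finsetSum _ fun i _ => (continuous_fst.pow (e i)).smul (hcont i))
    (continuous_finsetSum _ fun i _ =>
      (continuous_const.mul (continuous_fst.pow (e i - 1))).smul (hcont i)) (fun l t => H l (t • z)) (fun l => by simpa using (hH l).zero)
    (fun l t => (hH l).hasDerivAt_ray z t)
  simpa using this

end Connections

/-! ### Flatness of the loop of connections -/

section Loops

attribute [local instance] NormedAlgebra.toNormedSpace

variable {A : Type*} [NormedRing A] [NormedAlgebra ℝ A]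

theorem IsSmoothForm.map {β : ℂ → ℂ → A} (hβ : IsSmoothForm β) (T : A →ₗ[ℝ] A)
    (hT : Continuous T) : IsSmoothForm fun z X => T (β z X) where
  smooth X := (⟨T, hT⟩ : A →L[ℝ] A).contDiff.comp (hβ.smooth X)
  map_add z X Y := by rw [hβ.map_add, _root_.map_add]
  map_smul z r X := by rw [hβ.map_smul, _root_.map_smul]

/-- A linear functional of a frame which satisfies a homogeneous scalar equation. -/
theorem IsFrameOf.eq_zero_of_functional {β : ℂ → ℂ → A} {H : ℂ → A} (hH : IsFrameOf β H)
    (Λ : A →ₗ[ℝ] ℂ) (hΛ : Continuous Λ) (g : ℂ → ℂ → ℂ)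
    (hgc : ∀ z, Continuous fun t : ℝ => g (t • z) z)
    (hg : ∀ M z X, Λ (M * β z X) = Λ M * g z X) (h1 : Λ 1 = 0) (z : ℂ) : Λ (H z) = 0 := by
  let Λ' : A →L[ℝ] ℂ := ⟨Λ, hΛ⟩
  have hc := hgc z
  have := linear_ode_unique (Y := fun t : ℝ => Λ (H (t • z))) (Z := fun _ : ℝ => (0 : ℂ))
    (L := fun t : ℝ => (ContinuousLinearMap.mul ℝ ℂ).flip (g (t • z) z))
    ((ContinuousLinearMap.mul ℝ ℂ).flip.continuous.comp hc)
    (fun t _ => by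
      have h := Λ'.hasFDerivAt.comp_hasDerivAt t (hH.hasDerivAt_ray z t)
      refine h.congr_deriv ?_
      exact hg _ _ _)
    (fun t _ => by simpa using hasDerivAt_const t (0 : ℂ)) (by simp [hH.zero, h1])
  simpa using this

/-- The Maurer-Cartan form of a map which is unitary with respect to `S`. -/
theorem fderiv_unitary {F : ℂ → A} (hF : Differentiable ℝ F) (S : A →ₗ[ℝ] A) (hS : Continuous S)
    (h : ∀ z, S (F z) * F z = 1) (z X : ℂ) :
    S (F z) * fderiv ℝ F z X + S (fderiv ℝ F z X) * F z = 0 := by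
  let S' : A →L[ℝ] A := ⟨S, hS⟩
  have h1 : HasFDerivAt (fun w => S' (F w) * F w) (0 : ℂ →L[ℝ] A) z := by
    have : (fun w => S' (F w) * F w) = fun _ => 1 := funext h
    rw [this]
    exact hasFDerivAt_const _ _
  have h2 := (S'.hasFDerivAt.comp z (hF z).hasFDerivAt).mul' (hF z).hasFDerivAt
  exact DFunLike.congr_fun (h2.unique h1) X

variable [NormedAlgebra ℂ A] [SMulCommClass ℝ ℂ A]

/-- If `C = cA` is the extreme coefficient of a solution of the Lax equations, then `A` is parallel
in the direction of the corresponding type. -/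
theorem parallel_of_lax {M C N : ℂ → A} (hM : Differentiable ℝ M) {c : ℂ} (hc : c ≠ 0)
    (hC : ∀ z, C z = c • M z) (t : ℂ → ℂ → A) (θ : ℂ → ℂ)
    (hl : ∀ z X, fderiv ℝ C z X + θ X • (M z * N z - N z * M z) +
      (t z X * C z - C z * t z X) = 0) (z u v : ℂ) :
    θ v • fderiv ℝ M z u - θ u • fderiv ℝ M z v + θ u • (M z * t z v - t z v * M z) -
      θ v • (M z * t z u - t z u * M z) = 0 := by
  have hd : ∀ X, fderiv ℝ C z X = c • fderiv ℝ M z X := by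
    intro X
    have : C = fun z => c • M z := funext hC
    rw [this, ((hM z).hasFDerivAt.fun_const_smul c).fderiv]
    rfl
  have h1 := hl z u
  have h2 := hl z v
  rw [hd, hC] at h1 h2
  simp only [mul_smul_comm, smul_mul_assoc] at h1 h2
  -- Antisymmetrising in `u`, `v` eliminates the next coefficient `N`, which enters only through `θ
  -- X`.
  have h3 : c • (θ v • fderiv ℝ M z u - θ u • fderiv ℝ M z v +
      θ u • (M z * t z v - t z v * M z) - θ v • (M z * t z u - t z u * M z)) = 0 := by
    linear_combination (norm := module) θ v • h1 - θ u • h2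
  exact (smul_eq_zero.mp h3).resolve_left hc

/-- The loop of connections of a harmonic map is flat. -/
theorem isFlat_loop {P Q : ℂ → A} (hP : Differentiable ℝ P) (hQ : Differentiable ℝ Q)
    {t : ℂ → ℂ → A} (ht : ∀ X, Differentiable ℝ fun z => t z X)
    (hPt : ∀ z u v, v • fderiv ℝ P z u - u • fderiv ℝ P z v + u • (P z * t z v - t z v * P z) -
      v • (P z * t z u - t z u * P z) = 0)
    (hQt : ∀ z u v, conj v • fderiv ℝ Q z u - conj u • fderiv ℝ Q z v +
      conj u • (Q z * t z v - t z v * Q z) - conj v • (Q z * t z u - t z u * Q z) = 0)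
    (h1 : IsFlat fun z X => X • P z + t z X + conj X • Q z) {ζ : ℂ} (hζ : ζ ≠ 0) :
    IsFlat fun z X => (ζ⁻¹ * X) • P z + t z X + (ζ * conj X) • Q z := by
  have hd : ∀ a b z X : ℂ, HasFDerivAt (𝕜 := ℝ) (fun w => a • P w + t w X + b • Q w)
      (a • fderiv ℝ P z + fderiv ℝ (fun w => t w X) z + b • fderiv ℝ Q z) z := fun a b z X =>
    (((hP z).hasFDerivAt.fun_const_smul a).add (ht X z).hasFDerivAt).add
      ((hQ z).hasFDerivAt.fun_const_smul b)
  intro z u v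
  have h := h1 z u v
  have hp := hPt z u v
  have hq := hQt z u v
  beta_reduce at h ⊢
  rw [(hd _ _ z v).fderiv, (hd _ _ z u).fderiv] at h ⊢
  simp only [add_apply, smul_apply] at h ⊢
  simp only [mul_add, add_mul, smul_mul_assoc, mul_smul_comm] at h ⊢
  -- The curvature differs from that at `ζ = 1` only in its `ζ⁻¹` and `ζ` coefficients, which vanish
  -- by `hp` and `hq`; the `ζ^{±2}` terms are zero because `dz ∧ dz = dz̄ ∧ dz̄ = 0`.
  linear_combination (norm := (match_scalars <;> (try field_simp) <;> ring))
    h + (ζ⁻¹ - 1) • hp + (ζ - 1) • hq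

end Loops

/-! ### Passing from `ζ` to `λ = ζ²` -/

/-- The diagonal, upper and lower parts of a matrix. -/
def blockPart (t : Fin 3) : Mat →ₗ[ℂ] Mat where
  toFun M := ![!![M 0 0, 0; 0, M 1 1], !![0, M 0 1; 0, 0], !![0, 0; M 1 0, 0]] t
  map_add' M N := by
    ext i j
    fin_cases t <;> fin_cases i <;> fin_cases j <;> simp
  map_smul' r M := by
    ext i j
    fin_cases t <;> fin_cases i <;> fin_cases j <;> simp

/-- The exponents of `λ` in `Ad κ (ζ^k M)`. -/
def upExponent (k : ℕ) : Fin 3 → ℕ := ![k / 2, (k - 1) / 2, (k + 1) / 2]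

/-- The exponents of `λ⁻¹` in `Ad κ (ζ^{-k} M)`. -/
def downExponent (k : ℕ) : Fin 3 → ℕ := ![k / 2, (k + 1) / 2, (k - 1) / 2]

theorem kappa_inv {ζ : ℂ} (hζ : ζ ≠ 0) : (kappa ζ)⁻¹ = !![1, 0; 0, ζ⁻¹] := by
  refine Matrix.inv_eq_right_inv ?_
  ext i j
  fin_cases i <;> fin_cases j <;> simp [kappa, hζ]

theorem isUnit_kappa {ζ : ℂ} (hζ : ζ ≠ 0) : IsUnit (kappa ζ) := by
  rw [Matrix.isUnit_iff_isUnit_det]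
  simp [kappa, hζ]

theorem entries_of_twisted {M : Mat} {k : ℕ} (hM : tau * M * tau = (-1 : ℂ) ^ k • M) :
    (Even k → M 0 1 = 0 ∧ M 1 0 = 0) ∧ (Odd k → M 0 0 = 0 ∧ M 1 1 = 0) := by
  have h00 := congrFun (congrFun hM 0) 0
  have h01 := congrFun (congrFun hM 0) 1
  have h10 := congrFun (congrFun hM 1) 0
  have h11 := congrFun (congrFun hM 1) 1
  simp [tau, Matrix.mul_apply, Matrix.vecMul, dotProduct, Fin.sum_univ_two] at h00 h01 h10 h11
  constructor
  · intro hk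
    rw [hk.neg_one_pow] at h01 h10
    exact ⟨by linear_combination (-1 / 2) * h01, by linear_combination (-1 / 2) * h10⟩
  · intro hk
    rw [hk.neg_one_pow] at h00 h11
    exact ⟨by linear_combination (1 / 2) * h00, by linear_combination (1 / 2) * h11⟩

theorem kappa_conj (M : Mat) {ζ : ℂ} (hζ : ζ ≠ 0) :
    kappa ζ * M * (kappa ζ)⁻¹ = !![M 0 0, M 0 1 * ζ⁻¹; ζ * M 1 0, M 1 1] := by
  rw [kappa_inv hζ]
  ext i j
  fin_cases i <;> fin_cases j <;>
    simp [kappa, Matrix.mul_apply, Matrix.vecMul, dotProduct, Fin.sum_univ_two]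
  field_simp

/-- Conjugation by `κ` shifts the upper entry by `ζ⁻¹` and the lower one by `ζ`, so every block
surviving the parity condition carries an even power of `ζ`. Where the floor or the truncated
subtraction gives a wrong exponent, the block is zero. -/
theorem sum_upExponent {M : Mat} {k : ℕ} (hM : tau * M * tau = (-1 : ℂ) ^ k • M) {ζ : ℂ}
    (hζ : ζ ≠ 0) : ∑ t, (ζ ^ 2) ^ upExponent k t • blockPart t M =
      kappa ζ * (ζ ^ k • M) * (kappa ζ)⁻¹ := by
  obtain ⟨he, ho⟩ := entries_of_twisted hM
  rw [kappa_conj _ hζ]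
  rcases Nat.even_or_odd' k with ⟨m, rfl | rfl⟩
  · obtain ⟨h1, h2⟩ := he (even_two_mul m)
    ext i j
    fin_cases i <;> fin_cases j <;>
      simp [Fin.sum_univ_three, upExponent, blockPart, h1, h2, pow_mul]
  · obtain ⟨h1, h2⟩ := ho (odd_two_mul_add_one m)
    have e1 : (2 * m + 1 + 1) / 2 = m + 1 := by omega
    ext i j
    fin_cases i <;> fin_cases j <;>
      simp [Fin.sum_univ_three, upExponent, blockPart, h1, h2, e1, pow_add, pow_mul]
    · field_simp
    · ring

theorem sum_downExponent {M : Mat} {k : ℕ} (hM : tau * M * tau = (-1 : ℂ) ^ k • M) {ζ : ℂ}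
    (hζ : ζ ≠ 0) : ∑ t, ((ζ ^ 2)⁻¹) ^ downExponent k t • blockPart t M =
      kappa ζ * (ζ⁻¹ ^ k • M) * (kappa ζ)⁻¹ := by
  obtain ⟨he, ho⟩ := entries_of_twisted hM
  rw [kappa_conj _ hζ]
  rcases Nat.even_or_odd' k with ⟨m, rfl | rfl⟩
  · obtain ⟨h1, h2⟩ := he (even_two_mul m)
    ext i j
    fin_cases i <;> fin_cases j <;>
      simp [Fin.sum_univ_three, downExponent, blockPart, h1, h2, pow_mul]
  · obtain ⟨h1, h2⟩ := ho (odd_two_mul_add_one m)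
    have e1 : (2 * m + 1 + 1) / 2 = m + 1 := by omega
    ext i j
    fin_cases i <;> fin_cases j <;>
      simp [Fin.sum_univ_three, downExponent, blockPart, h1, h2, e1, pow_add, pow_mul]
    · field_simp
    · field_simp

/-! ### Frames of twisted families of connections -/

theorem continuous_of_linear (T : Mat →ₗ[ℝ] Mat) : Continuous T :=
  LinearMap.continuous_of_finiteDimensional T

theorem IsFlat.conj {A : Type*} [NormedRing A] [NormedAlgebra ℝ A] {β : ℂ → ℂ → A} (hf : IsFlat β)
    (hβ : IsSmoothForm β) {K K' : A} (hK : K' * K = 1) : IsFlat fun z X => K * β z X * K' := by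
  have hd : ∀ z X, HasFDerivAt (fun w => K * β w X * K')
      (((ContinuousLinearMap.mul ℝ A).flip K').comp
        ((ContinuousLinearMap.mul ℝ A K).comp (fderiv ℝ (fun w => β w X) z))) z := fun z X =>
    ((ContinuousLinearMap.mul ℝ A).flip K').hasFDerivAt.comp z
      ((ContinuousLinearMap.mul ℝ A K).hasFDerivAt.comp z
        ((hβ.smooth X).differentiable (by simp) z).hasFDerivAt)
  intro z u v
  beta_reduce
  rw [(hd z v).fderiv, (hd z u).fderiv]
  change K * fderiv ℝ (fun w => β w v) z u * K' - K * fderiv ℝ (fun w => β w u) z v * K' + _ = 0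
  have e : ∀ P Q : A, K * P * K' * (K * Q * K') = K * (P * Q) * K' := fun P Q => by
    calc _ = K * P * (K' * K) * Q * K' := by noncomm_ring
      _ = _ := by rw [hK]; noncomm_ring
  rw [e, e]
  calc _ = K * (fderiv ℝ (fun w => β w v) z u - fderiv ℝ (fun w => β w u) z v +
        (β z u * β z v - β z v * β z u)) * K' := by noncomm_ring
    _ = 0 := by rw [hf z u v]; simp

/-- For `2 × 2` matrices, `β_{ij} = 0` gives `(Hβ)_{ij} = H_{ij} β_{jj}`: a homogeneous scalar
equation with zero initial value. Triangularity of the connection thus passes to the frame. -/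
theorem IsFrameOf.entry_eq_zero {β : ℂ → ℂ → Mat} (hβ : IsSmoothForm β) {H : ℂ → Mat}
    (hH : IsFrameOf β H) {i j : Fin 2} (hij : i ≠ j) (h0 : ∀ z X, β z X i j = 0) (z : ℂ) :
    H z i j = 0 := by
  refine hH.eq_zero_of_functional (Matrix.entryLinearMap ℝ ℂ i j)
    (continuous_id.matrix_elem i j) (fun z X => β z X j j)
    (fun z => (hβ.continuous_ray z z).matrix_elem j j) (fun M z X => ?_) ?_ z
  · have h := h0 z X
    simp only [Matrix.entryLinearMap_apply, Matrix.mul_apply, Fin.sum_univ_two]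
    fin_cases i <;> fin_cases j <;> simp_all
  · simp [hij]

theorem IsFrameOf.isUnit {β : ℂ → ℂ → Mat} (hβ : IsSmoothForm β) {H : ℂ → Mat}
    (hH : IsFrameOf β H) (z : ℂ) : IsUnit (H z) := by
  obtain ⟨W, hW⟩ := hH.exists_mul_eq_one hβ z
  exact (Matrix.isUnit_iff_isUnit_det _).mpr (Matrix.isUnit_det_of_right_inverse hW)

/-- Each block has its own power of `λ`; indexing by degree and block makes the family polynomial,
so `exists_frame_family` gives frames that are holomorphic at `λ = 0` too. -/
theorem exists_block_family (ex : ℕ → Fin 3 → ℕ) (N : ℕ) (Γ : ℕ → ℂ → ℂ → Mat)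
    (hΓ : ∀ k, IsSmoothForm (Γ k))
    (hf : ∀ l : ℂ, l ≠ 0 → IsFlat fun z X =>
      ∑ k ∈ Finset.range N, ∑ t, l ^ ex k t • blockPart t (Γ k z X)) :
    ∃ H : ℂ → ℂ → Mat,
      (∀ l, IsFrameOf (fun z X => ∑ k ∈ Finset.range N, ∑ t, l ^ ex k t • blockPart t (Γ k z X))
        (H l)) ∧
      (∀ z, Differentiable ℂ fun l => H l z) ∧ ∀ l z, IsUnit (H l z) := by
  have hb : ∀ i : Fin N × Fin 3, IsSmoothForm fun z X => blockPart i.2 (Γ i.1 z X) := fun i =>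
    (hΓ i.1).map ((blockPart i.2).restrictScalars ℝ) (continuous_of_linear _)
  have e : ∀ l : ℂ, (fun z X => ∑ k ∈ Finset.range N, ∑ t, l ^ ex k t • blockPart t (Γ k z X)) =
      fun z X => ∑ i : Fin N × Fin 3, l ^ ex i.1 i.2 • blockPart i.2 (Γ i.1 z X) := by
    intro l
    funext z X
    rw [Fintype.sum_prod_type, Finset.sum_range]
  simp only [e] at hf ⊢
  obtain ⟨H, hH, hHd⟩ := exists_frame_family (fun i : Fin N × Fin 3 => ex i.1 i.2) _ hb hf
  exact ⟨H, hH, hHd, fun l z =>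
    (hH l).isUnit (IsSmoothForm.sum _ fun i => (hb i).const_smul _) z⟩

theorem isSmoothForm_block (ex : ℕ → Fin 3 → ℕ) (N : ℕ) (Γ : ℕ → ℂ → ℂ → Mat)
    (hΓ : ∀ k, IsSmoothForm (Γ k)) (l : ℂ) : IsSmoothForm fun z X =>
      ∑ k ∈ Finset.range N, ∑ t, l ^ ex k t • blockPart t (Γ k z X) :=
  IsSmoothForm.sum _ fun k => IsSmoothForm.sum _ fun t =>
    ((hΓ k).map ((blockPart t).restrictScalars ℝ) (continuous_of_linear _)).const_smul _

theorem kappa_inv_mul {ζ : ℂ} (hζ : ζ ≠ 0) : (kappa ζ)⁻¹ * kappa ζ = 1 :=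
  Matrix.nonsing_inv_mul _ ((Matrix.isUnit_iff_isUnit_det _).mp (isUnit_kappa hζ))

/-- Frames of a family of connections which is polynomial in `ζ`. -/
theorem exists_up_family (N : ℕ) (Γ : ℕ → ℂ → ℂ → Mat) (hΓ : ∀ k, IsSmoothForm (Γ k))
    (htw : ∀ k < N, ∀ z X, tau * Γ k z X * tau = (-1 : ℂ) ^ k • Γ k z X)
    (hf : ∀ ζ : ℂ, ζ ≠ 0 → IsFlat fun z X => ∑ k ∈ Finset.range N, ζ ^ k • Γ k z X) :
    ∃ H : ℂ → ℂ → Mat,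
      (∀ ζ : ℂ, ζ ≠ 0 → IsFrameOf (fun z X =>
        kappa ζ * (∑ k ∈ Finset.range N, ζ ^ k • Γ k z X) * (kappa ζ)⁻¹) (H (ζ ^ 2))) ∧
      (∀ z, Differentiable ℂ fun l => H l z) ∧ (∀ l z, IsUnit (H l z)) ∧ ∀ z, H 0 z 1 0 = 0 := by
  have e : ∀ ζ : ℂ, ζ ≠ 0 → (fun z X => ∑ k ∈ Finset.range N, ∑ t,
      (ζ ^ 2) ^ upExponent k t • blockPart t (Γ k z X)) = fun z X =>
        kappa ζ * (∑ k ∈ Finset.range N, ζ ^ k • Γ k z X) * (kappa ζ)⁻¹ := by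
    intro ζ hζ
    funext z X
    rw [Finset.mul_sum, Finset.sum_mul]
    exact Finset.sum_congr rfl fun k hk => sum_upExponent (htw k (Finset.mem_range.mp hk) z X) hζ
  obtain ⟨H, hH, hHd, hHu⟩ := exists_block_family upExponent N Γ hΓ (fun l hl => by
    obtain ⟨ζ, rfl⟩ := IsAlgClosed.exists_pow_nat_eq l two_pos
    have hζ : ζ ≠ 0 := by rintro rfl; simp at hl
    rw [e ζ hζ]
    exact (hf ζ hζ).conj (IsSmoothForm.sum _ fun k => (hΓ k).const_smul _) (kappa_inv_mul hζ))
  refine ⟨H, fun ζ hζ => e ζ hζ ▸ hH (ζ ^ 2), hHd, hHu, fun z => ?_⟩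
  -- At `λ = 0` the lower-left block has a positive exponent for `k ≥ 1`, and for `k = 0` it
  -- vanishes by parity.
  refine (hH 0).entry_eq_zero (isSmoothForm_block _ _ _ hΓ 0) (by decide) (fun z X => ?_) z
  rw [Matrix.sum_apply]
  refine Finset.sum_eq_zero fun k hkN => ?_
  rcases Nat.eq_zero_or_pos k with rfl | hk
  · have := ((entries_of_twisted (htw 0 (Finset.mem_range.mp hkN) z X)).1 (by simp)).2
    simp [Fin.sum_univ_three, blockPart, this]
  · have h2 : (k + 1) / 2 ≠ 0 := by omega
    simp [Fin.sum_univ_three, blockPart, upExponent, h2]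

/-- Frames of a family of connections which is polynomial in `ζ⁻¹`. -/
theorem exists_down_family (N : ℕ) (Γ : ℕ → ℂ → ℂ → Mat) (hΓ : ∀ k, IsSmoothForm (Γ k))
    (htw : ∀ k < N, ∀ z X, tau * Γ k z X * tau = (-1 : ℂ) ^ k • Γ k z X)
    (hf : ∀ ζ : ℂ, ζ ≠ 0 → IsFlat fun z X => ∑ k ∈ Finset.range N, ζ⁻¹ ^ k • Γ k z X) :
    ∃ H : ℂ → ℂ → Mat,
      (∀ ζ : ℂ, ζ ≠ 0 → IsFrameOf (fun z X =>
        kappa ζ * (∑ k ∈ Finset.range N, ζ⁻¹ ^ k • Γ k z X) * (kappa ζ)⁻¹) (H (ζ ^ 2)⁻¹)) ∧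
      (∀ z, Differentiable ℂ fun l => H l z) ∧ (∀ l z, IsUnit (H l z)) ∧ ∀ z, H 0 z 0 1 = 0 := by
  have e : ∀ ζ : ℂ, ζ ≠ 0 → (fun z X => ∑ k ∈ Finset.range N, ∑ t,
      ((ζ ^ 2)⁻¹) ^ downExponent k t • blockPart t (Γ k z X)) = fun z X =>
        kappa ζ * (∑ k ∈ Finset.range N, ζ⁻¹ ^ k • Γ k z X) * (kappa ζ)⁻¹ := by
    intro ζ hζ
    funext z X
    rw [Finset.mul_sum, Finset.sum_mul]
    exact Finset.sum_congr rfl fun k hk => sum_downExponent (htw k (Finset.mem_range.mp hk) z X) hζ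
  obtain ⟨H, hH, hHd, hHu⟩ := exists_block_family downExponent N Γ hΓ (fun l hl => by
    obtain ⟨ζ, hζl⟩ := IsAlgClosed.exists_pow_nat_eq l⁻¹ two_pos
    obtain rfl : (ζ ^ 2)⁻¹ = l := by rw [hζl, inv_inv]
    have hζ : ζ ≠ 0 := by rintro rfl; simp at hl
    rw [e ζ hζ]
    exact (hf ζ hζ).conj (IsSmoothForm.sum _ fun k => (hΓ k).const_smul _) (kappa_inv_mul hζ))
  refine ⟨H, fun ζ hζ => e ζ hζ ▸ hH (ζ ^ 2)⁻¹, hHd, hHu, fun z => ?_⟩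
  refine (hH 0).entry_eq_zero (isSmoothForm_block _ _ _ hΓ 0) (by decide) (fun z X => ?_) z
  rw [Matrix.sum_apply]
  refine Finset.sum_eq_zero fun k hkN => ?_
  rcases Nat.eq_zero_or_pos k with rfl | hk
  · have := ((entries_of_twisted (htw 0 (Finset.mem_range.mp hkN) z X)).1 (by simp)).1
    simp [Fin.sum_univ_three, blockPart, this]
  · have h2 : (k + 1) / 2 ≠ 0 := by omega
    simp [Fin.sum_univ_three, blockPart, downExponent, h2]

/-! ### The Maurer-Cartan form of a framing -/

/-- The diagonal part as a linear map. -/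
def tPartLin : Mat →ₗ[ℂ] Mat where
  toFun := tPart
  map_add' M N := by simp [tPart]
  map_smul' r M := by simp [tPart]

/-- The off-diagonal part as a linear map. -/
def mPartLin : Mat →ₗ[ℂ] Mat := LinearMap.id - tPartLin

theorem mPartLin_apply (M : Mat) : mPartLin M = mPart M := rfl

theorem tau_tPart (M : Mat) : tau * tPart M * tau = tPart M := by
  ext i j
  fin_cases i <;> fin_cases j <;>
    simp [tau, tPart, Matrix.mul_apply, Matrix.vecMul, dotProduct, Fin.sum_univ_two]

theorem tau_mPart (M : Mat) : tau * mPart M * tau = -mPart M := by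
  ext i j
  fin_cases i <;> fin_cases j <;>
    simp [tau, mPart, tPart, Matrix.mul_apply, Matrix.vecMul, dotProduct, Fin.sum_univ_two]

theorem conjTranspose_mPart (M : Mat) : (mPart M)ᴴ = mPart Mᴴ := by
  ext i j
  fin_cases i <;> fin_cases j <;> simp [mPart, tPart]

section Algebra

attribute [local instance] NormedAlgebra.toNormedSpace

theorem isSmoothForm_mul_fderiv {A : Type*} [NormedRing A] [NormedAlgebra ℝ A] {F G : ℂ → A}
    (hF : ContDiff ℝ ∞ F) (hG : ContDiff ℝ ∞ G) : IsSmoothForm fun z X => G z * fderiv ℝ F z X where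
  smooth X := hG.mul ((hF.fderiv_right (m := ∞) (by simp)).clm_apply contDiff_const)
  map_add z X Y := by rw [map_add, mul_add]
  map_smul z r X := by rw [map_smul, mul_smul_comm]

theorem contDiff_ringInverse_comp {A : Type*} [NormedRing A] [NormedAlgebra ℝ A] [CompleteSpace A]
    {F : ℂ → A} (hF : ContDiff ℝ ∞ F) (hu : ∀ z, IsUnit (F z)) :
    ContDiff ℝ ∞ fun z => Ring.inverse (F z) := by
  rw [contDiff_iff_contDiffAt]
  intro z
  obtain ⟨u, hu⟩ := hu z
  exact ContDiffAt.comp z (hu ▸ contDiffAt_ringInverse ℝ u) hF.contDiffAt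

end Algebra

section Framing

variable {φ : ℂ → EuclideanSpace ℝ (Fin 3)} {F : ℂ → Mat}

theorem IsFraming.conjTranspose_mul (hF : IsFraming φ F) (z : ℂ) : (F z)ᴴ * F z = 1 :=
  Matrix.mem_unitaryGroup_iff'.mp (Matrix.mem_specialUnitaryGroup_iff.mp (hF.mem z)).1

theorem IsFraming.inv_eq (hF : IsFraming φ F) (z : ℂ) : (F z)⁻¹ = (F z)ᴴ :=
  Matrix.inv_eq_left_inv (hF.conjTranspose_mul z)

theorem IsFraming.isUnit (hF : IsFraming φ F) (z : ℂ) : IsUnit (F z) :=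
  (Matrix.isUnit_iff_isUnit_det _).mpr
    (Matrix.isUnit_det_of_left_inverse (hF.conjTranspose_mul z))

theorem IsFraming.contDiff_inv (hF : IsFraming φ F) : ContDiff ℝ ∞ fun z => (F z)⁻¹ := by
  simp only [Matrix.nonsing_inv_eq_ringInverse]
  exact contDiff_ringInverse_comp hF.smooth hF.isUnit

theorem IsFraming.isSmoothForm (hF : IsFraming φ F) : IsSmoothForm (mcForm F) :=
  isSmoothForm_mul_fderiv hF.smooth hF.contDiff_inv

theorem IsFraming.isFlat (hF : IsFraming φ F) : IsFlat (mcForm F) := by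
  have hu := fun z => (Matrix.isUnit_iff_isUnit_det _).mp (hF.isUnit z)
  exact isFlat_mul_fderiv hF.smooth hF.contDiff_inv
    (fun z => Matrix.nonsing_inv_mul _ (hu z)) (fun z => Matrix.mul_nonsing_inv _ (hu z))

theorem IsFraming.conjTranspose_mcForm (hF : IsFraming φ F) (z X : ℂ) :
    (mcForm F z X)ᴴ = -mcForm F z X := by
  let S : Mat →ₗ[ℝ] Mat :=
    { toFun := fun M => Mᴴ
      map_add' := Matrix.conjTranspose_add
      map_smul' := fun r M => by simp [Matrix.conjTranspose_smul] }
  have h : (F z)ᴴ * fderiv ℝ F z X + (fderiv ℝ F z X)ᴴ * F z = 0 :=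
    fderiv_unitary (hF.smooth.differentiable (by simp)) S (continuous_of_linear S)
      hF.conjTranspose_mul z X
  rw [mcForm, hF.inv_eq, Matrix.conjTranspose_mul, Matrix.conjTranspose_conjTranspose]
  exact eq_neg_of_add_eq_zero_right h

/-- Unitarity of `F` makes its Maurer-Cartan form skew-Hermitian. This is what puts `conj c` at the
top of the Killing field once `c` is at the bottom. -/
theorem IsFraming.alphaMdzbar_eq (hF : IsFraming φ F) (z : ℂ) :
    alphaMdzbar F z = -(alphaMdz F z)ᴴ := by
  have h1 : ∀ X, (mPart (mcForm F z X))ᴴ = -mPart (mcForm F z X) := fun X => by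
    rw [conjTranspose_mPart, hF.conjTranspose_mcForm, ← mPartLin_apply, map_neg, mPartLin_apply]
  rw [alphaMdz, alphaMdzbar, Matrix.conjTranspose_smul, Matrix.conjTranspose_sub,
    Matrix.conjTranspose_smul, h1, h1]
  simp
  module

theorem IsFraming.mPart_mcForm (hF : IsFraming φ F) (z X : ℂ) :
    mPart (mcForm F z X) = X • alphaMdz F z + conj X • alphaMdzbar F z := by
  have h : mPart (mcForm F z X) =
      (X.re : ℂ) • mPart (mcForm F z 1) + (X.im : ℂ) • mPart (mcForm F z Complex.I) := by
    have hX : X = X.re • (1 : ℂ) + X.im • Complex.I := by simp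
    conv_lhs => rw [hX, hF.isSmoothForm.map_add, hF.isSmoothForm.map_smul,
      hF.isSmoothForm.map_smul]
    rw [← Complex.coe_smul, ← Complex.coe_smul, ← mPartLin_apply, map_add, map_smul, map_smul]
    rfl
  have h1 : (X.re : ℂ) = (X + conj X) / 2 := by rw [Complex.add_conj]; simp
  have h2 : (X.im : ℂ) = -(Complex.I / 2) * (X - conj X) := by
    rw [Complex.sub_conj]
    push_cast
    linear_combination (X.im : ℂ) * Complex.I_mul_I
  rw [h, h1, h2, alphaMdz, alphaMdzbar]
  module

theorem IsFraming.contDiff_mPart (hF : IsFraming φ F) (X : ℂ) :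
    ContDiff ℝ ∞ fun z => mPart (mcForm F z X) :=
  (hF.isSmoothForm.map (mPartLin.restrictScalars ℝ) (continuous_of_linear _)).smooth X

theorem IsFraming.contDiff_alphaMdz (hF : IsFraming φ F) : ContDiff ℝ ∞ (alphaMdz F) :=
  ContDiff.const_smul (1 / 2 : ℂ) ((hF.contDiff_mPart 1).sub
    ((hF.contDiff_mPart Complex.I).const_smul Complex.I))

theorem IsFraming.contDiff_alphaMdzbar (hF : IsFraming φ F) : ContDiff ℝ ∞ (alphaMdzbar F) :=
  ContDiff.const_smul (1 / 2 : ℂ) ((hF.contDiff_mPart 1).add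
    ((hF.contDiff_mPart Complex.I).const_smul Complex.I))

theorem IsFraming.isSmoothForm_tPart (hF : IsFraming φ F) :
    IsSmoothForm fun z X => tPart (mcForm F z X) :=
  hF.isSmoothForm.map (tPartLin.restrictScalars ℝ) (continuous_of_linear _)

theorem IsFraming.isSmoothForm_loopForm (hF : IsFraming φ F) (ζ : ℂ) :
    IsSmoothForm fun z X => loopForm F z X ζ := by
  have h := (((IsSmoothForm.dz hF.contDiff_alphaMdz).const_smul ζ⁻¹).add
    hF.isSmoothForm_tPart).add ((IsSmoothForm.dzbar hF.contDiff_alphaMdzbar).const_smul ζ)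
  simp only [smul_smul] at h
  exact h

theorem IsFraming.loopForm_one (hF : IsFraming φ F) (z X : ℂ) :
    X • alphaMdz F z + tPart (mcForm F z X) + conj X • alphaMdzbar F z = mcForm F z X := by
  rw [add_right_comm, ← hF.mPart_mcForm, mPart, sub_add_cancel]

/-- The leading coefficients of the Killing field make the loop of connections flat. -/
theorem IsFraming.isFlat_loopForm (hF : IsFraming φ F) {c d : ℂ} (hc : c ≠ 0) (hd : d ≠ 0)
    {C C' D D' : ℂ → Mat} (hC : ∀ z, C z = c • alphaMdz F z) (hD : ∀ z, D z = d • alphaMdzbar F z)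
    (hlC : ∀ z X, fderiv ℝ C z X + X • (alphaMdz F z * C' z - C' z * alphaMdz F z) +
      (tPart (mcForm F z X) * C z - C z * tPart (mcForm F z X)) = 0)
    (hlD : ∀ z X, fderiv ℝ D z X + conj X • (alphaMdzbar F z * D' z - D' z * alphaMdzbar F z) +
      (tPart (mcForm F z X) * D z - D z * tPart (mcForm F z X)) = 0) {ζ : ℂ} (hζ : ζ ≠ 0) :
    IsFlat fun z X => loopForm F z X ζ := by
  have hA := hF.contDiff_alphaMdz.differentiable (by simp)
  have hB := hF.contDiff_alphaMdzbar.differentiable (by simp)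
  refine isFlat_loop hA hB (fun X => (hF.isSmoothForm_tPart.smooth X).differentiable (by simp))
    (parallel_of_lax hA hc hC (fun z X => tPart (mcForm F z X)) id hlC)
    (parallel_of_lax hB hd hD (fun z X => tPart (mcForm F z X)) conj hlD) ?_ hζ
  simp only [hF.loopForm_one]
  exact hF.isFlat

end Framing

/-! ### The extended frame -/

section Conj

attribute [local instance] NormedAlgebra.toNormedSpace

variable {A : Type*} [NormedRing A] [NormedAlgebra ℝ A]

theorem hasFDerivAt_conj {f : ℂ → A} (hf : Differentiable ℝ f) (K K' : A) (z : ℂ) :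
    HasFDerivAt (fun w => K * f w * K') (((ContinuousLinearMap.mul ℝ A).flip K').comp
      ((ContinuousLinearMap.mul ℝ A K).comp (fderiv ℝ f z))) z :=
  ((ContinuousLinearMap.mul ℝ A).flip K').hasFDerivAt.comp z
    ((ContinuousLinearMap.mul ℝ A K).hasFDerivAt.comp z (hf z).hasFDerivAt)

theorem lax_conj {f : ℂ → A} (hf : Differentiable ℝ f) {α : ℂ → ℂ → A}
    (hl : ∀ z X, fderiv ℝ f z X + (α z X * f z - f z * α z X) = 0) {K K' : A} (hK : K' * K = 1)
    (z X : ℂ) : fderiv ℝ (fun w => K * f w * K') z X +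
      (K * α z X * K' * (K * f z * K') - K * f z * K' * (K * α z X * K')) = 0 := by
  rw [(hasFDerivAt_conj hf K K' z).fderiv]
  change K * fderiv ℝ f z X * K' + _ = 0
  have e : ∀ P Q : A, K * P * K' * (K * Q * K') = K * (P * Q) * K' := fun P Q => by
    calc _ = K * P * (K' * K) * Q * K' := by noncomm_ring
      _ = _ := by rw [hK]; noncomm_ring
  rw [e, e]
  calc _ = K * (fderiv ℝ f z X + (α z X * f z - f z * α z X)) * K' := by noncomm_ring
    _ = 0 := by rw [hl z X]; simp

theorem IsSmoothForm.clm_smul [NormedAlgebra ℂ A] [SMulCommClass ℝ ℂ A] [IsScalarTower ℝ ℂ A]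
    {M : ℂ → A} (hM : ContDiff ℝ ∞ M) (θ : ℂ →L[ℝ] ℂ) : IsSmoothForm fun z X => θ X • M z where
  smooth X := hM.const_smul (θ X)
  map_add z X Y := by rw [_root_.map_add, add_smul]
  map_smul z r X := by rw [_root_.map_smul, smul_assoc]

end Conj

/-- Isolates the lowest term, which will cancel `ζ⁻¹ α_𝔪^{(1,0)}`; multiplied by `ζ^{2n}`, the
others have exponents `0, …, 4n + 1`. -/
theorem sum_Icc_symm (n : ℕ) (f : ℤ → Mat) :
    ∑ j ∈ Finset.Icc (-((2 * n + 1 : ℕ) : ℤ)) ((2 * n + 1 : ℕ) : ℤ), f j =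
      (∑ k ∈ Finset.range (4 * n + 2), f (k - 2 * n)) + f (-(2 * n + 1)) := by
  have h : ∑ j ∈ Finset.Icc (-((2 * n + 1 : ℕ) : ℤ)) ((2 * n + 1 : ℕ) : ℤ), f j =
      ∑ k ∈ Finset.range (4 * n + 2 + 1), f (k - (2 * n + 1)) := by
    symm
    refine Finset.sum_bij' (fun k _ => (k : ℤ) - (2 * n + 1)) (fun j _ => (j + (2 * n + 1)).toNat)
      ?_ ?_ ?_ ?_ ?_
    · intro k hk; rw [Finset.mem_range] at hk; rw [Finset.mem_Icc]; omega
    · intro j hj; rw [Finset.mem_Icc] at hj; rw [Finset.mem_range]; omega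
    · intro k hk; omega
    · intro j hj; rw [Finset.mem_Icc] at hj; omega
    · intro k _; rfl
  rw [h, Finset.sum_range_succ']
  refine congrArg₂ _ (Finset.sum_congr rfl fun k _ => ?_) (by simp)
  congr 1
  push_cast
  ring

theorem sum_Icc_symm' (n : ℕ) (f : ℤ → Mat) :
    ∑ j ∈ Finset.Icc (-((2 * n + 1 : ℕ) : ℤ)) ((2 * n + 1 : ℕ) : ℤ), f j =
      (∑ k ∈ Finset.range (4 * n + 2), f (2 * n - k)) + f (2 * n + 1) := by
  have h := sum_Icc_symm n fun j => f (-j)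
  rw [neg_neg] at h
  simp only [neg_sub] at h
  rw [← h]
  refine Finset.sum_bij' (fun j _ => -j) (fun j _ => -j) ?_ ?_ ?_ ?_ ?_
  · intro j hj; rw [Finset.mem_Icc] at hj ⊢; omega
  · intro j hj; rw [Finset.mem_Icc] at hj ⊢; omega
  · simp
  · simp
  · simp

/-- The forms of degree `0` and `1` in a polynomial of 1-forms. -/
def lowForms (t b : ℂ → ℂ → Mat) : ℕ → ℂ → ℂ → Mat
  | 0 => t
  | 1 => b
  | _ => fun _ _ => 0

theorem sum_lowForms (t b : ℂ → ℂ → Mat) (n : ℕ) (x z X : ℂ) :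
    ∑ k ∈ Finset.range (4 * n + 2), x ^ k • lowForms t b k z X = t z X + x • b z X := by
  rw [Finset.sum_range_succ', Finset.sum_range_succ', Finset.sum_eq_zero]
  · simp [lowForms, add_comm]
  · intro k _
    simp [lowForms]

theorem isSmoothForm_lowForms {t b : ℂ → ℂ → Mat} (ht : IsSmoothForm t) (hb : IsSmoothForm b) :
    ∀ k, IsSmoothForm (lowForms t b k)
  | 0 => ht
  | 1 => hb
  | _ + 2 => IsSmoothForm.zero

theorem lowForms_twisted {t b : ℂ → ℂ → Mat} (ht : ∀ z X, tau * t z X * tau = t z X)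
    (hb : ∀ z X, tau * b z X * tau = -b z X) (z X : ℂ) :
    ∀ k : ℕ, tau * lowForms t b k z X * tau = (-1 : ℂ) ^ k • lowForms t b k z X
  | 0 => by simpa [lowForms] using ht z X
  | 1 => by simpa [lowForms] using hb z X
  | _ + 2 => by simp [lowForms]

/-! ### Gauging away the poles at `0` and `∞` -/

section Twisted

variable {φ : ℂ → EuclideanSpace ℝ (Fin 3)} {F : ℂ → Mat} {ξ : ℂ → ℂ → Mat}

theorem tau_alphaMdz (z : ℂ) : tau * alphaMdz F z * tau = -alphaMdz F z := by
  simp only [alphaMdz, mul_smul_comm, smul_mul_assoc, mul_sub, sub_mul, tau_mPart]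
  module

theorem tau_alphaMdzbar (z : ℂ) : tau * alphaMdzbar F z * tau = -alphaMdzbar F z := by
  simp only [alphaMdzbar, mul_smul_comm, smul_mul_assoc, mul_add, add_mul, tau_mPart]
  module

theorem twisted_sub_smul {M C : Mat} {k : ℕ} (hM : tau * M * tau = (-1 : ℂ) ^ k • M)
    (hC : tau * C * tau = (-1 : ℂ) ^ k • C) (x : ℂ) :
    tau * (M - x • C) * tau = (-1 : ℂ) ^ k • (M - x • C) := by
  rw [mul_sub, sub_mul, mul_smul_comm, smul_mul_assoc, hM, hC, smul_sub, smul_comm x]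

/-- A frame of the gauge transformed connection yields a frame of the untwisted loop. -/
theorem frame_of_gauge (hF : IsFraming φ F) (hξ : IsPolynomialKillingField F ξ) {ζ : ℂ}
    (hζ : ζ ≠ 0) (θ : ℂ →L[ℝ] ℂ) {H : ℂ → Mat}
    (hH : IsFrameOf (fun z X => kappa ζ * (loopForm F z X ζ - θ X • ξ z ζ) * (kappa ζ)⁻¹) H) :
    IsFrameOf (fun z X => kappa ζ * loopForm F z X ζ * (kappa ζ)⁻¹)
      (fun z => NormedSpace.exp (θ z • (kappa ζ * ξ 0 ζ * (kappa ζ)⁻¹)) * H z) ∧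
    ∀ z, kappa ζ * ξ 0 ζ * (kappa ζ)⁻¹ * H z = H z * (kappa ζ * ξ z ζ * (kappa ζ)⁻¹) := by
  have hξs := contDiff_eval hξ.smooth hζ
  have hξd : Differentiable ℝ fun z => ξ z ζ := hξs.differentiable (by simp)
  have hl := lax_conj hξd (hξ.lax ζ hζ) (kappa_inv_mul hζ)
  have hd : Differentiable ℝ fun z => kappa ζ * ξ z ζ * (kappa ζ)⁻¹ :=
    fun z => (hasFDerivAt_conj hξd (kappa ζ) (kappa ζ)⁻¹ z).differentiableAt
  have e : (fun z X => kappa ζ * (loopForm F z X ζ - θ X • ξ z ζ) * (kappa ζ)⁻¹) = fun z X =>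
      kappa ζ * loopForm F z X ζ * (kappa ζ)⁻¹ - θ X • (kappa ζ * ξ z ζ * (kappa ζ)⁻¹) := by
    funext z X
    rw [mul_sub, sub_mul, mul_smul_comm, smul_mul_assoc]
  have hs : IsSmoothForm fun z X =>
      kappa ζ * loopForm F z X ζ * (kappa ζ)⁻¹ - θ X • (kappa ζ * ξ z ζ * (kappa ζ)⁻¹) := by
    rw [← e]
    have h := ((hF.isSmoothForm_loopForm ζ).add ((IsSmoothForm.clm_smul hξs θ).const_smul (-1))).map
      ((LinearMap.mulLeft ℂ (kappa ζ) ∘ₗ LinearMap.mulRight ℂ (kappa ζ)⁻¹).restrictScalars ℝ)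
      (continuous_of_linear _)
    simpa [← sub_eq_add_neg, ← mul_assoc] using h
  rw [e] at hH
  exact ⟨hH.exp_mul hd hl θ hs, hH.lax_conj hd hl hs⟩

theorem neg_one_zpow_sub (k n : ℕ) : (-1 : ℂ) ^ ((k : ℤ) - 2 * n) = (-1) ^ k := by
  rw [zpow_sub₀ (by simp), zpow_mul]
  simp

theorem neg_one_zpow_sub' (k n : ℕ) : (-1 : ℂ) ^ (2 * (n : ℤ) - k) = (-1) ^ k := by
  rw [zpow_sub₀ (by simp), zpow_mul]
  simp [← inv_pow]

/-- The extended frame and its two normalisations. -/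
theorem exists_extended_frames (hF : IsFraming φ F) (hss : IsSemisimpleFrame F)
    (hξ : IsPolynomialKillingField F ξ) :
    ∃ (E : ℂ → ℂ → Mat) (p : ℕ) (c : ℂ) (C : ℂ → ℤ → Mat) (H K : ℂ → ℂ → Mat),
      IsExtendedFrame F E ∧ 0 < p ∧ c ≠ 0 ∧
      (∀ z, HasLaurentExpansion (ξ z) (2 * p + 1) (C z)) ∧
      (∀ z, C z (-(2 * (p : ℤ) + 1)) = c • alphaMdz F z) ∧
      (∀ z, C z (2 * (p : ℤ) + 1) = conj c • alphaMdzbar F z) ∧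
      (∀ z, Differentiable ℂ fun l => H l z) ∧ (∀ l z, IsUnit (H l z)) ∧ (∀ z, H 0 z 1 0 = 0) ∧
      (∀ z, Differentiable ℂ fun l => K l z) ∧ (∀ l z, IsUnit (K l z)) ∧ (∀ z, K 0 z 0 1 = 0) ∧
      (∀ l z, l ≠ 0 → H l z =
        NormedSpace.exp (-(c⁻¹ * z * l ^ p) • untwist (ξ 0) l) * E z l) ∧
      (∀ s z, s ≠ 0 → K s z =
        NormedSpace.exp (-((conj c)⁻¹ * conj z * s ^ p) • untwist (ξ 0) s⁻¹) * E z s⁻¹) ∧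
      ∀ l z, l ≠ 0 → untwist (ξ 0) l * H l z = H l z * untwist (ξ z) l := by
  obtain ⟨p, c, C, hp, hc, hC, hCs, hCbot, hlbot, hltop⟩ := exists_leading_coeff hss hξ
  have hcc : conj c ≠ 0 := by simpa using hc
  have hCtop : ∀ z, C z (2 * (p : ℤ) + 1) = conj c • alphaMdzbar F z := by
    intro z
    rw [(hC z).real (hξ.real z) (Finset.mem_Icc.mpr (by push_cast; omega)), hCbot,
      hF.alphaMdzbar_eq, Matrix.conjTranspose_smul, smul_neg]
    rfl
  have hflat : ∀ ζ : ℂ, ζ ≠ 0 → IsFlat fun z X => loopForm F z X ζ := fun ζ hζ =>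
    hF.isFlat_loopForm hc hcc hCbot hCtop hlbot hltop hζ
  have hξd : ∀ ζ : ℂ, ζ ≠ 0 → Differentiable ℝ fun z => ξ z ζ := fun ζ hζ =>
    (contDiff_eval hξ.smooth hζ).differentiable (by simp)
  have hloopd : ∀ ζ X : ℂ, Differentiable ℝ fun z => loopForm F z X ζ := fun ζ X =>
    ((hF.isSmoothForm_loopForm ζ).smooth X).differentiable (by simp)
  have hCtw : ∀ z, ∀ j ∈ Finset.Icc (-((2 * p + 1 : ℕ) : ℤ)) ((2 * p + 1 : ℕ) : ℤ),
      tau * C z j * tau = (-1 : ℂ) ^ j • C z j := fun z j hj => (hC z).twisted (hξ.twisted z) hj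
  let t : ℂ → ℂ → Mat := fun z X => tPart (mcForm F z X)
  let θ : ℂ → ℂ →L[ℝ] ℂ := fun k => k • ContinuousLinearMap.id ℝ ℂ
  let θ' : ℂ → ℂ →L[ℝ] ℂ := fun k => k • (Complex.conjCLE : ℂ →L[ℝ] ℂ)
  -- the connection which is regular at `0`
  let ΓH : ℕ → ℂ → ℂ → Mat := fun k z X =>
    lowForms t (fun z X => conj X • alphaMdzbar F z) k z X - (c⁻¹ * X) • C z (k - 2 * p)
  have hΓH : ∀ ζ : ℂ, ζ ≠ 0 → (fun z X => ∑ k ∈ Finset.range (4 * p + 2), ζ ^ k • ΓH k z X) =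
      fun z X => loopForm F z X ζ - θ (c⁻¹ * (ζ ^ 2) ^ p) X • ξ z ζ := by
    intro ζ hζ
    funext z X
    simp only [ΓH, smul_sub, Finset.sum_sub_distrib]
    rw [sum_lowForms, hC z ζ hζ, sum_Icc_symm, hCbot, smul_add, Finset.smul_sum]
    have e1 : ∀ k : ℕ, ζ ^ k • (c⁻¹ * X) • C z (k - 2 * p) =
        θ (c⁻¹ * (ζ ^ 2) ^ p) X • ζ ^ ((k : ℤ) - 2 * p) • C z (k - 2 * p) := by
      intro k
      rw [smul_smul, smul_smul]
      congr 1
      simp only [θ, smul_apply, ContinuousLinearMap.id_apply, smul_eq_mul]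
      rw [zpow_sub₀ hζ, zpow_mul]
      norm_cast
      field_simp
    -- The pole cancellation: the bottom term of `c⁻¹ λ^p ξ_ζ dz` is exactly `ζ⁻¹ α_𝔪^{(1,0)}`.
    have e2 : θ (c⁻¹ * (ζ ^ 2) ^ p) X * (ζ ^ (-(2 * (p : ℤ) + 1)) * c) = ζ⁻¹ * X := by
      simp only [θ, smul_apply, ContinuousLinearMap.id_apply, smul_eq_mul]
      rw [neg_add, zpow_add₀ hζ, zpow_neg, zpow_mul, zpow_neg_one]
      norm_cast
      field_simp
    rw [Finset.sum_congr rfl fun k _ => e1 k, smul_smul _ _ (c • _), smul_smul _ c, mul_assoc, e2,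
      loopForm]
    simp only [t, smul_smul]
    abel
  obtain ⟨H, hHf, hHd, hHu, hH0⟩ := exists_up_family (4 * p + 2) ΓH
    (fun k => by
      have h := (isSmoothForm_lowForms hF.isSmoothForm_tPart
        (IsSmoothForm.dzbar hF.contDiff_alphaMdzbar) k).add
        ((IsSmoothForm.dz (hCs (k - 2 * p))).const_smul (-c⁻¹))
      simpa only [smul_smul, neg_mul, neg_smul, ← sub_eq_add_neg] using h)
    (fun k hk z X => by
      refine twisted_sub_smul (lowForms_twisted (fun z X => tau_tPart _) (fun z X => ?_) z X k) ?_ _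
      · rw [mul_smul_comm, smul_mul_assoc, tau_alphaMdzbar, smul_neg]
      · rw [hCtw z _ (Finset.mem_Icc.mpr (by omega)), neg_one_zpow_sub])
    (fun ζ hζ => by
      rw [hΓH ζ hζ]
      exact (hflat ζ hζ).sub_smul (hloopd ζ) (hξd ζ hζ) (hξ.lax ζ hζ) _)
  -- the connection which is regular at `∞`
  let ΓK : ℕ → ℂ → ℂ → Mat := fun k z X =>
    lowForms t (fun z X => X • alphaMdz F z) k z X - ((conj c)⁻¹ * conj X) • C z (2 * p - k)
  have hΓK : ∀ ζ : ℂ, ζ ≠ 0 → (fun z X => ∑ k ∈ Finset.range (4 * p + 2), ζ⁻¹ ^ k • ΓK k z X) =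
      fun z X => loopForm F z X ζ - θ' ((conj c)⁻¹ * ((ζ ^ 2)⁻¹) ^ p) X • ξ z ζ := by
    intro ζ hζ
    funext z X
    simp only [ΓK, smul_sub, Finset.sum_sub_distrib]
    rw [sum_lowForms, hC z ζ hζ, sum_Icc_symm', hCtop, smul_add, Finset.smul_sum]
    have e1 : ∀ k : ℕ, ζ⁻¹ ^ k • ((conj c)⁻¹ * conj X) • C z (2 * p - k) =
        θ' ((conj c)⁻¹ * ((ζ ^ 2)⁻¹) ^ p) X • ζ ^ (2 * (p : ℤ) - k) • C z (2 * p - k) := by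
      intro k
      rw [smul_smul, smul_smul]
      congr 1
      simp only [θ', smul_apply, ContinuousLinearEquiv.coe_coe, Complex.conjCLE_apply, smul_eq_mul]
      rw [zpow_sub₀ hζ, zpow_mul, inv_pow, inv_pow]
      norm_cast
      field_simp
    have e2 : θ' ((conj c)⁻¹ * ((ζ ^ 2)⁻¹) ^ p) X * (ζ ^ (2 * (p : ℤ) + 1) * conj c) =
        ζ * conj X := by
      simp only [θ', smul_apply, ContinuousLinearEquiv.coe_coe, Complex.conjCLE_apply, smul_eq_mul]
      rw [zpow_add₀ hζ, zpow_mul, zpow_one, inv_pow]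
      norm_cast
      field_simp
    rw [Finset.sum_congr rfl fun k _ => e1 k, smul_smul _ _ (conj c • _), smul_smul _ (conj c),
      mul_assoc, e2, loopForm]
    simp only [t, smul_smul]
    abel
  obtain ⟨K, hKf, hKd, hKu, hK0⟩ := exists_down_family (4 * p + 2) ΓK
    (fun k => by
      have h := (isSmoothForm_lowForms hF.isSmoothForm_tPart
        (IsSmoothForm.dz hF.contDiff_alphaMdz) k).add
        ((IsSmoothForm.dzbar (hCs (2 * p - k))).const_smul (-(conj c)⁻¹))
      simpa only [smul_smul, neg_mul, neg_smul, ← sub_eq_add_neg] using h)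
    (fun k hk z X => by
      refine twisted_sub_smul (lowForms_twisted (fun z X => tau_tPart _) (fun z X => ?_) z X k) ?_ _
      · rw [mul_smul_comm, smul_mul_assoc, tau_alphaMdz, smul_neg]
      · rw [hCtw z _ (Finset.mem_Icc.mpr (by omega)), neg_one_zpow_sub'])
    (fun ζ hζ => by
      rw [hΓK ζ hζ]
      exact (hflat ζ hζ).sub_smul (hloopd ζ) (hξd ζ hζ) (hξ.lax ζ hζ) _)
  have hroot : ∀ l : ℂ, l ≠ 0 → (l ^ (1 / 2 : ℂ)) ^ 2 = l ∧ l ^ (1 / 2 : ℂ) ≠ 0 := fun l hl => by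
    have h : (l ^ (1 / 2 : ℂ)) ^ 2 = l := by simp
    exact ⟨h, fun h0 => hl (by rw [← h, h0]; simp)⟩
  have hHg : ∀ l : ℂ, l ≠ 0 → IsFrameOf (fun z X => untwist (loopForm F z X) l)
      (fun z => NormedSpace.exp (θ (c⁻¹ * l ^ p) z • untwist (ξ 0) l) * H l z) ∧
      ∀ z, untwist (ξ 0) l * H l z = H l z * untwist (ξ z) l := by
    intro l hl
    obtain ⟨h2, h0⟩ := hroot l hl
    have hf := hHf _ h0
    have hΓ := hΓH _ h0
    rw [h2] at hf hΓ
    refine frame_of_gauge hF hξ h0 (θ (c⁻¹ * l ^ p)) ?_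
    simpa only [fun z X => congrFun (congrFun hΓ z) X] using hf
  have hKg : ∀ l : ℂ, l ≠ 0 → IsFrameOf (fun z X => untwist (loopForm F z X) l)
      (fun z => NormedSpace.exp (θ' ((conj c)⁻¹ * l⁻¹ ^ p) z • untwist (ξ 0) l) * K l⁻¹ z) := by
    intro l hl
    obtain ⟨h2, h0⟩ := hroot l hl
    have hf := hKf _ h0
    have hΓ := hΓK _ h0
    rw [h2] at hf hΓ
    refine (frame_of_gauge hF hξ h0 (θ' ((conj c)⁻¹ * l⁻¹ ^ p)) ?_).1
    simpa only [fun z X => congrFun (congrFun hΓ z) X] using hf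
  have hsm : ∀ l : ℂ, IsSmoothForm fun z X => untwist (loopForm F z X) l := fun l => by
    let ζ := l ^ (1 / 2 : ℂ)
    have h := (hF.isSmoothForm_loopForm ζ).map
      ((LinearMap.mulLeft ℂ (kappa ζ) ∘ₗ LinearMap.mulRight ℂ (kappa ζ)⁻¹).restrictScalars ℝ)
      (continuous_of_linear _)
    simp only [LinearMap.restrictScalars_apply, LinearMap.comp_apply, LinearMap.mulLeft_apply,
      LinearMap.mulRight_apply, ← mul_assoc] at h
    exact h
  have hexp : ∀ M P Q : Mat, P = NormedSpace.exp M * Q → Q = NormedSpace.exp (-M) * P := by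
    intro M P Q h
    rw [h, Matrix.exp_neg, ← mul_assoc, Matrix.nonsing_inv_mul _
      ((Matrix.isUnit_iff_isUnit_det _).mp (Matrix.isUnit_exp M)), one_mul]
  -- The extended frame is built from the frame regular at `0`; its relation to the frame regular at
  -- `∞` follows from uniqueness of frames of `α_λ`.
  refine ⟨fun z l => NormedSpace.exp (θ (c⁻¹ * l ^ p) z • untwist (ξ 0) l) * H l z, p, c, C, H, K,
    ⟨fun l hl => (hHg l hl).1.zero, fun l hl => (hHg l hl).1.differentiable,
      fun l hl => (hHg l hl).1.isUnit (hsm l), fun l hl z X => ?_⟩, hp, hc, hC, hCbot, hCtop,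
    hHd, hHu, hH0, hKd, hKu, hK0, fun l z _ => ?_, fun s z hs => ?_,
    fun l z hl => (hHg l hl).2 z⟩
  · have h := (hHg l hl).1.deriv z X
    erw [h]
    rw [← mul_assoc, Matrix.nonsing_inv_mul _ ((Matrix.isUnit_iff_isUnit_det _).mp
      ((hHg l hl).1.isUnit (hsm l) z)), one_mul]
  · rw [neg_smul]
    refine hexp _ _ _ ?_
    simp only [θ, smul_apply, ContinuousLinearMap.id_apply, smul_eq_mul]
    rw [mul_right_comm]
  · rw [neg_smul]
    refine hexp _ _ _ ?_
    have h := (hHg s⁻¹ (inv_ne_zero hs)).1.unique (hsm _) (hKg s⁻¹ (inv_ne_zero hs)) z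
    rw [inv_inv] at h
    refine h.trans ?_
    simp only [θ', smul_apply, ContinuousLinearEquiv.coe_coe, Complex.conjCLE_apply, smul_eq_mul]
    rw [mul_right_comm]

end Twisted

/-! ### Renormalised values and eigenvectors -/

/-- The principal square root jumps across the negative axis. Near `l` it is replaced by the
continuous branch `l^{1/2} (w/l)^{1/2}`; the twist condition makes `untwist` independent of the
branch. -/
theorem continuousAt_untwist {η : ℂ → Mat} (hη : ∀ ζ, ζ ≠ 0 → η (-ζ) = tau * η ζ * tau⁻¹)
    (hc : ∀ ζ, ζ ≠ 0 → ContinuousAt η ζ) {l : ℂ} (hl : l ≠ 0) : ContinuousAt (untwist η) l := by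
  set r : ℂ → ℂ := fun w => l ^ (1 / 2 : ℂ) * (w / l) ^ (1 / 2 : ℂ) with hr
  have hsq : ∀ w, r w ^ 2 = w := fun w => by
    simp only [hr, mul_pow]
    simp [hl, mul_div_cancel₀]
  have hr0 : ∀ w, w ≠ 0 → r w ≠ 0 := fun w hw h => hw (by rw [← hsq w, h]; simp)
  have hrc : ContinuousAt r l := by
    refine continuousAt_const.mul (ContinuousAt.cpow (continuousAt_id.div_const l)
      continuousAt_const ?_)
    simp [hl]
  have hηr : ContinuousAt (fun w => η (r w)) l := ContinuousAt.comp (hc _ (hr0 l hl)) hrc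
  have he : ∀ i j, ContinuousAt (fun w => η (r w) i j) l := fun i j =>
    ContinuousAt.comp (f := fun w => η (r w)) (g := fun M : Mat => M i j)
      (continuous_id.matrix_elem i j).continuousAt hηr
  have h : ContinuousAt (fun w => (!![η (r w) 0 0, η (r w) 0 1 * (r w)⁻¹;
      r w * η (r w) 1 0, η (r w) 1 1] : Mat)) l := by
    refine continuousAt_pi.2 fun i => continuousAt_pi.2 fun j => ?_
    fin_cases i <;> fin_cases j
    · exact he 0 0
    · exact (he 0 1).mul (hrc.inv₀ (hr0 l hl))
    · exact hrc.mul (he 1 0)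
    · exact he 1 1
  refine h.congr ?_
  filter_upwards [isOpen_ne.mem_nhds hl] with w hw
  rw [← kappa_conj _ (hr0 w hw), ← untwist_sq η hη _ (hr0 w hw), hsq]

/-- If `m = 0` then `N = η l`, if `m < 0` then `η l = 0`, and `m > 0` would force `N = 0`. Thus
points of the curve always give eigenvectors of `η l` itself, as the exponential argument requires.
-/
theorem IsRenormalizedValue.mulVec_eq {η : ℂ → Mat} {l : ℂ} {N : Mat}
    (hN : IsRenormalizedValue η l N) (hη : ContinuousAt η l) {v : Vec} {μ : ℂ}
    (hv : N *ᵥ v = μ • v) : ∃ ν : ℂ, η l *ᵥ v = ν • v := by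
  obtain ⟨hN0, m, hm⟩ := hN
  have hp : Tendsto η (𝓝[≠] l) (𝓝 (η l)) := hη.tendsto.mono_left nhdsWithin_le_nhds
  have hz : ∀ n : ℕ, n ≠ 0 → Tendsto (fun w : ℂ => (w - l) ^ n) (𝓝[≠] l) (𝓝 0) := fun n hn => by
    have : Continuous fun w : ℂ => (w - l) ^ n := by fun_prop
    have h := (this.tendsto l).mono_left (nhdsWithin_le_nhds (s := {l}ᶜ))
    simpa [hn] using h
  rcases lt_trichotomy m 0 with h | h | h
  · refine ⟨0, ?_⟩
    obtain ⟨n, rfl⟩ : ∃ n : ℕ, m = -n := ⟨m.natAbs, by omega⟩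
    have h1 := (hz n (by omega)).smul hm
    have h2 : η l = (0 : ℂ) • N := by
      refine tendsto_nhds_unique hp (h1.congr' ?_)
      filter_upwards [self_mem_nhdsWithin] with w hw
      have : (w - l) ^ n ≠ 0 := pow_ne_zero _ (sub_ne_zero.2 hw)
      rw [zpow_neg, zpow_natCast, smul_smul, mul_inv_cancel₀ this, one_smul]
    rw [h2]; simp
  · subst h
    have : N = η l := tendsto_nhds_unique (by simpa using hm) hp
    exact ⟨μ, this ▸ hv⟩
  · obtain ⟨n, rfl⟩ : ∃ n : ℕ, m = n := ⟨m.natAbs, by omega⟩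
    have h1 := (hz n (by omega)).smul hp
    refine absurd (tendsto_nhds_unique hm (by simpa using h1)) hN0

/-- Conjugation by a continuous invertible family with continuous inverse changes neither the
exponent `m` nor the nonvanishing of the limit. -/
theorem IsRenormalizedValue.conj {η η' H : ℂ → Mat} {l : ℂ} {N : Mat}
    (hN : IsRenormalizedValue η l N) (hl : l ≠ 0) (hH : ContinuousAt H l)
    (hH' : ContinuousAt (fun w => (H w)⁻¹) l) (hu : ∀ w, IsUnit (H w))
    (h : ∀ w, w ≠ 0 → η w * H w = H w * η' w) :
    IsRenormalizedValue η' l ((H l)⁻¹ * N * H l) := by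
  obtain ⟨hN0, m, hm⟩ := hN
  have hd : ∀ w, IsUnit (H w).det := fun w => (Matrix.isUnit_iff_isUnit_det _).1 (hu w)
  refine ⟨fun h0 => hN0 ?_, m, ?_⟩
  · calc N = H l * ((H l)⁻¹ * N * H l) * (H l)⁻¹ := by
          rw [Matrix.mul_assoc _ N, ← Matrix.mul_assoc, Matrix.mul_nonsing_inv _ (hd l),
            Matrix.one_mul, Matrix.mul_assoc, Matrix.mul_nonsing_inv _ (hd l), Matrix.mul_one]
      _ = 0 := by rw [h0]; simp
  · have h1 := ((hH'.tendsto.mono_left nhdsWithin_le_nhds).mul hm).mul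
      (hH.tendsto.mono_left (nhdsWithin_le_nhds (s := {l}ᶜ)))
    refine h1.congr' ?_
    filter_upwards [mem_nhdsWithin_of_mem_nhds (isOpen_ne.mem_nhds hl)] with w hw
    rw [mul_assoc, smul_mul_assoc, h w hw, mul_smul_comm, ← mul_assoc,
      Matrix.nonsing_inv_mul _ (hd w), one_mul]

theorem exp_mulVec {A : Mat} {v : Vec} {μ : ℂ} (h : A *ᵥ v = μ • v) :
    NormedSpace.exp A *ᵥ v = Complex.exp μ • v := by
  have hp : ∀ n : ℕ, A ^ n *ᵥ v = μ ^ n • v := fun n => by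
    induction n with
    | zero => simp
    | succ n ih =>
      rw [pow_succ, ← Matrix.mulVec_mulVec, h, Matrix.mulVec_smul, ih, smul_smul, pow_succ, mul_comm]
  have h1 : HasSum (fun n : ℕ => ((n.factorial : ℂ)⁻¹ • A ^ n) *ᵥ v) (NormedSpace.exp A *ᵥ v) :=
    (NormedSpace.exp_series_hasSum_exp' (𝕂 := ℂ) A).map
      (LinearMap.flip (Matrix.mulVecBilin ℂ ℂ) v : Mat →ₗ[ℂ] Vec)
      (continuous_id.matrix_mulVec continuous_const)
  have h2 : HasSum (fun n : ℕ => ((n.factorial : ℂ)⁻¹ • μ ^ n) • v) (Complex.exp μ • v) := by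
    rw [Complex.exp_eq_exp_ℂ]
    exact (NormedSpace.exp_series_hasSum_exp' (𝕂 := ℂ) μ).smul_const v
  refine h1.unique (h2.congr_fun ?_)
  intro n
  rw [Matrix.smul_mulVec, hp, smul_smul, smul_eq_mul]

/-- An eigenvector of `η` is one of `exp(k η)`, with eigenvalue `e^{kμ}`. Hence frames differing by
this left factor have inverses with the same projective action on it. -/
theorem exists_smul_of_exp_mul {η E H : Mat} {k μ : ℂ} {v : Vec}
    (hv : η *ᵥ v = μ • v) (hH : IsUnit H) (h : H = NormedSpace.exp (k • η) * E) :
    ∃ a : ℂ, a ≠ 0 ∧ E⁻¹ *ᵥ v = a • (H⁻¹ *ᵥ v) := by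
  have h1 : NormedSpace.exp (k • η) *ᵥ v = Complex.exp (k * μ) • v :=
    exp_mulVec (by rw [Matrix.smul_mulVec, hv, smul_smul])
  have hX : IsUnit (NormedSpace.exp (k • η)).det := by
    have := (Matrix.isUnit_iff_isUnit_det _).1 hH
    rw [h, Matrix.det_mul] at this
    exact isUnit_of_mul_isUnit_left this
  refine ⟨Complex.exp (k * μ), Complex.exp_ne_zero _, ?_⟩
  rw [← Matrix.mulVec_smul, ← h1, h, Matrix.mul_inv_rev, Matrix.mulVec_mulVec, mul_assoc,
    Matrix.nonsing_inv_mul _ hX, mul_one]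

/-! ### Homogeneous coordinates -/

theorem Represents.smul {y : Vec × Vec} {x : P1 × P1} (h : Represents y x) {a b : ℂ} (ha : a ≠ 0)
    (hb : b ≠ 0) : Represents (a • y.1, b • y.2) x := by
  obtain ⟨⟨h1, e1⟩, h2, e2⟩ := h
  refine ⟨⟨smul_ne_zero ha h1, ?_⟩, smul_ne_zero hb h2, ?_⟩
  · rw [e1, Projectivization.mk_eq_mk_iff']
    exact ⟨a⁻¹, by simp [ha]⟩
  · rw [e2, Projectivization.mk_eq_mk_iff']
    exact ⟨b⁻¹, by simp [hb]⟩

theorem Represents.exists_smul {y y' : Vec × Vec} {x : P1 × P1} (h : Represents y x)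
    (h' : Represents y' x) : ∃ a b : ℂ, a ≠ 0 ∧ b ≠ 0 ∧ y'.1 = a • y.1 ∧ y'.2 = b • y.2 := by
  obtain ⟨⟨h1, e1⟩, h2, e2⟩ := h
  obtain ⟨⟨h1', e1'⟩, h2', e2'⟩ := h'
  obtain ⟨a, ha⟩ := (Projectivization.mk_eq_mk_iff' ℂ _ _ h1' h1).1 (e1'.symm.trans e1)
  obtain ⟨b, hb⟩ := (Projectivization.mk_eq_mk_iff' ℂ _ _ h2' h2).1 (e2'.symm.trans e2)
  refine ⟨a, b, ?_, ?_, ha.symm, hb.symm⟩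
  · rintro rfl; exact h1' (by rw [← ha]; simp)
  · rintro rfl; exact h2' (by rw [← hb]; simp)

theorem Represents.affine {y : Vec × Vec} {x : P1 × P1} (h : Represents y x) (h1 : y.1 1 ≠ 0) :
    Represents (![y.1 0 / y.1 1, 1], y.2) x := by
  have := h.smul (inv_ne_zero h1) one_ne_zero
  convert! this using 2
  · ext i; fin_cases i <;> simp [h1, div_eq_inv_mul]
  · simp

theorem Represents.affine' {y : Vec × Vec} {x : P1 × P1} (h : Represents y x) (h1 : y.1 0 ≠ 0) :
    Represents (![1, y.1 1 / y.1 0], y.2) x := by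
  have := h.smul (inv_ne_zero h1) one_ne_zero
  convert! this using 2
  · ext i; fin_cases i <;> simp [h1, div_eq_inv_mul]
  · simp

theorem Represents.of_affine {u v : Vec} {x : P1 × P1} (h1 : u 1 ≠ 0)
    (h : Represents (![u 0 / u 1, 1], v) x) : Represents (u, v) x := by
  have := h.smul h1 one_ne_zero
  convert! this using 2
  · ext i; fin_cases i <;> simp [h1, mul_div_cancel₀]
  · simp

theorem Represents.of_affine' {u v : Vec} {x : P1 × P1} (h1 : u 0 ≠ 0)
    (h : Represents (![1, u 1 / u 0], v) x) : Represents (u, v) x := by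
  have := h.smul h1 one_ne_zero
  convert! this using 2
  · ext i; fin_cases i <;> simp [h1, mul_div_cancel₀]
  · simp

/-! ### Holomorphic maps which are linear in the second factor -/

theorem analyticAt_mulVec {X : Type*} [NormedAddCommGroup X] [NormedSpace ℂ X] {M : ℂ → Mat}
    (hM : Differentiable ℂ M) {f : X → ℂ} {g : X → Vec} {y : X} (hf : AnalyticAt ℂ f y)
    (hg : AnalyticAt ℂ g y) : AnalyticAt ℂ (fun x => M (f x) *ᵥ g x) y := by
  have he : ∀ i j, AnalyticAt ℂ (fun x => M (f x) i j) y := fun i j => by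
    have hd : Differentiable ℂ fun l => M l i j := fun l =>
      (LinearMap.toContinuousLinearMap (Matrix.entryLinearMap ℂ ℂ i j)).differentiableAt.comp l
        (hM l)
    exact (hd.analyticAt (f y)).comp hf
  rw [analyticAt_pi_iff] at hg ⊢
  intro i
  simp only [Matrix.mulVec, dotProduct, Fin.sum_univ_two]
  exact ((he i 0).mul (hg 0)).add ((he i 1).mul (hg 1))

/-- In homogeneous coordinates the map is `(y₁, M(y₁₀/y₁₁) y₂)` off `∞` and `(y₁, M'(y₁₁/y₁₀) y₂)`
off `0`. The two need agree only on `S`, not on the ambient space. -/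
theorem isHolomorphicMap_of_linear {S T : Set (P1 × P1)} {f : S → T} {M M' : ℂ → Mat}
    (hM : Differentiable ℂ M) (hM' : Differentiable ℂ M')
    (h : ∀ (l : ℂ) (v : Vec) (x : S), Represents (![l, 1], v) x →
      Represents (![l, 1], M l *ᵥ v) (f x))
    (h' : ∀ (s : ℂ) (v : Vec) (x : S), Represents (![1, s], v) x →
      Represents (![1, s], M' s *ᵥ v) (f x)) : IsHolomorphicMap f := by
  intro x y hy
  have hc : ∀ i, Continuous fun y : Vec × Vec => y.1 i := fun i => by fun_prop
  have ha : ∀ i, AnalyticAt ℂ (fun y : Vec × Vec => y.1 i) y := fun i =>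
    ((ContinuousLinearMap.proj i : Vec →L[ℂ] ℂ).comp
      (ContinuousLinearMap.fst ℂ Vec Vec)).analyticAt y
  by_cases h1 : y.1 1 = 0
  · have h0 : y.1 0 ≠ 0 := fun h0 => hy.1.1 (by ext i; fin_cases i <;> simpa)
    refine ⟨fun y => (y.1, M' (y.1 1 / y.1 0) *ᵥ y.2),
      analyticAt_fst.prod (analyticAt_mulVec hM' ((ha 1).div (ha 0) h0) analyticAt_snd), ?_⟩
    filter_upwards [(hc 0).continuousAt.eventually_ne h0] with w hw x' hx'
    exact Represents.of_affine' hw (h' _ _ _ (hx'.affine' hw))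
  · refine ⟨fun y => (y.1, M (y.1 0 / y.1 1) *ᵥ y.2),
      analyticAt_fst.prod (analyticAt_mulVec hM ((ha 0).div (ha 1) h1) analyticAt_snd), ?_⟩
    filter_upwards [(hc 1).continuousAt.eventually_ne h1] with w hw x' hx'
    exact Represents.of_affine hw (h _ _ _ (hx'.affine hw))

theorem differentiable_matrix_inv {M : ℂ → Mat} (hM : Differentiable ℂ M)
    (hu : ∀ l, IsUnit (M l)) : Differentiable ℂ fun l => (M l)⁻¹ := by
  simp only [Matrix.nonsing_inv_eq_ringInverse]
  exact fun l => (differentiableAt_inverse (hu l)).comp l (hM l)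

/-! ### Fibrewise linear bijections of `ℙ¹ × ℙ¹` -/

noncomputable section

/-- The projective transformation given by an invertible matrix. -/
def projAct (A : Matˣ) : P1 ≃ P1 :=
  MulAction.toPerm (Matrix.GeneralLinearGroup.toLin A)

theorem mulVec_ne_zero {A : Mat} (hA : IsUnit A) {v : Vec} (hv : v ≠ 0) : A *ᵥ v ≠ 0 := fun h =>
  hv (Matrix.mulVec_injective_of_isUnit hA (by simpa using h))

theorem projAct_mk (A : Matˣ) {v : Vec} (hv : v ≠ 0) :
    projAct A (Projectivization.mk ℂ v hv) =
      Projectivization.mk ℂ ((A : Mat) *ᵥ v) (mulVec_ne_zero A.isUnit hv) := rfl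

theorem projAct_symm (A : Matˣ) : (projAct A).symm = projAct A⁻¹ := by
  ext x
  simp [projAct]

open Classical in
/-- The matrix attached to a point `u` of `ℙ¹`: the value of `M` at `λ` if `u = [λ, 1]` and the value
of `M'` at `0` if `u = [1, 0]`. -/
def glue (M M' : ℂ → Matˣ) (u : P1) : Matˣ :=
  if u.rep 1 = 0 then M' 0 else M (u.rep 0 / u.rep 1)

theorem glue_affine (M M' : ℂ → Matˣ) (l : ℂ) (h : (![l, 1] : Vec) ≠ 0) :
    glue M M' (Projectivization.mk ℂ ![l, 1] h) = M l := by
  obtain ⟨a, ha⟩ := Projectivization.exists_smul_eq_mk_rep ℂ (![l, 1] : Vec) h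
  rw [glue, ← ha]
  simp [Units.smul_def]

theorem glue_infty (M M' : ℂ → Matˣ) (h : (![1, 0] : Vec) ≠ 0) :
    glue M M' (Projectivization.mk ℂ ![1, 0] h) = M' 0 := by
  obtain ⟨a, ha⟩ := Projectivization.exists_smul_eq_mk_rep ℂ (![1, 0] : Vec) h
  rw [glue, ← ha]
  simp

/-- The fibrewise linear bijection of `ℙ¹ × ℙ¹` given by `M` over `ℂ` and by `M' 0` over `∞`. -/
def fibreMap (M M' : ℂ → Matˣ) : P1 × P1 ≃ P1 × P1 :=
  Equiv.prodShear (Equiv.refl _) fun u => projAct (glue M M' u)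

theorem fibreMap_symm (M M' : ℂ → Matˣ) :
    (fibreMap M M').symm = fibreMap (fun l => (M l)⁻¹) fun s => (M' s)⁻¹ := by
  have : ∀ u, glue (fun l => (M l)⁻¹) (fun s => (M' s)⁻¹) u = (glue M M' u)⁻¹ := fun u => by
    unfold glue; split_ifs <;> rfl
  refine Equiv.ext fun x => ?_
  change (x.1, (projAct (glue M M' x.1)).symm x.2) = (x.1, projAct (glue _ _ x.1) x.2)
  rw [this, projAct_symm]

theorem fibreMap_symm_fst (M M' : ℂ → Matˣ) (x : P1 × P1) : ((fibreMap M M').symm x).1 = x.1 := by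
  rw [fibreMap_symm]
  rfl

theorem Represents.fibreMap (M M' : ℂ → Matˣ) {l : ℂ} {v : Vec} {x : P1 × P1}
    (h : Represents (![l, 1], v) x) :
    Represents (![l, 1], (M l : Mat) *ᵥ v) (fibreMap M M' x) := by
  obtain ⟨⟨h1, e1⟩, h2, e2⟩ := h
  refine ⟨⟨h1, e1⟩, mulVec_ne_zero (M l).isUnit h2, ?_⟩
  change projAct (glue M M' x.1) x.2 = _
  rw [e1, e2, glue_affine, projAct_mk]

theorem Represents.fibreMap_infty (M M' : ℂ → Matˣ) {v : Vec} {x : P1 × P1}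
    (h : Represents (![1, 0], v) x) :
    Represents (![1, 0], (M' 0 : Mat) *ᵥ v) (SpectralCurve.fibreMap M M' x) := by
  obtain ⟨⟨h1, e1⟩, h2, e2⟩ := h
  refine ⟨⟨h1, e1⟩, mulVec_ne_zero (M' 0).isUnit h2, ?_⟩
  change projAct (glue M M' x.1) x.2 = _
  rw [e1, e2, glue_infty, projAct_mk]

/-- A fibrewise linear bijection which conjugates the spectral problems and fixes the points over
`0` and `∞` maps the spectral curves into each other. -/
theorem fibreMap_mem_curve {ξ : ℂ → ℂ → Mat} {z w : ℂ} (M M' : ℂ → Matˣ)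
    (hM : Differentiable ℂ fun l => (M l : Mat))
    (h0 : (M 0 : Mat) 1 0 = 0) (h0' : (M' 0 : Mat) 0 1 = 0)
    (h : ∀ l, l ≠ 0 → (M l : Mat) * untwist (ξ z) l = untwist (ξ w) l * (M l : Mat))
    {x : P1 × P1} (hx : x ∈ curve ξ z) : fibreMap M M' x ∈ curve ξ w := by
  rcases hx with (⟨l, hl, v, hv, N, hN, μ, hμ⟩ | hx) | hx
  · refine Or.inl (Or.inl ⟨l, hl, (M l : Mat) *ᵥ v, hv.fibreMap M M', _,
      hN.conj (H := fun l => ((M l)⁻¹ : Matˣ)) hl ?_ ?_ (fun w => Units.isUnit _) ?_, μ, ?_⟩)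
    · simp only [Matrix.coe_units_inv]
      exact (differentiable_matrix_inv hM fun l => (M l).isUnit).continuous.continuousAt
    · simp only [← Matrix.coe_units_inv, inv_inv]
      exact hM.continuous.continuousAt
    · intro u hu
      rw [Units.eq_inv_mul_iff_mul_eq, ← mul_assoc, h u hu, mul_assoc, Units.mul_inv, mul_one]
    · rw [← Matrix.coe_units_inv, inv_inv, Matrix.mulVec_mulVec, mul_assoc, Units.inv_mul, mul_one,
        ← Matrix.mulVec_mulVec, hμ, Matrix.mulVec_smul]
  · refine Or.inl (Or.inr ?_)
    have hx' : Represents (![0, 1], ![1, 0]) x := hx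
    have hr := hx'.fibreMap M M'
    -- Upper triangularity sends `[1, 0]` to a multiple of itself, and invertibility makes the
    -- factor nonzero.
    have hd : (M 0 : Mat) 0 0 ≠ 0 := fun hd => hr.2.1 (by
      ext i; fin_cases i <;> simp [Matrix.mulVec, dotProduct, Fin.sum_univ_two, hd, h0])
    have := hr.smul one_ne_zero (inv_ne_zero hd)
    change Represents _ _
    convert! this using 2
    · simp
    · ext i; fin_cases i <;> simp [hd, h0]
  · refine Or.inr ?_
    have hx' : Represents (![1, 0], ![0, 1]) x := hx
    have hr := hx'.fibreMap_infty M M'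
    have hd : (M' 0 : Mat) 1 1 ≠ 0 := fun hd => hr.2.1 (by
      ext i; fin_cases i <;> simp [Matrix.mulVec, dotProduct, Fin.sum_univ_two, hd, h0'])
    have := hr.smul one_ne_zero (inv_ne_zero hd)
    change Represents _ _
    convert! this using 2
    · simp
    · ext i; fin_cases i <;> simp [hd, h0']

/-! ### The isomorphism of the curves -/

theorem inv_entry_eq_zero {A : Mat} {i j : Fin 2} (hij : i ≠ j) (h : A i j = 0) : A⁻¹ i j = 0 := by
  rw [Matrix.inv_def, Matrix.adjugate_fin_two]
  fin_cases i <;> fin_cases j <;> simp_all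

/-- The bijection acts by `H⁻¹` over finite `λ` and by `K(0)⁻¹` over `∞`. Since `H` and `K` differ
from `E` by exponentials of multiples of `untwist (ξ z)`, all three inverses act alike on
eigenlines; so `K⁻¹` describes the map near `∞` as well, which gives holomorphy there. -/
theorem exists_curve_iso {ξ : ℂ → ℂ → Mat} {z w : ℂ} {H K E : ℂ → Mat}
    (hξ : ∀ ζ, ζ ≠ 0 → ξ z (-ζ) = tau * ξ z ζ * tau⁻¹)
    (hξc : ∀ ζ, ζ ≠ 0 → ContinuousAt (ξ z) ζ)
    (hH : Differentiable ℂ H) (hHu : ∀ l, IsUnit (H l)) (hH0 : H 0 1 0 = 0)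
    (hK : Differentiable ℂ K) (hKu : ∀ l, IsUnit (K l)) (hK0 : K 0 0 1 = 0)
    (hHE : ∀ l, l ≠ 0 → ∃ k : ℂ, H l = NormedSpace.exp (k • untwist (ξ z) l) * E l)
    (hKE : ∀ s, s ≠ 0 → ∃ k : ℂ, K s = NormedSpace.exp (k • untwist (ξ z) s⁻¹) * E s⁻¹)
    (hHc : ∀ l, l ≠ 0 → untwist (ξ z) l * H l = H l * untwist (ξ w) l) :
    ∃ Φ : curve ξ z ≃ curve ξ w, IsCurveIso Φ ∧
      (∀ (l : ℂ) (v : Vec) (x : curve ξ z), l ≠ 0 → Represents (![l, 1], v) x →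
        Represents (![l, 1], (E l)⁻¹ *ᵥ v) (Φ x)) ∧
      (∀ (l : ℂ) (v : Vec) (x : curve ξ z), Represents (![l, 1], v) x →
        Represents (![l, 1], (H l)⁻¹ *ᵥ v) (Φ x)) ∧
      ∀ (s : ℂ) (v : Vec) (x : curve ξ z), Represents (![1, s], v) x →
        Represents (![1, s], (K s)⁻¹ *ᵥ v) (Φ x) := by
  set M : ℂ → Matˣ := fun l => (hHu l).unit⁻¹ with hMdef
  set M' : ℂ → Matˣ := fun s => (hKu s).unit⁻¹ with hM'def
  have hMi : ∀ l, ((M l : Matˣ) : Mat) = (H l)⁻¹ := fun l => Matrix.coe_units_inv _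
  have hMi' : ∀ l, ((M' l : Matˣ) : Mat) = (K l)⁻¹ := fun l => Matrix.coe_units_inv _
  have hdH : ∀ l, IsUnit (H l).det := fun l => (Matrix.isUnit_iff_isUnit_det _).1 (hHu l)
  have hHd := differentiable_matrix_inv hH hHu
  have hKd := differentiable_matrix_inv hK hKu
  have hto : ∀ x ∈ curve ξ z, fibreMap M M' x ∈ curve ξ w := fun x hx => by
    refine fibreMap_mem_curve M M' (by simpa only [hMi] using hHd) ?_ ?_ ?_ hx
    · rw [hMi]; exact inv_entry_eq_zero (by decide) hH0
    · rw [hMi']; exact inv_entry_eq_zero (by decide) hK0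
    · intro l hl
      rw [hMi]
      calc _ = (H l)⁻¹ * (untwist (ξ z) l * H l) * (H l)⁻¹ := by
            rw [mul_assoc _ _ (H l)⁻¹, mul_assoc _ (H l), Matrix.mul_nonsing_inv _ (hdH l), mul_one]
        _ = _ := by
            rw [hHc l hl, ← mul_assoc, Matrix.nonsing_inv_mul _ (hdH l), one_mul]
  have hfrom : ∀ x ∈ curve ξ w, (fibreMap M M').symm x ∈ curve ξ z := fun x hx => by
    rw [fibreMap_symm]
    simp only [hMdef, hM'def, inv_inv]
    exact fibreMap_mem_curve _ _ hH hH0 hK0 (fun l hl => (hHc l hl).symm) hx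
  obtain ⟨Φ, hΦ, hsy⟩ : ∃ Φ : curve ξ z ≃ curve ξ w,
      (∀ x, (Φ x : P1 × P1) = fibreMap M M' x) ∧
        ∀ x, (Φ.symm x : P1 × P1) = (fibreMap M M').symm x :=
    ⟨(fibreMap M M').subtypeEquiv fun x => ⟨hto x, fun hx => by simpa using hfrom _ hx⟩,
      fun _ => rfl, fun _ => rfl⟩
  have hcH : ∀ (l : ℂ) (v : Vec) (x : curve ξ z), Represents (![l, 1], v) x →
      Represents (![l, 1], (H l)⁻¹ *ᵥ v) (Φ x) := fun l v x hx => by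
    rw [← hMi, hΦ]; exact hx.fibreMap M M'
  have heig : ∀ (l : ℂ) (v : Vec) (x : curve ξ z), l ≠ 0 → Represents (![l, 1], v) x →
      ∃ ν : ℂ, untwist (ξ z) l *ᵥ v = ν • v := fun l v x hl hx => by
    rcases x.2 with (⟨l', hl', v', hv', N, hN, μ, hμ⟩ | hx') | hx'
    · obtain ⟨a, b, ha, hb, h1, h2⟩ := hv'.exists_smul hx
      have ha1 := congrFun h1 1
      have ha0 := congrFun h1 0
      simp only [Matrix.cons_val_zero, Matrix.cons_val_one, Pi.smul_apply, smul_eq_mul,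
        mul_one] at ha0 ha1
      rw [← ha1, one_mul] at ha0
      subst ha0
      simp only at h2
      refine hN.mulVec_eq (continuousAt_untwist hξ hξc hl) (μ := μ) ?_
      rw [h2, Matrix.mulVec_smul, hμ, smul_comm]
    · obtain ⟨a, b, ha, hb, h1, h2⟩ := Represents.exists_smul hx' hx
      exact absurd (by simpa using congrFun h1 0) hl
    · obtain ⟨a, b, ha, hb, h1, h2⟩ := Represents.exists_smul hx' hx
      exact absurd (congrFun h1 1) (by simp)
  have hcE : ∀ (l : ℂ) (v : Vec) (x : curve ξ z), l ≠ 0 → Represents (![l, 1], v) x →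
      Represents (![l, 1], (E l)⁻¹ *ᵥ v) (Φ x) := fun l v x hl hx => by
    obtain ⟨ν, hν⟩ := heig l v x hl hx
    obtain ⟨k, hk⟩ := hHE l hl
    obtain ⟨a, ha, hE⟩ := exists_smul_of_exp_mul hν (hHu l) hk
    rw [hE]
    simpa using (hcH l v x hx).smul one_ne_zero ha
  have hcK : ∀ (s : ℂ) (v : Vec) (x : curve ξ z), Represents (![1, s], v) x →
      Represents (![1, s], (K s)⁻¹ *ᵥ v) (Φ x) := fun s v x hx => by
    -- At `s = 0` this is the definition of the bijection; elsewhere the formula is transferred from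
    -- `H` through `E`, using that `v` is an eigenvector.
    rcases eq_or_ne s 0 with rfl | hs
    · rw [← hMi', hΦ]; exact Represents.fibreMap_infty M M' hx
    · have hx1 : Represents (![s⁻¹, 1], v) x := by
        simpa using hx.affine (by simpa using hs)
      obtain ⟨ν, hν⟩ := heig s⁻¹ v x (inv_ne_zero hs) hx1
      obtain ⟨k, hk⟩ := hKE s hs
      obtain ⟨a, ha, hE⟩ := exists_smul_of_exp_mul hν (hKu s) hk
      have h1 := hcE s⁻¹ v x (inv_ne_zero hs) hx1
      rw [hE] at h1
      have h2 := h1.smul one_ne_zero (inv_ne_zero ha)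
      simp only [one_smul, smul_smul, inv_mul_cancel₀ ha] at h2
      simpa using h2.affine' (by simpa using hs)
  refine ⟨Φ, ⟨isHolomorphicMap_of_linear hHd hKd hcH hcK, ?_⟩, hcE, hcH, hcK⟩
  have hsH : ∀ (l : ℂ) (v : Vec) (x : curve ξ w), Represents (![l, 1], v) x →
      Represents (![l, 1], H l *ᵥ v) (Φ.symm x) := fun l v x hx => by
    rw [hsy, fibreMap_symm]
    simp only [hMdef, hM'def, inv_inv]
    exact hx.fibreMap (fun l => (hHu l).unit) fun s => (hKu s).unit
  have hsK : ∀ (s : ℂ) (v : Vec) (x : curve ξ w), Represents (![1, s], v) x →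
      Represents (![1, s], K s *ᵥ v) (Φ.symm x) := fun s v x hx => by
    -- Away from the curve the ambient bijection near `∞` acts by `H`, not `K`, so the inverse
    -- cannot be read off it directly. Instead the formula for `Φ` is applied to the preimage and
    -- inverted.
    have hu : Represents (![1, s], (Φ.symm x : P1 × P1).2.rep) (Φ.symm x) :=
      ⟨by rw [hsy, fibreMap_symm_fst]; exact hx.1, Projectivization.rep_nonzero _,
        (Projectivization.mk_rep _).symm⟩
    have h1 := hcK s _ _ hu
    rw [Φ.apply_symm_apply] at h1
    obtain ⟨a, b, ha, hb, -, h2⟩ := h1.exists_smul hx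
    simp only at h2
    rw [h2, Matrix.mulVec_smul, Matrix.mulVec_mulVec, Matrix.mul_nonsing_inv _
      ((Matrix.isUnit_iff_isUnit_det _).1 (hKu s)), Matrix.one_mulVec]
    simpa using hu.smul one_ne_zero hb
  exact isHolomorphicMap_of_linear hH hK hsH hsK

theorem IsPolynomialKillingField.continuousAt {F : ℂ → Mat} {ξ : ℂ → ℂ → Mat}
    (hξ : IsPolynomialKillingField F ξ) (z : ℂ) {ζ : ℂ} (hζ : ζ ≠ 0) : ContinuousAt (ξ z) ζ := by
  have h : ContinuousAt (fun q : ℂ × ℂ => ξ q.1 q.2) (z, ζ) :=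
    hξ.smooth.continuousOn.continuousAt
      ((isOpen_ne_fun continuous_snd continuous_const).mem_nhds hζ)
  exact ContinuousAt.comp (f := fun w => (z, w)) h (by fun_prop)

end

end SpectralCurve

/-! ### Assembly of the theorem -/

theorem mainTheorem10
    (φ : ℂ → EuclideanSpace ℝ (Fin 3)) (F : ℂ → SpectralCurve.Mat) (ξ : ℂ → ℂ → SpectralCurve.Mat)
    (hφ : SpectralCurve.IsHarmonicMap φ)
    (hF : SpectralCurve.IsFraming φ F)
    (hss : SpectralCurve.IsSemisimpleFrame F)
    (hξ : SpectralCurve.IsPolynomialKillingField F ξ) :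
    ∃ (E : ℂ → ℂ → SpectralCurve.Mat) (p : ℕ) (c : ℂ),
      -- the extended frame `F_λ(z)`
      SpectralCurve.IsExtendedFrame F E ∧
      -- `ξ_ζ = c ζ^{-2p-1} α_𝔪(∂/∂z) + … + c̄ ζ^{2p+1} α_𝔪(∂/∂z̄)`, with `p` and `c` independent of `z`
      0 < p ∧ c ≠ 0 ∧
      (∀ z : ℂ, ∃ C : ℤ → SpectralCurve.Mat,
        SpectralCurve.HasLaurentExpansion (ξ z) (2 * p + 1) C ∧
        C (-(2 * (p : ℤ) + 1)) = c • SpectralCurve.alphaMdz F z ∧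
        C (2 * (p : ℤ) + 1) = (starRingEnd ℂ c) • SpectralCurve.alphaMdzbar F z) ∧
      ∀ z : ℂ, ∃ Φ : SpectralCurve.curve ξ 0 ≃ SpectralCurve.curve ξ z,
        SpectralCurve.IsCurveIso Φ ∧
        -- over `λ ≠ 0, ∞` it is `(λ, [v]) ↦ (λ, [F_λ⁻¹ v])`
        (∀ (l : ℂ) (v : SpectralCurve.Vec) (x : SpectralCurve.curve ξ 0), l ≠ 0 →
          SpectralCurve.Represents (![l, 1], v) x →
          SpectralCurve.Represents (![l, 1], (E z l)⁻¹ *ᵥ v) (Φ x)) ∧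
        -- `H₊ = exp(-c⁻¹ z λ^p ξ_λ(0)) F_λ` extends holomorphically to `λ = 0`, and gives `Φ` near `P₀`
        (∃ H : ℂ → SpectralCurve.Mat, Differentiable ℂ H ∧ (∀ l, IsUnit (H l)) ∧
          (∀ l : ℂ, l ≠ 0 →
            H l = NormedSpace.exp (-(c⁻¹ * z * l ^ p) • SpectralCurve.untwist (ξ 0) l) * E z l) ∧
          ∀ (l : ℂ) (v : SpectralCurve.Vec) (x : SpectralCurve.curve ξ 0),
            SpectralCurve.Represents (![l, 1], v) x →
            SpectralCurve.Represents (![l, 1], (H l)⁻¹ *ᵥ v) (Φ x)) ∧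
        -- `H₋ = exp(-c̄⁻¹ z̄ λ^{-p} ξ_λ(0)) F_λ`, with `λ = s⁻¹`, extends holomorphically to `s = 0`,
        -- and gives `Φ` near `P_∞`
        (∃ K : ℂ → SpectralCurve.Mat, Differentiable ℂ K ∧ (∀ s, IsUnit (K s)) ∧
          (∀ s : ℂ, s ≠ 0 →
            K s = NormedSpace.exp
              (-((starRingEnd ℂ c)⁻¹ * (starRingEnd ℂ z) * s ^ p) •
                SpectralCurve.untwist (ξ 0) s⁻¹) * E z s⁻¹) ∧
          ∀ (s : ℂ) (v : SpectralCurve.Vec) (x : SpectralCurve.curve ξ 0),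
            SpectralCurve.Represents (![1, s], v) x →
            SpectralCurve.Represents (![1, s], (K s)⁻¹ *ᵥ v) (Φ x)) := by
  obtain ⟨E, p, c, C, H, K, hE, hp, hc, hC, hbot, htop, hH, hHu, hH0, hK, hKu, hK0, hHE, hKE, hHc⟩ :=
    SpectralCurve.exists_extended_frames hF hss hξ
  refine ⟨E, p, c, hE, hp, hc, fun z => ⟨C z, hC z, hbot z, htop z⟩, fun z => ?_⟩
  obtain ⟨Φ, hΦ, h1, h2, h3⟩ := SpectralCurve.exists_curve_iso (ξ := ξ) (z := 0) (w := z)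
    (H := fun l => H l z) (K := fun s => K s z) (E := E z)
    (hξ.twisted 0)
    (fun ζ hζ => hξ.continuousAt 0 hζ)
    (hH z) (fun l => hHu l z) (hH0 z) (hK z) (fun s => hKu s z) (hK0 z)
    (fun l hl => ⟨_, hHE l z hl⟩) (fun s hs => ⟨_, hKE s z hs⟩) (fun l hl => hHc l z hl)
  exact ⟨Φ, hΦ, h1, ⟨fun l => H l z, hH z, fun l => hHu l z, fun l hl => hHE l z hl, h2⟩,
    fun s => K s z, hK z, fun s => hKu s z, fun s hs => hKE s z hs, h3⟩
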